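/- **Setting.** Let $\Omega\subset\mathbb R^2$ be a bounded connected open set with Lipschitz boundary. Let $h\in L^\infty(\Omega)$, and let $c,\sigma$ be positive measurable functions on $\Omega$ that are bounded with bounded inverse. Let $\partial\Omega$ be partitioned into measurable sets $\Gamma_N,\Gamma_D,\Gamma_R,\Gamma_\sharp$ (any of which may be empty). On $\Gamma_R$ a bounded measurable function $a>0$ is given. $\Gamma_\sharp$ is the union of finitely many measurable sets $G_j$ and their translates $G_j+v_j$, and a function on $\partial\Omega$ is called periodic on $\Gamma_\sharp$ if its values at $x$ and $x+v_j$ agree for almost every $x\in G_j$ and every $j$. Let $$V=\{s\in H^1(\Omega):\ s=0\text{ on }\Gamma_D,\ s\text{ periodic on }\Gamma_\sharp\}$$ in the sense of traces. The constants are called controlled if $\Gamma_D\cup\Gamma_R$ has positive length. Put $H=V$ if the constants are controlled and $H=V/\mathbb R$ otherwise, and $\mathcal H=L^2(\Omega)\times H$ with $$\big((u,s)\,|\,(u',s')\big)_{\mathcal H}=\int_\Omega c\,uu'+\int_\Omega\sigma\nabla s\cdot\nabla s'+\int_{\Gamma_R}a\,ss'.$$ The Graetz operator is $\mathcal A(u,s)=\big(c^{-1}(hu-\operatorname{div}(\sigma\nabla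 s)),\,u\big)$; its domain consists of the $(u,s)\in\mathcal H$ such that $u\in V$, $\operatorname{div}(\sigma\nabla s)\in L^2(\Omega)$ and, in the weak sense, $\sigma\nabla s\cdot n=0$ on $\Gamma_N$, $\sigma\nabla s\cdot n+as=0$ on $\Gamma_R$, and the flux $\sigma\nabla s$ through $\Gamma_\sharp$ is periodic; that is, there is $f\in L^2(\Omega)$ (namely $f=-\operatorname{div}(\sigma\nabla s)$) with $\int_\Omega\sigma\nabla s\cdot\nabla v+\int_{\Gamma_R}a\,sv=\int_\Omega fv$ for all $v\in V$. Let $P(u,s)=(u,0)$. Let $\pi_-$ and $\pi_+$ be the orthogonal projections of $\mathcal H$ onto the closed spans of the eigenvectors of $\mathcal A$ with negative and with positive eigenvalues, respectively, and let $\mathcal R(\pi_\pm)$ be their ranges. For $\varphi\in\mathcal H$ put $$\|\varphi\|_{1/2}=\Big(\sum_\lambda|\lambda|\,\|E_\lambda\varphi\|_{\mathcal H}^2\Big)^{1/2}\in[0,\infty],$$ where the sum is over the eigenvalues $\lambda$ of $\mathcal A$ and $E_\lambda$ is the orthogonal projection onto the eigenspace of $\lambda$. **Theorem.** The form $(\cdot|\cdot)_{\mathcal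 H}$ is an inner product (i.e. it is definite) that makes $\mathcal H$ a Hilbert space, and the following holds. The operator $\pi_-P\pi_-$ is invertible on $\mathcal R(\pi_-)$ (a bijection of $\mathcal R(\pi_-)$ with bounded inverse). The operator $B_-=\pi_-(\pi_-P\pi_-)^{-1}\pi_-$ on $\mathcal H$ is bounded and self-adjoint, and there is a constant $C$ such that for all $\varphi\in\mathcal H$ $$\|B_-\varphi\|_{\mathcal H}\le C\|\pi_-\varphi\|_{\mathcal H}\qquad\text{and}\qquad\|B_-\varphi\|_{1/2}\le C\|\pi_-\varphi\|_{1/2}.$$ The same holds with $\pi_+$ and $B_+=\pi_+(\pi_+P\pi_+)^{-1}\pi_+$ in place of $\pi_-$ and $B_-$. -/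

import Mathlib

open MeasureTheory Set Filter Topology
open scoped ENNReal ContDiff

noncomputable section

namespace Graetz

/-- The Euclidean plane, which contains the cross section of the pipe. -/
abbrev Plane : Type := EuclideanSpace ℝ (Fin 2)

/-- Length (one-dimensional Hausdorff measure) in the plane. -/
abbrev len : Measure Plane := Measure.hausdorffMeasure 1

/-- Lipschitz boundary: near each boundary point, in suitable orthonormal coordinates centred there,
the set is the part of the plane strictly above the graph of a Lipschitz function. -/
def HasLipschitzBoundary (Ω : Set Plane) : Prop :=
  ∀ p ∈ frontier Ω, ∃ (e : Plane ≃ₗᵢ[ℝ] Plane) (γ : ℝ → ℝ) (K : NNReal) (r : ℝ),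
    LipschitzWith K γ ∧ 0 < r ∧
      ∀ x ∈ Metric.ball p r, x ∈ Ω ↔ γ (e (x - p) 0) < e (x - p) 1

/-- The data of a generalized Graetz problem: the cross section `Ω`, the velocity `h`, the diffusion
coefficients `c` and `σ`, and the lateral boundary conditions. The boundary is partitioned into a
Neumann part `ΓN`, a Dirichlet part `ΓD`, a Robin part `ΓR` with coefficient `a`, and a periodic part
`Γper`. The periodic part consists of finitely many pieces `piece j` and their translates by
`shift j`; the condition identifies the values at `x` and `x + shift j` for `x ∈ piece j`. Any of the
four parts may be empty. -/
structure Data where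
  Ω : Set Plane
  isOpen_Ω : IsOpen Ω
  isConnected_Ω : IsConnected Ω
  isBounded_Ω : Bornology.IsBounded Ω
  lipschitz_Ω : HasLipschitzBoundary Ω
  h : Plane → ℝ
  c : Plane → ℝ
  σ : Plane → ℝ
  measurable_h : Measurable h
  measurable_c : Measurable c
  measurable_σ : Measurable σ
  h_bound : ∃ M : ℝ, ∀ᵐ x ∂(volume.restrict Ω), |h x| ≤ M
  c_bound : ∃ m M : ℝ, 0 < m ∧ ∀ᵐ x ∂(volume.restrict Ω), m ≤ c x ∧ c x ≤ M
  σ_bound : ∃ m M : ℝ, 0 < m ∧ ∀ᵐ x ∂(volume.restrict Ω), m ≤ σ x ∧ σ x ≤ M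
  ΓN : Set Plane
  ΓD : Set Plane
  ΓR : Set Plane
  Γper : Set Plane
  measurableSet_ΓN : MeasurableSet ΓN
  measurableSet_ΓD : MeasurableSet ΓD
  measurableSet_ΓR : MeasurableSet ΓR
  measurableSet_Γper : MeasurableSet Γper
  cover : ΓN ∪ ΓD ∪ ΓR ∪ Γper = frontier Ω
  disjoint_ND : Disjoint ΓN ΓD
  disjoint_NR : Disjoint ΓN ΓR
  disjoint_Nper : Disjoint ΓN Γper
  disjoint_DR : Disjoint ΓD ΓR
  disjoint_Dper : Disjoint ΓD Γper
  disjoint_Rper : Disjoint ΓR Γper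
  a : Plane → ℝ
  measurable_a : Measurable a
  a_bound : ∃ M : ℝ, ∀ x ∈ ΓR, 0 < a x ∧ a x ≤ M
  numPieces : ℕ
  piece : Fin numPieces → Set Plane
  shift : Fin numPieces → Plane
  measurableSet_piece : ∀ j, MeasurableSet (piece j)
  periodic_cover : Γper = ⋃ j, (piece j ∪ (fun x => x + shift j) '' piece j)

namespace Data

variable (D : Data)

/-- Lebesgue measure on `Ω`. -/
abbrev vol : Measure Plane := volume.restrict D.Ω

/-- Length measure on `∂Ω`. -/
abbrev bd : Measure Plane := len.restrict (frontier D.Ω)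

/-- Triples (function, gradient, boundary values), all square integrable. -/
abbrev Triple : Type := Lp ℝ 2 D.vol × Lp Plane 2 D.vol × Lp ℝ 2 D.bd

/-- `G` is the weak gradient of `s` in `Ω`. -/
def IsWeakGradient (s : Lp ℝ 2 D.vol) (G : Lp Plane 2 D.vol) : Prop :=
  ∀ φ : Plane → ℝ, ContDiff ℝ ∞ φ → HasCompactSupport φ → tsupport φ ⊆ D.Ω →
    ∫ x in D.Ω, s x • gradient φ x = -∫ x in D.Ω, φ x • G x

/-- `g` is the trace on `∂Ω` of the function `s` with gradient `G`: there are functions smooth up to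
the boundary that converge to `s` in `H¹(Ω)` and whose boundary values converge to `g` in `L²(∂Ω)`.
On a bounded Lipschitz domain each function in `H¹(Ω)` has exactly one trace. -/
def IsTrace (s : Lp ℝ 2 D.vol) (G : Lp Plane 2 D.vol) (g : Lp ℝ 2 D.bd) : Prop :=
  ∀ ε : ℝ≥0∞, 0 < ε → ∃ f : Plane → ℝ, ContDiff ℝ ∞ f ∧
    eLpNorm (fun x => f x - s x) 2 D.vol ≤ ε ∧
    eLpNorm (fun x => gradient f x - G x) 2 D.vol ≤ ε ∧
    eLpNorm (fun x => f x - g x) 2 D.bd ≤ ε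

/-- The boundary values `g` vanish on the Dirichlet part. -/
def VanishesOnDirichlet (g : Lp ℝ 2 D.bd) : Prop :=
  ∀ᵐ x ∂(len.restrict D.ΓD), g x = 0

/-- The boundary values `g` are periodic on the periodic part. -/
def IsPeriodic (g : Lp ℝ 2 D.bd) : Prop :=
  ∀ j, ∀ᵐ x ∂(len.restrict (D.piece j)), g (x + D.shift j) = g x

theorem contDiff_gradient_continuous {f : Plane → ℝ} (hf : ContDiff ℝ ∞ f) :
    Continuous (gradient f) := by
  unfold gradient
  exact (InnerProductSpace.toDual ℝ Plane).symm.continuous.comp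
    (hf.continuous_fderiv (by simp))

theorem gradient_add' {f g : Plane → ℝ} (hf : ContDiff ℝ ∞ f) (hg : ContDiff ℝ ∞ g) (x : Plane) :
    gradient (fun y => f y + g y) x = gradient f x + gradient g x := by
  have h1 : DifferentiableAt ℝ f x := (hf.differentiable (by simp)) x
  have h2 : DifferentiableAt ℝ g x := (hg.differentiable (by simp)) x
  unfold gradient
  rw [fderiv_fun_add h1 h2, map_add]

theorem gradient_smul' {f : Plane → ℝ} (hf : ContDiff ℝ ∞ f) (r : ℝ) (x : Plane) :
    gradient (fun y => r * f y) x = r • gradient f x := by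
  have h1 : DifferentiableAt ℝ f x := (hf.differentiable (by simp)) x
  unfold gradient
  rw [fderiv_const_mul h1]
  simp

theorem gradient_compact {f : Plane → ℝ} (hf : HasCompactSupport f) :
    HasCompactSupport (gradient f) := by
  unfold gradient
  exact (hf.fderiv (𝕜 := ℝ)).comp_left (map_zero _)

theorem integrable_smul_gradient (s : Lp ℝ 2 D.vol) {φ : Plane → ℝ} (hφ : ContDiff ℝ ∞ φ)
    (hc : HasCompactSupport φ) : Integrable (fun x => s x • gradient φ x) D.vol := by
  have h1 : MemLp (gradient φ) 2 D.vol :=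
    (contDiff_gradient_continuous hφ).memLp_of_hasCompactSupport (gradient_compact hc)
  exact memLp_one_iff_integrable.1 (h1.smul (Lp.memLp s))

theorem integrable_smul_grad (G : Lp Plane 2 D.vol) {φ : Plane → ℝ} (hφ : ContDiff ℝ ∞ φ)
    (hc : HasCompactSupport φ) : Integrable (fun x => φ x • G x) D.vol := by
  have h1 : MemLp φ 2 D.vol := hφ.continuous.memLp_of_hasCompactSupport hc
  exact memLp_one_iff_integrable.1 ((Lp.memLp G).smul h1)

theorem isWeakGradient_add {s s' : Lp ℝ 2 D.vol} {G G' : Lp Plane 2 D.vol}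
    (h : D.IsWeakGradient s G) (h' : D.IsWeakGradient s' G') :
    D.IsWeakGradient (s + s') (G + G') := by
  intro φ hφ hc hs
  have e1 : ∫ x in D.Ω, (s + s') x • gradient φ x
      = ∫ x in D.Ω, (s x • gradient φ x + s' x • gradient φ x) := by
    apply integral_congr_ae
    filter_upwards [Lp.coeFn_add s s'] with x hx
    rw [hx, Pi.add_apply, add_smul]
  have e2 : ∫ x in D.Ω, φ x • (G + G') x = ∫ x in D.Ω, (φ x • G x + φ x • G' x) := by
    apply integral_congr_ae
    filter_upwards [Lp.coeFn_add G G'] with x hx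
    rw [hx, Pi.add_apply, smul_add]
  rw [e1, e2, integral_add (D.integrable_smul_gradient s hφ hc) (D.integrable_smul_gradient s' hφ hc),
    integral_add (D.integrable_smul_grad G hφ hc) (D.integrable_smul_grad G' hφ hc),
    h φ hφ hc hs, h' φ hφ hc hs, neg_add]

theorem isWeakGradient_smul (r : ℝ) {s : Lp ℝ 2 D.vol} {G : Lp Plane 2 D.vol}
    (h : D.IsWeakGradient s G) : D.IsWeakGradient (r • s) (r • G) := by
  intro φ hφ hc hs
  have e1 : ∫ x in D.Ω, (r • s) x • gradient φ x = ∫ x in D.Ω, r • (s x • gradient φ x) := by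
    apply integral_congr_ae
    filter_upwards [Lp.coeFn_smul r s] with x hx
    rw [hx, Pi.smul_apply, smul_assoc]
  have e2 : ∫ x in D.Ω, φ x • (r • G) x = ∫ x in D.Ω, r • (φ x • G x) := by
    apply integral_congr_ae
    filter_upwards [Lp.coeFn_smul r G] with x hx
    rw [hx, Pi.smul_apply, smul_comm]
  rw [e1, e2, integral_smul, integral_smul, h φ hφ hc hs, smul_neg]

theorem eLpNorm_sub_add_le {E : Type*} [NormedAddCommGroup E] {μ : Measure Plane} {f f' : Plane → E}
    (hf : AEStronglyMeasurable f μ) (hf' : AEStronglyMeasurable f' μ) (s s' : Lp E 2 μ) {ε : ℝ≥0∞}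
    (h : eLpNorm (fun x => f x - s x) 2 μ ≤ ε / 2) (h' : eLpNorm (fun x => f' x - s' x) 2 μ ≤ ε / 2) :
    eLpNorm (fun x => (f x + f' x) - (s + s') x) 2 μ ≤ ε := by
  have e : eLpNorm (fun x => (f x + f' x) - (s + s') x) 2 μ
      = eLpNorm ((fun x => f x - s x) + (fun x => f' x - s' x)) 2 μ := by
    apply eLpNorm_congr_ae
    filter_upwards [Lp.coeFn_add s s'] with x hx
    rw [hx]
    simp only [Pi.add_apply]
    abel
  rw [e]
  refine (eLpNorm_add_le (hf.sub (Lp.aestronglyMeasurable s))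
    (hf'.sub (Lp.aestronglyMeasurable s')) (by norm_num)).trans ?_
  exact (add_le_add h h').trans (ENNReal.add_halves ε).le

theorem eLpNorm_sub_smul_le {E : Type*} [NormedAddCommGroup E] [NormedSpace ℝ E]
    {μ : Measure Plane} {f : Plane → E} (s : Lp E 2 μ) {ε : ℝ≥0∞} (r : ℝ)
    (h : eLpNorm (fun x => f x - s x) 2 μ ≤ ε / (‖r‖ₑ + 1)) :
    eLpNorm (fun x => r • f x - (r • s) x) 2 μ ≤ ε := by
  have e : eLpNorm (fun x => r • f x - (r • s) x) 2 μ = eLpNorm (r • fun x => f x - s x) 2 μ := by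
    apply eLpNorm_congr_ae
    filter_upwards [Lp.coeFn_smul r s] with x hx
    rw [hx]
    simp only [Pi.smul_apply, smul_sub]
  rw [e]
  refine eLpNorm_const_smul_le.trans ?_
  have h1 : ‖r‖ₑ * (ε / (‖r‖ₑ + 1)) ≤ (‖r‖ₑ + 1) * (ε / (‖r‖ₑ + 1)) := by
    gcongr
    exact le_self_add
  exact (mul_le_mul_right h _).trans (h1.trans ENNReal.mul_div_le)

theorem isTrace_add {s s' : Lp ℝ 2 D.vol} {G G' : Lp Plane 2 D.vol} {g g' : Lp ℝ 2 D.bd}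
    (h : D.IsTrace s G g) (h' : D.IsTrace s' G' g') : D.IsTrace (s + s') (G + G') (g + g') := by
  intro ε hε
  obtain ⟨f, hf, h1, h2, h3⟩ := h (ε / 2) (ENNReal.half_pos hε.ne')
  obtain ⟨f', hf', h1', h2', h3'⟩ := h' (ε / 2) (ENNReal.half_pos hε.ne')
  refine ⟨fun x => f x + f' x, hf.add hf', ?_, ?_, ?_⟩
  · exact eLpNorm_sub_add_le hf.continuous.aestronglyMeasurable
      hf'.continuous.aestronglyMeasurable s s' h1 h1'
  · simp only [gradient_add' hf hf']
    exact eLpNorm_sub_add_le (contDiff_gradient_continuous hf).aestronglyMeasurable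
      (contDiff_gradient_continuous hf').aestronglyMeasurable G G' h2 h2'
  · exact eLpNorm_sub_add_le hf.continuous.aestronglyMeasurable
      hf'.continuous.aestronglyMeasurable g g' h3 h3'

theorem isTrace_smul (r : ℝ) {s : Lp ℝ 2 D.vol} {G : Lp Plane 2 D.vol} {g : Lp ℝ 2 D.bd}
    (h : D.IsTrace s G g) : D.IsTrace (r • s) (r • G) (r • g) := by
  intro ε hε
  obtain ⟨f, hf, h1, h2, h3⟩ := h (ε / (‖r‖ₑ + 1))
    (ENNReal.div_pos hε.ne' (by simp [enorm_ne_top]))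
  refine ⟨fun x => r * f x, contDiff_const.mul hf, ?_, ?_, ?_⟩
  · exact eLpNorm_sub_smul_le s r h1
  · simp only [gradient_smul' hf]
    exact eLpNorm_sub_smul_le G r h2
  · exact eLpNorm_sub_smul_le g r h3

theorem isTrace_zero : D.IsTrace 0 0 0 := by
  intro ε hε
  refine ⟨fun _ => 0, contDiff_const, ?_, ?_, ?_⟩
  · rw [eLpNorm_congr_ae (g := 0)]
    · simp
    · filter_upwards [Lp.coeFn_zero ℝ 2 D.vol] with x hx
      simp only [hx, Pi.zero_apply]
      simp
  · rw [eLpNorm_congr_ae (g := 0)]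
    · simp
    · filter_upwards [Lp.coeFn_zero Plane 2 D.vol] with x hx
      simp only [hx, Pi.zero_apply]
      simp [gradient]
  · rw [eLpNorm_congr_ae (g := 0)]
    · simp
    · filter_upwards [Lp.coeFn_zero ℝ 2 D.bd] with x hx
      simp only [hx, Pi.zero_apply]
      simp

theorem ΓD_subset : D.ΓD ⊆ frontier D.Ω := by
  rw [← D.cover]
  intro x hx
  simp [hx]

theorem Γper_subset : D.Γper ⊆ frontier D.Ω := by
  rw [← D.cover]
  intro x hx
  simp [hx]

theorem piece_subset (j : Fin D.numPieces) : D.piece j ⊆ frontier D.Ω := by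
  refine Subset.trans ?_ D.Γper_subset
  rw [D.periodic_cover]
  exact subset_iUnion_of_subset j subset_union_left

theorem ae_piece {p : Plane → Prop} (hp : ∀ᵐ x ∂D.bd, p x) (j : Fin D.numPieces) :
    ∀ᵐ x ∂(len.restrict (D.piece j)), p x :=
  ae_restrict_of_ae_restrict_of_subset (D.piece_subset j) hp

theorem ae_shift {p : Plane → Prop} (hp : ∀ᵐ x ∂D.bd, p x) (j : Fin D.numPieces) :
    ∀ᵐ x ∂(len.restrict (D.piece j)), p (x + D.shift j) := by
  have hmp : MeasurePreserving (fun x => x + D.shift j) len len :=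
    (IsometryEquiv.addRight (D.shift j)).measurePreserving_hausdorffMeasure 1
  rw [ae_restrict_iff' isClosed_frontier.measurableSet] at hp
  have h2 := hmp.quasiMeasurePreserving.ae hp
  rw [ae_restrict_iff' (D.measurableSet_piece j)]
  filter_upwards [h2] with x hx hxj
  apply hx
  apply D.Γper_subset
  rw [D.periodic_cover]
  exact mem_iUnion.2 ⟨j, Or.inr ⟨x, hxj, rfl⟩⟩

/-- The functions in `H¹(Ω)` that vanish on `ΓD` and are periodic on `Γper`. An element is a Sobolev
function together with its weak gradient and its trace, which the function determines. -/
def sobolev : Submodule ℝ D.Triple where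
  carrier := {w | D.IsWeakGradient w.1 w.2.1 ∧ D.IsTrace w.1 w.2.1 w.2.2 ∧
    D.VanishesOnDirichlet w.2.2 ∧ D.IsPeriodic w.2.2}
  zero_mem' := by
    refine ⟨?_, D.isTrace_zero, ?_, ?_⟩
    · intro φ hφ hc hs
      have e1 : ∫ x in D.Ω, (0 : Lp ℝ 2 D.vol) x • gradient φ x = 0 := by
        rw [← integral_zero Plane Plane (μ := D.vol)]
        apply integral_congr_ae
        filter_upwards [Lp.coeFn_zero ℝ 2 D.vol] with x hx
        simp only [hx, Pi.zero_apply]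
        simp
      have e2 : ∫ x in D.Ω, φ x • (0 : Lp Plane 2 D.vol) x = 0 := by
        rw [← integral_zero Plane Plane (μ := D.vol)]
        apply integral_congr_ae
        filter_upwards [Lp.coeFn_zero Plane 2 D.vol] with x hx
        simp only [hx, Pi.zero_apply]
        simp
      exact e1.trans (by rw [← neg_zero, ← e2]; rfl)
    · exact ae_restrict_of_ae_restrict_of_subset D.ΓD_subset (Lp.coeFn_zero ℝ 2 D.bd)
    · intro j
      filter_upwards [D.ae_piece (Lp.coeFn_zero ℝ 2 D.bd) j,
        D.ae_shift (Lp.coeFn_zero ℝ 2 D.bd) j] with x h1 h2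
      exact h2.trans h1.symm
  add_mem' := by
    rintro ⟨s, G, g⟩ ⟨s', G', g'⟩ ⟨h1, h2, h3, h4⟩ ⟨h1', h2', h3', h4'⟩
    refine ⟨D.isWeakGradient_add h1 h1', D.isTrace_add h2 h2', ?_, ?_⟩
    · filter_upwards [h3, h3', ae_restrict_of_ae_restrict_of_subset D.ΓD_subset
        (Lp.coeFn_add g g')] with x hx hx' hs
      refine hs.trans ?_
      simp only [Pi.add_apply]
      rw [hx, hx', add_zero]
    · intro j
      filter_upwards [h4 j, h4' j, D.ae_piece (Lp.coeFn_add g g') j,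
        D.ae_shift (Lp.coeFn_add g g') j] with x hx hx' hs hs'
      refine hs'.trans (Eq.trans ?_ hs.symm)
      simp only [Pi.add_apply]
      rw [hx, hx']
  smul_mem' := by
    rintro r ⟨s, G, g⟩ ⟨h1, h2, h3, h4⟩
    refine ⟨D.isWeakGradient_smul r h1, D.isTrace_smul r h2, ?_, ?_⟩
    · filter_upwards [h3, ae_restrict_of_ae_restrict_of_subset D.ΓD_subset
        (Lp.coeFn_smul r g)] with x hx hs
      refine hs.trans ?_
      simp only [Pi.smul_apply]
      rw [hx, smul_zero]
    · intro j
      filter_upwards [h4 j, D.ae_piece (Lp.coeFn_smul r g) j,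
        D.ae_shift (Lp.coeFn_smul r g) j] with x hx hs hs'
      refine hs'.trans (Eq.trans ?_ hs.symm)
      simp only [Pi.smul_apply]
      rw [hx]

/-- The space of the functions in `sobolev`, to be equipped with the energy product. -/
def V : Type := ↥D.sobolev

instance : AddCommGroup D.V := inferInstanceAs (AddCommGroup ↥D.sobolev)
instance : Module ℝ D.V := inferInstanceAs (Module ℝ ↥D.sobolev)

variable {D}

/-- The function itself. -/
def V.fn (s : D.V) : Lp ℝ 2 D.vol := s.1.1

/-- Its weak gradient. -/
def V.grad (s : D.V) : Lp Plane 2 D.vol := s.1.2.1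

/-- Its trace on `∂Ω`. -/
def V.trace (s : D.V) : Lp ℝ 2 D.bd := s.1.2.2

/-- The energy product `∫_Ω σ ∇s·∇s' + ∫_{ΓR} a s s'`. -/
def energy (s s' : D.V) : ℝ :=
  (∫ x in D.Ω, D.σ x * inner ℝ (s.grad x) (s'.grad x)) +
    ∫ x in D.ΓR, D.a x * (s.trace x * s'.trace x) ∂len

theorem ΓR_subset : D.ΓR ⊆ frontier D.Ω := by
  rw [← D.cover]
  intro x hx
  simp [hx]

theorem bd_restrict : D.bd.restrict D.ΓR = len.restrict D.ΓR :=
  Measure.restrict_restrict_of_subset ΓR_subset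

theorem integrable_grad (G G' : Lp Plane 2 D.vol) :
    Integrable (fun x => D.σ x * inner ℝ (G x) (G' x)) D.vol := by
  obtain ⟨m, M, hm, hM⟩ := D.σ_bound
  refine (L2.integrable_inner (𝕜 := ℝ) G G').bdd_mul (c := M)
    D.measurable_σ.aestronglyMeasurable ?_
  filter_upwards [hM] with x hx
  rw [Real.norm_eq_abs, abs_of_nonneg (hm.le.trans hx.1)]
  exact hx.2

theorem integrable_trace (g g' : Lp ℝ 2 D.bd) :
    Integrable (fun x => D.a x * (g x * g' x)) (len.restrict D.ΓR) := by
  obtain ⟨M, hM⟩ := D.a_bound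
  have h0 : Integrable (fun x => g x * g' x) (len.restrict D.ΓR) := by
    have := (MemLp.integrable_mul (Lp.memLp g) (Lp.memLp g')).restrict (s := D.ΓR)
    rwa [bd_restrict] at this
  refine h0.bdd_mul (c := M) D.measurable_a.aestronglyMeasurable ?_
  filter_upwards [ae_restrict_mem D.measurableSet_ΓR] with x hx
  rw [Real.norm_eq_abs, abs_of_pos (hM x hx).1]
  exact (hM x hx).2

theorem ae_ΓR {p : Plane → Prop} (hp : ∀ᵐ x ∂D.bd, p x) : ∀ᵐ x ∂(len.restrict D.ΓR), p x :=
  ae_restrict_of_ae_restrict_of_subset ΓR_subset hp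

theorem energy_comm (s s' : D.V) : energy s' s = energy s s' := by
  unfold energy
  congr 1
  · simp only [real_inner_comm]
  · simp only [mul_comm]

theorem energy_nonneg (s : D.V) : 0 ≤ energy s s := by
  unfold energy
  apply add_nonneg
  · apply integral_nonneg_of_ae
    obtain ⟨m, M, hm, hM⟩ := D.σ_bound
    filter_upwards [hM] with x hx
    exact mul_nonneg (hm.le.trans hx.1) real_inner_self_nonneg
  · apply integral_nonneg_of_ae
    obtain ⟨M, hM⟩ := D.a_bound
    filter_upwards [ae_restrict_mem D.measurableSet_ΓR] with x hx
    exact mul_nonneg (hM x hx).1.le (mul_self_nonneg _)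

theorem energy_add (s t r : D.V) : energy (s + t) r = energy s r + energy t r := by
  have e1 : ∫ x in D.Ω, D.σ x * inner ℝ ((s + t).grad x) (r.grad x)
      = ∫ x in D.Ω, (D.σ x * inner ℝ (s.grad x) (r.grad x) +
          D.σ x * inner ℝ (t.grad x) (r.grad x)) := by
    apply integral_congr_ae
    filter_upwards [Lp.coeFn_add s.grad t.grad] with x hx
    have hx' : (s + t).grad x = s.grad x + t.grad x := hx
    simp only [hx', inner_add_left, mul_add]
  have e2 : ∫ x in D.ΓR, D.a x * ((s + t).trace x * r.trace x) ∂len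
      = ∫ x in D.ΓR, (D.a x * (s.trace x * r.trace x) + D.a x * (t.trace x * r.trace x)) ∂len := by
    apply integral_congr_ae
    filter_upwards [ae_ΓR (Lp.coeFn_add s.trace t.trace)] with x hx
    have hx' : (s + t).trace x = s.trace x + t.trace x := hx
    simp only [hx']
    ring
  unfold energy
  rw [e1, e2, integral_add (integrable_grad _ _) (integrable_grad _ _),
    integral_add (integrable_trace _ _) (integrable_trace _ _)]
  ring

theorem energy_smul (k : ℝ) (s r : D.V) : energy (k • s) r = k * energy s r := by
  have e1 : ∫ x in D.Ω, D.σ x * inner ℝ ((k • s).grad x) (r.grad x)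
      = ∫ x in D.Ω, k * (D.σ x * inner ℝ (s.grad x) (r.grad x)) := by
    apply integral_congr_ae
    filter_upwards [Lp.coeFn_smul k s.grad] with x hx
    have hx' : (k • s).grad x = k • s.grad x := hx
    simp only [hx', real_inner_smul_left]
    ring
  have e2 : ∫ x in D.ΓR, D.a x * ((k • s).trace x * r.trace x) ∂len
      = ∫ x in D.ΓR, k * (D.a x * (s.trace x * r.trace x)) ∂len := by
    apply integral_congr_ae
    filter_upwards [ae_ΓR (Lp.coeFn_smul k s.trace)] with x hx
    have hx' : (k • s).trace x = k * s.trace x := hx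
    simp only [hx']
    ring
  unfold energy
  rw [e1, e2, integral_const_mul, integral_const_mul]
  ring

variable (D)

/-- The energy product as a positive semidefinite inner product on `V`. -/
abbrev energyCore : PreInnerProductSpace.Core ℝ D.V where
  inner := energy
  conj_inner_symm s t := energy_comm s t
  re_inner_nonneg s := energy_nonneg s
  add_left s t r := energy_add s t r
  smul_left s t k := energy_smul k s t

instance : SeminormedAddCommGroup D.V :=
  InnerProductSpace.Core.toSeminormedAddCommGroup (c := D.energyCore)

instance : InnerProductSpace ℝ D.V := InnerProductSpace.ofCore D.energyCore

/-- The constants are controlled: Dirichlet or Robin conditions hold on a part of the boundary (of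
positive length). -/
def ConstantsControlled : Prop := 0 < len (D.ΓD ∪ D.ΓR)

/-- The functions that are divided out in the definition of `H`: only `0` if the constants are
controlled, and the constants otherwise. -/
def IsNegligible (s : D.V) : Prop :=
  (∀ᵐ x ∂D.vol, s.fn x = 0) ∨ (¬ D.ConstantsControlled ∧ ∃ k : ℝ, ∀ᵐ x ∂D.vol, s.fn x = k)

/-- The space `H` with the energy product: the functions in `V`, two of them being identified if
their difference has energy `0`. It is `V` itself if the constants are controlled, and the quotient
of `V` by the constants otherwise (the main theorem contains this fact). -/
abbrev H : Type := SeparationQuotient D.V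

/-- The class in `H` of a function in `V`. -/
def V.toH {D : Data} (s : D.V) : D.H := SeparationQuotient.mk s

/-- `L²(Ω)` with the inner product `∫_Ω c u u'`. -/
abbrev L2c : Type := Lp ℝ 2 (D.vol.withDensity fun x => ENNReal.ofReal (D.c x))

/-- The space of the pairs `(u, s)` with `u ∈ L²(Ω)`, `s ∈ H`, with the inner product
`∫_Ω c u u' + ∫_Ω σ ∇s·∇s' + ∫_{ΓR} a s s'`. -/
abbrev Space : Type := WithLp 2 (D.L2c × D.H)

/-- `-div (σ ∇s) = f` in `Ω`, with the natural boundary conditions in the weak sense: the conormal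
derivative `σ ∇s·n` is `0` on `ΓN`, is `-a s` on `ΓR`, and matches on the periodic part. -/
def IsNegDiv {D : Data} (s : D.V) (f : Lp ℝ 2 D.vol) : Prop :=
  ∀ v : D.V, inner ℝ s v = ∫ x in D.Ω, f x * v.fn x

/-- `φ = (u, s)` is in the domain of the Graetz operator and `ψ = (c⁻¹ (h u - div (σ ∇s)), u)` is its
image. -/
def IsImage {D : Data} (φ ψ : D.Space) : Prop :=
  ∃ (u s : D.V) (f : Lp ℝ 2 D.vol), IsNegDiv s f ∧
    (∀ᵐ x ∂D.vol, φ.fst x = u.fn x) ∧ φ.snd = s.toH ∧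
    (∀ᵐ x ∂D.vol, ψ.fst x = (D.c x)⁻¹ * (D.h x * u.fn x + f x)) ∧ ψ.snd = u.toH

variable {D}

theorem isNegDiv_add {s s' : D.V} {f f' : Lp ℝ 2 D.vol} (h : IsNegDiv s f) (h' : IsNegDiv s' f') :
    IsNegDiv (s + s') (f + f') := by
  intro v
  have e : ∫ x in D.Ω, (f + f') x * v.fn x = ∫ x in D.Ω, (f x * v.fn x + f' x * v.fn x) := by
    apply integral_congr_ae
    filter_upwards [Lp.coeFn_add f f'] with x hx
    rw [hx, Pi.add_apply, add_mul]
  rw [inner_add_left, h v, h' v, e, integral_add]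
  · exact MemLp.integrable_mul (Lp.memLp f) (Lp.memLp v.fn)
  · exact MemLp.integrable_mul (Lp.memLp f') (Lp.memLp v.fn)

theorem isNegDiv_smul (k : ℝ) {s : D.V} {f : Lp ℝ 2 D.vol} (h : IsNegDiv s f) :
    IsNegDiv (k • s) (k • f) := by
  intro v
  have e : ∫ x in D.Ω, (k • f) x * v.fn x = ∫ x in D.Ω, k * (f x * v.fn x) := by
    apply integral_congr_ae
    filter_upwards [Lp.coeFn_smul k f] with x hx
    rw [hx, Pi.smul_apply, smul_eq_mul, mul_assoc]
  rw [real_inner_smul_left, h v, e, integral_const_mul]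

theorem vol_ac : D.vol ≪ D.vol.withDensity fun x => ENNReal.ofReal (D.c x) := by
  obtain ⟨m, M, hm, hM⟩ := D.c_bound
  refine withDensity_absolutelyContinuous' (by have := D.measurable_c; fun_prop) ?_
  filter_upwards [hM] with x hx
  simpa using hm.trans_le hx.1

theorem isImage_add {φ ψ φ' ψ' : D.Space} (h : IsImage φ ψ) (h' : IsImage φ' ψ') :
    IsImage (φ + φ') (ψ + ψ') := by
  obtain ⟨u, s, f, h1, h2, h3, h4, h5⟩ := h
  obtain ⟨u', s', f', h1', h2', h3', h4', h5'⟩ := h'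
  refine ⟨u + u', s + s', f + f', isNegDiv_add h1 h1', ?_, ?_, ?_, ?_⟩
  · filter_upwards [h2, h2', vol_ac.ae_le (Lp.coeFn_add φ.fst φ'.fst),
      Lp.coeFn_add u.fn u'.fn] with x a1 a2 a3 a4
    exact a3.trans ((congrArg₂ (· + ·) a1 a2).trans a4.symm)
  · rw [WithLp.add_snd, h3, h3']
    rfl
  · filter_upwards [h4, h4', vol_ac.ae_le (Lp.coeFn_add ψ.fst ψ'.fst),
      Lp.coeFn_add u.fn u'.fn, Lp.coeFn_add f f'] with x a1 a2 a3 a4 a5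
    have a4' : (u + u').fn x = u.fn x + u'.fn x := a4
    refine a3.trans ((congrArg₂ (· + ·) a1 a2).trans ?_)
    rw [a4', a5, Pi.add_apply]
    ring
  · rw [WithLp.add_snd, h5, h5']
    rfl

theorem isImage_smul (k : ℝ) {φ ψ : D.Space} (h : IsImage φ ψ) : IsImage (k • φ) (k • ψ) := by
  obtain ⟨u, s, f, h1, h2, h3, h4, h5⟩ := h
  refine ⟨k • u, k • s, k • f, isNegDiv_smul k h1, ?_, ?_, ?_, ?_⟩
  · filter_upwards [h2, vol_ac.ae_le (Lp.coeFn_smul k φ.fst), Lp.coeFn_smul k u.fn] with x a1 a3 a4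
    exact a3.trans ((congrArg (k • ·) a1).trans a4.symm)
  · rw [WithLp.smul_snd, h3]
    rfl
  · filter_upwards [h4, vol_ac.ae_le (Lp.coeFn_smul k ψ.fst), Lp.coeFn_smul k u.fn,
      Lp.coeFn_smul k f] with x a1 a3 a4 a5
    have a4' : (k • u).fn x = k * u.fn x := a4
    refine a3.trans ((congrArg (k • ·) a1).trans ?_)
    rw [a4', a5, Pi.smul_apply]
    simp only [smul_eq_mul]
    ring
  · rw [WithLp.smul_snd, h5]
    rfl

theorem isImage_zero : IsImage (0 : D.Space) 0 := by
  refine ⟨0, 0, 0, ?_, ?_, rfl, ?_, rfl⟩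
  · intro v
    rw [inner_zero_left]
    symm
    rw [← integral_zero Plane ℝ (μ := D.vol)]
    apply integral_congr_ae
    filter_upwards [Lp.coeFn_zero ℝ 2 D.vol] with x hx
    simp only [hx, Pi.zero_apply]
    simp
  · filter_upwards [vol_ac.ae_le (Lp.coeFn_zero ℝ 2
      (D.vol.withDensity fun x => ENNReal.ofReal (D.c x))), Lp.coeFn_zero ℝ 2 D.vol] with x a1 a2
    exact a1.trans a2.symm
  · filter_upwards [vol_ac.ae_le (Lp.coeFn_zero ℝ 2
      (D.vol.withDensity fun x => ENNReal.ofReal (D.c x))), Lp.coeFn_zero ℝ 2 D.vol] with x a1 a2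
    refine a1.trans ?_
    have a2' : (0 : D.V).fn x = 0 := a2
    rw [a2', a2]
    simp

variable (D)

/-- The graph of the Graetz operator `𝒜 (u, s) = (c⁻¹ (h u - div (σ ∇s)), u)`, with the domain given
by `u ∈ H`, `div (σ ∇s) ∈ L²(Ω)` and the lateral boundary conditions. -/
def graph : Submodule ℝ (D.Space × D.Space) where
  carrier := {p | IsImage p.1 p.2}
  zero_mem' := isImage_zero
  add_mem' h h' := isImage_add h h'
  smul_mem' k _ h := isImage_smul k h

/-- The eigenspace `{φ | 𝒜 φ = μ φ}`. -/
def eigenspace (μ : ℝ) : Submodule ℝ D.Space :=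
  D.graph.comap (LinearMap.id.prod (μ • LinearMap.id))

/-- The closed span of the eigenvectors whose eigenvalue lies in `S`; it is the range of the spectral
projection for `S`. -/
def spectralSpace (S : Set ℝ) : Submodule ℝ D.Space :=
  (⨆ μ ∈ S, D.eigenspace μ).topologicalClosure

/-- The projection `P (u, s) = (u, 0)`. -/
def P : D.Space →L[ℝ] D.Space :=
  (WithLp.prodContinuousLinearEquiv 2 ℝ D.L2c D.H).symm.toContinuousLinearMap ∘L
    (ContinuousLinearMap.inl ℝ D.L2c D.H ∘L ContinuousLinearMap.fst ℝ D.L2c D.H) ∘L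
      (WithLp.prodContinuousLinearEquiv 2 ℝ D.L2c D.H).toContinuousLinearMap

section Hilbert

variable [CompleteSpace D.Space]

instance (S : Set ℝ) : (D.spectralSpace S).HasOrthogonalProjection := by
  unfold spectralSpace
  infer_instance

/-- The spectral projection `π_S`: the orthogonal projection onto the closed span of the eigenvectors
whose eigenvalue lies in `S`. Thus `π₋` and `π₊` belong to `Iio 0` and `Ioi 0`. -/
def proj (S : Set ℝ) : D.Space →L[ℝ] D.Space := (D.spectralSpace S).starProjection

/-- The orthogonal projection onto the (closed) eigenspace of `μ`. -/
def eigenProj (μ : ℝ) : D.Space →L[ℝ] D.Space :=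
  (D.eigenspace μ).topologicalClosure.starProjection

/-- The `α`-norm `(∑_μ |μ|^{2α} ‖E_μ φ‖²)^{1/2} ∈ [0, ∞]`, where `E_μ` is the orthogonal projection
onto the eigenspace of `μ`. -/
def powNorm (α : ℝ) (φ : D.Space) : ℝ≥0∞ :=
  (∑' μ : ℝ, ENNReal.ofReal (|μ| ^ (2 * α)) * ‖D.eigenProj μ φ‖ₑ ^ 2) ^ (1 / 2 : ℝ)

/-- The operator `π_S P π_S` on the range of `π_S`. -/
def compression (S : Set ℝ) : D.spectralSpace S →L[ℝ] D.spectralSpace S :=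
  (D.spectralSpace S).orthogonalProjectionOnto ∘L D.P ∘L (D.spectralSpace S).subtypeL

/-- `B_S = π_S (π_S P π_S)⁻¹ π_S`, the inverse being taken on the range of `π_S`. -/
def B (S : Set ℝ) : D.Space →L[ℝ] D.Space :=
  (D.spectralSpace S).subtypeL ∘L (D.compression S).inverse ∘L
    (D.spectralSpace S).orthogonalProjectionOnto

/-- `π_S P π_S` is invertible on the range of `π_S`, and `B_S` is a self-adjoint operator that is
bounded in the norm of the space and in the `1/2`-norm. -/
def InvertibleWithBounds (S : Set ℝ) : Prop :=
  (D.compression S).IsInvertible ∧ IsSelfAdjoint (D.B S) ∧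
    ∃ C : ℝ, 0 < C ∧ ∀ φ : D.Space,
      ‖D.B S φ‖ ≤ C * ‖D.proj S φ‖ ∧
      D.powNorm (1 / 2) (D.B S φ) ≤ ENNReal.ofReal C * D.powNorm (1 / 2) (D.proj S φ)

end Hilbert

end Data

end Graetz

end

/-! Let k(φ, φ') = ∫ h u u', and let J be the form of 2P − 1, so that J(φ, φ') = ∫ c u u' − ⟨s, s'⟩
with the energy product ⟨·, ·⟩. The weak form of the lateral conditions gives both the symmetry of 𝒜
and J(𝒜φ, φ') + J(φ, 𝒜φ') = 2k(φ, φ') (`IsImage.inner_symm`). Put L = 𝒜 on the positive spectral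
space, and L = −𝒜 on the negative one, where k also changes sign. In both cases L > 0 and J solves
the Lyapunov equation LJ + JL = 2k. Hence J(x, y) = ∫₀^∞ 2k(e^{−tL}x, e^{−tL}y) dt, and since k is
bounded, |J(x, y)| ≤ C ‖L^{−1/2}x‖ ‖L^{−1/2}y‖ (`LyapunovFamily.reflForm_sq_le`).

On the range of π the form J is given by an operator Q with πPπ = (1 + Q)/2. Because the spectrum is
discrete, the estimate makes Q compact, and the Fredholm alternative reduces invertibility to
injectivity. If πPπx = 0, then Px = 0, so J(x, ·) = −(x | ·), and the estimate puts x into the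
domain of L^{1/2}. Formally, ‖L^{1/2}x‖² = (x | Lx) = −J(x, Lx) = −k(x, x) = 0, as k sees only Px;
`LyapunovFamily.eq_zero_of_proj_eq_zero` carries this out on partial sums. The bound in the 1/2-norm
comes from x = 2y − Qx with y = πPπx, since Q gains half a power of L.

Discreteness of the spectrum rests on compactness of the domain of 𝒜 in the graph norm
(`exists_norm_sub_lt`), hence on Rellich's theorem. Rellich's theorem and the trace inequality come
from the boundary charts: a function is controlled on every line transversal to the graph, so it is
small in thin layers along the boundary, while the rest of Ω is covered by small squares with a
Poincaré inequality on each. The trace inequality also yields definiteness of the energy, because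
the trace of a constant is that constant; Poincaré's inequality yields completeness. -/

namespace Graetz

/-! ### Orthogonal families of finite-dimensional subspaces -/

section OrthogonalSums

variable {ι E : Type*} [NormedAddCommGroup E] [InnerProductSpace ℝ E]
  {V : ι → Submodule ℝ E}

theorem inner_sum_sum (horth : ∀ i j, i ≠ j → ∀ x ∈ V i, ∀ y ∈ V j, inner ℝ x y = 0)
    (F : Finset ι) {a b : ι → E} (ha : ∀ i, a i ∈ V i) (hb : ∀ i, b i ∈ V i) :
    inner ℝ (∑ i ∈ F, a i) (∑ i ∈ F, b i) = ∑ i ∈ F, inner ℝ (a i) (b i) := by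
  classical
  rw [sum_inner]
  refine Finset.sum_congr rfl fun i hi => ?_
  rw [inner_sum, Finset.sum_eq_single i]
  · exact fun j _ hj => horth i j hj.symm _ (ha i) _ (hb j)
  · exact fun h => absurd hi h

theorem norm_sum_sq (horth : ∀ i j, i ≠ j → ∀ x ∈ V i, ∀ y ∈ V j, inner ℝ x y = 0)
    (F : Finset ι) {a : ι → E} (ha : ∀ i, a i ∈ V i) :
    ‖∑ i ∈ F, a i‖ ^ 2 = ∑ i ∈ F, ‖a i‖ ^ 2 := by
  rw [← real_inner_self_eq_norm_sq, inner_sum_sum horth F ha ha]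
  simp only [real_inner_self_eq_norm_sq]

variable [∀ i, FiniteDimensional ℝ (V i)]

/-- The partial sum of the orthogonal projections of `x` on the spaces `V i`. -/
noncomputable def partialProj (V : ι → Submodule ℝ E) [∀ i, FiniteDimensional ℝ (V i)] (F : Finset ι) :
    E →L[ℝ] E := ∑ i ∈ F, (V i).starProjection

theorem partialProj_apply (F : Finset ι) (x : E) :
    partialProj V F x = ∑ i ∈ F, (V i).starProjection x := by
  simp [partialProj]

theorem inner_starProjection_left (i : ι) (x : E) {y : E} (hy : y ∈ V i) :
    inner ℝ ((V i).starProjection x) y = inner ℝ x y := by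
  rw [Submodule.inner_starProjection_left_eq_right, Submodule.starProjection_eq_self_iff.2 hy]

theorem inner_sum_right_eq (F : Finset ι) (x : E) {b : ι → E} (hb : ∀ i, b i ∈ V i) :
    inner ℝ x (∑ i ∈ F, b i) = ∑ i ∈ F, inner ℝ ((V i).starProjection x) (b i) := by
  rw [inner_sum]
  exact Finset.sum_congr rfl fun i _ => (inner_starProjection_left i x (hb i)).symm

theorem norm_partialProj_sq (horth : ∀ i j, i ≠ j → ∀ x ∈ V i, ∀ y ∈ V j, inner ℝ x y = 0)
    (F : Finset ι) (x : E) :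
    ‖partialProj V F x‖ ^ 2 = ∑ i ∈ F, ‖(V i).starProjection x‖ ^ 2 := by
  rw [partialProj_apply, norm_sum_sq horth F fun i => (V i).starProjection_apply_mem x]

theorem inner_partialProj_self (horth : ∀ i j, i ≠ j → ∀ x ∈ V i, ∀ y ∈ V j, inner ℝ x y = 0)
    (F : Finset ι) (x : E) : inner ℝ x (partialProj V F x) = ‖partialProj V F x‖ ^ 2 := by
  rw [norm_partialProj_sq horth, partialProj_apply,
    inner_sum_right_eq F x fun i => (V i).starProjection_apply_mem x]
  simp only [real_inner_self_eq_norm_sq]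

theorem norm_partialProj_le (horth : ∀ i j, i ≠ j → ∀ x ∈ V i, ∀ y ∈ V j, inner ℝ x y = 0)
    (F : Finset ι) (x : E) : ‖partialProj V F x‖ ≤ ‖x‖ := by
  have h := real_inner_le_norm x (partialProj V F x)
  rw [inner_partialProj_self horth, sq] at h
  rcases (norm_nonneg (partialProj V F x)).eq_or_lt with h0 | h0
  · rw [← h0]; exact norm_nonneg x
  · exact le_of_mul_le_mul_right h h0

theorem starProjection_of_mem_ne (horth : ∀ i j, i ≠ j → ∀ x ∈ V i, ∀ y ∈ V j, inner ℝ x y = 0)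
    {i j : ι} (hij : i ≠ j) {x : E} (hx : x ∈ V i) : (V j).starProjection x = 0 := by
  refine (Submodule.starProjection_apply_eq_zero_iff (V j)).2 ?_
  exact (Submodule.mem_orthogonal' _ _).2 fun y hy => horth i j hij x hx y hy

theorem partialProj_mem (F : Finset ι) (x : E) :
    partialProj V F x ∈ (⨆ i, V i).topologicalClosure := by
  rw [partialProj_apply]
  refine Submodule.le_topologicalClosure _ (Submodule.sum_mem _ fun i _ => ?_)
  exact Submodule.mem_iSup_of_mem i ((V i).starProjection_apply_mem x)

theorem tendsto_partialProj_of_mem_iSup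
    (horth : ∀ i j, i ≠ j → ∀ x ∈ V i, ∀ y ∈ V j, inner ℝ x y = 0) {x : E} (hx : x ∈ ⨆ i, V i) :
    ∀ᶠ F : Finset ι in atTop, partialProj V F x = x := by
  classical
  induction hx using Submodule.iSup_induction' with
  | mem i x hx =>
    filter_upwards [eventually_ge_atTop {i}] with F hF
    rw [partialProj_apply, Finset.sum_eq_single i]
    · exact Submodule.starProjection_eq_self_iff.2 hx
    · exact fun j _ hj => starProjection_of_mem_ne horth hj.symm hx
    · exact fun h => absurd (hF (Finset.mem_singleton_self i)) h
  | zero => simp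
  | add x y _ _ h1 h2 =>
    filter_upwards [h1, h2] with F e1 e2
    rw [map_add, e1, e2]

/-- The partial sums are eventually constant on the algebraic span; as they are contractions,
convergence extends to the closure. -/
theorem tendsto_partialProj (horth : ∀ i j, i ≠ j → ∀ x ∈ V i, ∀ y ∈ V j, inner ℝ x y = 0)
    {x : E} (hx : x ∈ (⨆ i, V i).topologicalClosure) :
    Tendsto (fun F : Finset ι => partialProj V F x) atTop (𝓝 x) := by
  rw [Metric.tendsto_nhds]
  intro ε hε
  obtain ⟨y, hy, hxy⟩ := Metric.mem_closure_iff.1 hx (ε / 2) (half_pos hε)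
  filter_upwards [tendsto_partialProj_of_mem_iSup horth hy] with F hF
  have e : partialProj V F x - x = partialProj V F (x - y) - (x - y) := by
    rw [map_sub, hF]; abel
  rw [dist_eq_norm] at hxy ⊢
  rw [e]
  calc _ ≤ ‖partialProj V F (x - y)‖ + ‖x - y‖ := norm_sub_le _ _
    _ ≤ ‖x - y‖ + ‖x - y‖ := by gcongr; exact norm_partialProj_le horth F _
    _ < ε := by linarith

end OrthogonalSums

/-! ### The Lyapunov equation and its consequences -/

section Lyapunov

variable {ι E : Type*} [NormedAddCommGroup E] [InnerProductSpace ℝ E]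

/-- The form `((2P - 1) x | y)` for an orthogonal projection `P`. -/
noncomputable def reflForm (P : E →L[ℝ] E) (x y : E) : ℝ := 2 * inner ℝ (P x) (P y) - inner ℝ x y

/-- A family of finite-dimensional orthogonal subspaces `V i` with weights `l i > 0` tending to
infinity, such that on `V i × V j` the form of `2P - 1` is `2 k / (l i + l j)` for a bilinear form `k`
that is bounded in the seminorm `‖P ·‖`. -/
structure LyapunovFamily (V : ι → Submodule ℝ E) (l : ι → ℝ) (P : E →L[ℝ] E)
    (k : E →ₗ[ℝ] E →ₗ[ℝ] ℝ) (C : ℝ) : Prop where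
  finite_dim : ∀ i, FiniteDimensional ℝ (V i)
  orth : ∀ i j, i ≠ j → ∀ x ∈ V i, ∀ y ∈ V j, inner ℝ x y = 0
  pos : ∀ i, 0 < l i
  discrete : ∀ R, {i | V i ≠ ⊥ ∧ l i ≤ R}.Finite
  proj : ∀ x y, inner ℝ (P x) y = inner ℝ (P x) (P y)
  bound_pos : 0 < C
  bound : ∀ x y, |k x y| ≤ C * (‖P x‖ * ‖P y‖)
  relation : ∀ i j, ∀ x ∈ V i, ∀ y ∈ V j, (l i + l j) * reflForm P x y = 2 * k x y

theorem reflForm_sum_left (P : E →L[ℝ] E) (F : Finset ι) (a : ι → E) (y : E) :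
    reflForm P (∑ i ∈ F, a i) y = ∑ i ∈ F, reflForm P (a i) y := by
  simp only [reflForm, map_sum, sum_inner, Finset.mul_sum, Finset.sum_sub_distrib]

theorem reflForm_sum_right (P : E →L[ℝ] E) (F : Finset ι) (x : E) (b : ι → E) :
    reflForm P x (∑ i ∈ F, b i) = ∑ i ∈ F, reflForm P x (b i) := by
  simp only [reflForm, map_sum, inner_sum, Finset.mul_sum, Finset.sum_sub_distrib]

theorem reflForm_smul_left (P : E →L[ℝ] E) (t : ℝ) (x y : E) :
    reflForm P (t • x) y = t * reflForm P x y := by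
  simp only [reflForm, map_smul, real_inner_smul_left]; ring

theorem reflForm_sub_left (P : E →L[ℝ] E) (x x' y : E) :
    reflForm P (x - x') y = reflForm P x y - reflForm P x' y := by
  simp only [reflForm, map_sub, inner_sub_left]; ring

theorem reflForm_comm (P : E →L[ℝ] E) (x y : E) : reflForm P x y = reflForm P y x := by
  simp only [reflForm, real_inner_comm]

theorem continuous_reflForm_left (P : E →L[ℝ] E) (y : E) : Continuous fun x => reflForm P x y := by
  unfold reflForm; fun_prop

namespace LyapunovFamily

variable {V : ι → Submodule ℝ E} {l : ι → ℝ} {P : E →L[ℝ] E} {k : E →ₗ[ℝ] E →ₗ[ℝ] ℝ} {C : ℝ}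

theorem norm_le (h : LyapunovFamily V l P k C) (x : E) : ‖P x‖ ≤ ‖x‖ := by
  have h1 := real_inner_le_norm (P x) x
  rw [h.proj, real_inner_self_eq_norm_sq, sq] at h1
  rcases (norm_nonneg (P x)).eq_or_lt with h0 | h0
  · rw [← h0]; exact norm_nonneg x
  · exact le_of_mul_le_mul_left h1 h0

theorem two_abs_form_le (h : LyapunovFamily V l P k C) (x y : E) :
    |2 * k x y| ≤ C * (‖x‖ ^ 2 + ‖y‖ ^ 2) := by
  have h1 := h.norm_le x
  have h2 := h.norm_le y
  have h3 := h.bound_pos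
  rw [abs_mul, abs_two]
  calc 2 * |k x y| ≤ 2 * (C * (‖P x‖ * ‖P y‖)) := by gcongr; exact h.bound x y
    _ ≤ 2 * (C * (‖x‖ * ‖y‖)) := by gcongr
    _ = C * (2 * ‖x‖ * ‖y‖) := by ring
    _ ≤ _ := by gcongr; exact two_mul_le_add_sq _ _

theorem integral_exp_neg (c : ℝ) (hc : 0 < c) :
    IntegrableOn (fun t : ℝ => Real.exp (-c * t)) (Ioi 0) ∧
      ∫ t in Ioi (0 : ℝ), Real.exp (-c * t) = c⁻¹ := by
  refine ⟨exp_neg_integrableOn_Ioi 0 hc, ?_⟩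
  have := integral_exp_mul_Ioi (a := -c) (by linarith) 0
  rw [this]; simp

/-- The integral formula for the solution of a Lyapunov equation: 1/(l i + l j) is the integral of
exp(−(l i + l j)t), whose two factors are absorbed into the vectors, so that J becomes the integral
of 2k along the semigroup exp(−tL). The squared norms along the semigroup then integrate to ‖a i‖² /
(2 l i). -/
theorem abs_reflForm_le_add (h : LyapunovFamily V l P k C) (F : Finset ι) {a b : ι → E}
    (ha : ∀ i, a i ∈ V i) (hb : ∀ i, b i ∈ V i) :
    |reflForm P (∑ i ∈ F, a i) (∑ i ∈ F, b i)|
      ≤ C / 2 * (∑ i ∈ F, ‖a i‖ ^ 2 / l i + ∑ i ∈ F, ‖b i‖ ^ 2 / l i) := by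
  have hpos := h.pos
  have e1 : reflForm P (∑ i ∈ F, a i) (∑ i ∈ F, b i)
      = ∑ i ∈ F, ∑ j ∈ F, ∫ t in Ioi (0 : ℝ), 2 * k (a i) (b j) * Real.exp (-(l i + l j) * t) := by
    rw [reflForm_sum_left]
    refine Finset.sum_congr rfl fun i _ => ?_
    rw [reflForm_sum_right]
    refine Finset.sum_congr rfl fun j _ => ?_
    have hij : 0 < l i + l j := add_pos (hpos i) (hpos j)
    rw [integral_const_mul, (integral_exp_neg _ hij).2, ← h.relation i j _ (ha i) _ (hb j)]
    field_simp
  have e2 : ∑ i ∈ F, ∑ j ∈ F, ∫ t in Ioi (0 : ℝ), 2 * k (a i) (b j) * Real.exp (-(l i + l j) * t)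
      = ∫ t in Ioi (0 : ℝ), 2 * k (∑ i ∈ F, Real.exp (-l i * t) • a i)
          (∑ i ∈ F, Real.exp (-l i * t) • b i) := by
    have hint : ∀ i j, IntegrableOn
        (fun t : ℝ => 2 * k (a i) (b j) * Real.exp (-(l i + l j) * t)) (Ioi 0) := fun i j =>
      (integral_exp_neg _ (add_pos (hpos i) (hpos j))).1.const_mul _
    have : ∀ i ∈ F, ∑ j ∈ F, ∫ t in Ioi (0 : ℝ), 2 * k (a i) (b j) * Real.exp (-(l i + l j) * t)
        = ∫ t in Ioi (0 : ℝ), ∑ j ∈ F, 2 * k (a i) (b j) * Real.exp (-(l i + l j) * t) :=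
      fun i _ => (integral_finsetSum _ fun j _ => hint i j).symm
    rw [Finset.sum_congr rfl this, ← integral_finsetSum]
    · congr 1
      ext t
      simp only [map_sum, map_smul, LinearMap.sum_apply, LinearMap.smul_apply, smul_eq_mul,
        Finset.mul_sum]
      rw [Finset.sum_comm]
      refine Finset.sum_congr rfl fun i _ => Finset.sum_congr rfl fun j _ => ?_
      rw [neg_add, add_mul, Real.exp_add]
      ring
    · exact fun i _ => integrable_finsetSum _ fun j _ => hint i j
  have hint : ∀ i ∈ F, IntegrableOn (fun t : ℝ => Real.exp (-(2 * l i) * t) *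
      (‖a i‖ ^ 2 + ‖b i‖ ^ 2)) (Ioi 0) := fun i _ =>
    (integral_exp_neg _ (mul_pos two_pos (hpos i))).1.mul_const _
  rw [e1, e2]
  have e3 : C / 2 * (∑ i ∈ F, ‖a i‖ ^ 2 / l i + ∑ i ∈ F, ‖b i‖ ^ 2 / l i)
      = ∫ t in Ioi (0 : ℝ), C * ∑ i ∈ F, Real.exp (-(2 * l i) * t) * (‖a i‖ ^ 2 + ‖b i‖ ^ 2) := by
    rw [integral_const_mul, integral_finsetSum _ hint, ← Finset.sum_add_distrib, div_mul_eq_mul_div,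
      mul_div_assoc, Finset.sum_div]
    congr 1
    refine Finset.sum_congr rfl fun i _ => ?_
    have := (hpos i).ne'
    rw [integral_mul_const, (integral_exp_neg _ (mul_pos two_pos (hpos i))).2]
    field_simp
  rw [e3, ← Real.norm_eq_abs]
  refine norm_integral_le_of_norm_le ((integrable_finsetSum _ hint).const_mul C) ?_
  refine Eventually.of_forall fun t => ?_
  rw [Real.norm_eq_abs]
  refine (h.two_abs_form_le _ _).trans (le_of_eq ?_)
  rw [norm_sum_sq h.orth F fun i => (V i).smul_mem _ (ha i),
    norm_sum_sq h.orth F fun i => (V i).smul_mem _ (hb i), ← Finset.sum_add_distrib]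
  congr 1
  refine Finset.sum_congr rfl fun i _ => ?_
  rw [norm_smul, norm_smul, mul_pow, mul_pow, ← mul_add, Real.norm_eq_abs, sq_abs, ← Real.exp_nat_mul]
  congr 2
  push_cast
  ring

theorem reflForm_sq_le (h : LyapunovFamily V l P k C) (F : Finset ι) {a b : ι → E}
    (ha : ∀ i, a i ∈ V i) (hb : ∀ i, b i ∈ V i) :
    reflForm P (∑ i ∈ F, a i) (∑ i ∈ F, b i) ^ 2
      ≤ C ^ 2 * ((∑ i ∈ F, ‖a i‖ ^ 2 / l i) * ∑ i ∈ F, ‖b i‖ ^ 2 / l i) := by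
  set A := ∑ i ∈ F, ‖a i‖ ^ 2 / l i
  set B := ∑ i ∈ F, ‖b i‖ ^ 2 / l i
  set J := reflForm P (∑ i ∈ F, a i) (∑ i ∈ F, b i)
  -- Replacing a by t • a in the additive estimate gives a quadratic polynomial in t that is never
  -- negative; its discriminant turns the sum of the two weighted norms into their product.
  have key : ∀ t : ℝ, 0 ≤ (C / 2 * A) * (t * t) + (-J) * t + C / 2 * B := by
    intro t
    have h1 := h.abs_reflForm_le_add F (a := fun i => t • a i) (fun i => (V i).smul_mem t (ha i)) hb
    have e1 : ∑ i ∈ F, ‖t • a i‖ ^ 2 / l i = t ^ 2 * A := by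
      rw [Finset.mul_sum]
      refine Finset.sum_congr rfl fun i _ => ?_
      rw [norm_smul, mul_pow, Real.norm_eq_abs, sq_abs, mul_div_assoc]
    rw [← Finset.smul_sum, reflForm_smul_left, e1] at h1
    have h2 := (le_abs_self _).trans h1
    linarith
  have := discrim_le_zero key
  rw [discrim] at this
  nlinarith

/-- Only finitely many nontrivial V i have weight at most 1. Trivial V i must be excluded: in the
application the index runs over a whole half-line of candidate eigenvalues. -/
theorem exists_gap (h : LyapunovFamily V l P k C) : ∃ δ, 0 < δ ∧ ∀ i, V i ≠ ⊥ → δ ≤ l i := by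
  rcases (h.discrete 1).toFinset.eq_empty_or_nonempty with h0 | h0
  · refine ⟨1, one_pos, fun i hi => ?_⟩
    by_contra hlt
    have : i ∈ (h.discrete 1).toFinset := by simpa using ⟨hi, (not_le.1 hlt).le⟩
    simp [h0] at this
  · obtain ⟨m, hm, hmin⟩ := Finset.exists_min_image _ l h0
    refine ⟨min 1 (l m), lt_min one_pos (h.pos m), fun i hi => ?_⟩
    by_cases h1 : l i ≤ 1
    · exact (min_le_right _ _).trans (hmin i (by simpa using ⟨hi, h1⟩))
    · exact (min_le_left _ _).trans (not_le.1 h1).le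

theorem div_le_of_gap {δ : ℝ} (hδ : 0 < δ) (hgap : ∀ i, V i ≠ ⊥ → δ ≤ l i) {i : ι} {x : E}
    (hx : x ∈ V i) : ‖x‖ ^ 2 / l i ≤ ‖x‖ ^ 2 / δ := by
  by_cases h0 : V i = ⊥
  · rw [h0, Submodule.mem_bot] at hx
    simp [hx]
  · have := hgap i h0
    gcongr

/-- The half power is kept in the second argument only; in the first the spectral gap bounds
L^{−1/2} by 1/√δ, so that x may be any vector of the closed span, reached through its partial sums.
-/
theorem exists_abs_reflForm_le (h : LyapunovFamily V l P k C) : ∃ C₁, 0 < C₁ ∧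
    ∀ x ∈ (⨆ i, V i).topologicalClosure, ∀ (F : Finset ι) (b : ι → E), (∀ i, b i ∈ V i) →
      |reflForm P x (∑ i ∈ F, b i)| ≤ C₁ * ‖x‖ * √(∑ i ∈ F, ‖b i‖ ^ 2 / l i) := by
  classical
  obtain ⟨δ, hδ, hgap⟩ := h.exists_gap
  have hC := h.bound_pos
  have := h.finite_dim
  refine ⟨C / √δ, by positivity, fun x hx F b hb => ?_⟩
  have hlim : Tendsto (fun G : Finset ι => |reflForm P (partialProj V G x) (∑ i ∈ F, b i)|) atTop
      (𝓝 |reflForm P x (∑ i ∈ F, b i)|) :=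
    (((continuous_reflForm_left P _).tendsto x).comp (tendsto_partialProj h.orth hx)).abs
  refine le_of_tendsto hlim ?_
  filter_upwards [eventually_ge_atTop F] with G hG
  set b' : ι → E := fun i => if i ∈ F then b i else 0 with hb'
  have hb'V : ∀ i, b' i ∈ V i := fun i => by
    simp only [hb']; split_ifs
    · exact hb i
    · exact zero_mem _
  have e1 : ∑ i ∈ F, b i = ∑ i ∈ G, b' i := by
    rw [hb', ← Finset.sum_filter]
    congr 1
    ext i
    simpa using @hG i
  have e2 : ∑ i ∈ G, ‖b' i‖ ^ 2 / l i = ∑ i ∈ F, ‖b i‖ ^ 2 / l i := by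
    rw [← Finset.sum_subset hG]
    · exact Finset.sum_congr rfl fun i hi => by simp [hb', hi]
    · intro i _ hi
      simp [hb', hi]
  have h1 := h.reflForm_sq_le G (fun i => (V i).starProjection_apply_mem x) hb'V
  rw [← partialProj_apply, ← e1, e2] at h1
  have h2 : ∑ i ∈ G, ‖(V i).starProjection x‖ ^ 2 / l i ≤ ‖x‖ ^ 2 / δ := by
    calc _ ≤ ∑ i ∈ G, ‖(V i).starProjection x‖ ^ 2 / δ := by
          exact Finset.sum_le_sum fun i _ =>
            div_le_of_gap hδ hgap ((V i).starProjection_apply_mem x)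
      _ = ‖partialProj V G x‖ ^ 2 / δ := by rw [norm_partialProj_sq h.orth, Finset.sum_div]
      _ ≤ _ := by gcongr; exact norm_partialProj_le h.orth G x
  have hB : 0 ≤ ∑ i ∈ F, ‖b i‖ ^ 2 / l i :=
    Finset.sum_nonneg fun i _ => div_nonneg (sq_nonneg _) (h.pos i).le
  refine abs_le_of_sq_le_sq (h1.trans ?_) (by positivity)
  rw [mul_pow, mul_pow, div_pow, Real.sq_sqrt hδ.le, Real.sq_sqrt hB]
  calc _ ≤ C ^ 2 * (‖x‖ ^ 2 / δ * ∑ i ∈ F, ‖b i‖ ^ 2 / l i) := by gcongr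
    _ = _ := by ring

/-- Duality: a functional bounded by ‖L^{−1/2}b‖ is given by a vector with finite norm ‖L^{1/2}x‖.
With the test vector b = Lx, truncated to F, both the pairing and the square of the dual norm equal
the weighted sum. -/
theorem sum_weighted_le (h : LyapunovFamily V l P k C) [∀ i, FiniteDimensional ℝ (V i)] {C₁ : ℝ}
    (F : Finset ι) (x : E)
    (hx : ∀ b : ι → E, (∀ i, b i ∈ V i) →
      inner ℝ x (∑ i ∈ F, b i) ≤ C₁ * √(∑ i ∈ F, ‖b i‖ ^ 2 / l i)) (hC₁ : 0 ≤ C₁) :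
    √(∑ i ∈ F, l i * ‖(V i).starProjection x‖ ^ 2) ≤ C₁ := by
  have hmem : ∀ i, l i • (V i).starProjection x ∈ V i := fun i =>
    (V i).smul_mem _ ((V i).starProjection_apply_mem x)
  have h1 := hx _ hmem
  rw [inner_sum_right_eq F x hmem] at h1
  have e1 : ∑ i ∈ F, inner ℝ ((V i).starProjection x) (l i • (V i).starProjection x)
      = ∑ i ∈ F, l i * ‖(V i).starProjection x‖ ^ 2 :=
    Finset.sum_congr rfl fun i _ => by rw [real_inner_smul_right, real_inner_self_eq_norm_sq]
  have e2 : ∑ i ∈ F, ‖l i • (V i).starProjection x‖ ^ 2 / l i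
      = ∑ i ∈ F, l i * ‖(V i).starProjection x‖ ^ 2 :=
    Finset.sum_congr rfl fun i _ => by
      have := (h.pos i).ne'
      rw [norm_smul, mul_pow, Real.norm_eq_abs, sq_abs]
      field_simp
  rw [e1, e2] at h1
  set T := ∑ i ∈ F, l i * ‖(V i).starProjection x‖ ^ 2
  have hT : 0 ≤ T := Finset.sum_nonneg fun i _ => mul_nonneg (h.pos i).le (sq_nonneg _)
  rcases (Real.sqrt_nonneg T).eq_or_lt with h0 | h0
  · rw [← h0]; exact hC₁
  · refine le_of_mul_le_mul_right ?_ h0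
    rwa [Real.mul_self_sqrt hT]

/-- The form J is symmetric, so J(Lx, x) is half of J(Lx, x) + J(x, Lx), which the Lyapunov relation
evaluates. -/
theorem reflForm_weighted_eq (h : LyapunovFamily V l P k C) (F : Finset ι) {a : ι → E}
    (ha : ∀ i, a i ∈ V i) :
    reflForm P (∑ i ∈ F, l i • a i) (∑ i ∈ F, a i) = k (∑ i ∈ F, a i) (∑ i ∈ F, a i) := by
  have e1 : reflForm P (∑ i ∈ F, l i • a i) (∑ i ∈ F, a i)
      = ∑ i ∈ F, ∑ j ∈ F, l i * reflForm P (a i) (a j) := by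
    rw [reflForm_sum_left]
    refine Finset.sum_congr rfl fun i _ => ?_
    rw [reflForm_smul_left, reflForm_sum_right, Finset.mul_sum]
  have e2 : reflForm P (∑ i ∈ F, l i • a i) (∑ i ∈ F, a i)
      = ∑ i ∈ F, ∑ j ∈ F, l j * reflForm P (a i) (a j) := by
    rw [e1, Finset.sum_comm]
    refine Finset.sum_congr rfl fun i _ => Finset.sum_congr rfl fun j _ => ?_
    rw [reflForm_comm]
  have e3 : 2 * k (∑ i ∈ F, a i) (∑ i ∈ F, a i)
      = ∑ i ∈ F, ∑ j ∈ F, (l i + l j) * reflForm P (a i) (a j) := by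
    simp only [map_sum, LinearMap.sum_apply, Finset.mul_sum]
    rw [Finset.sum_comm]
    exact Finset.sum_congr rfl fun i _ => Finset.sum_congr rfl fun j _ =>
      (h.relation i j _ (ha i) _ (ha j)).symm
  simp only [add_mul, Finset.sum_add_distrib] at e3
  linarith

/-- From Px = 0 one has J(x, ·) = −(x | ·). The energy identity ‖L^{1/2}x‖² = −J(x, Lx) = −k(x, x) =
0 is applied to partial sums, because Lx need not exist. -/
theorem eq_zero_of_proj_eq_zero (h : LyapunovFamily V l P k C) {x : E}
    (hx : x ∈ (⨆ i, V i).topologicalClosure) (hP : P x = 0) : x = 0 := by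
  classical
  obtain ⟨C₁, hC₁, hbound⟩ := h.exists_abs_reflForm_le
  have := h.finite_dim
  have hJ : ∀ y, reflForm P x y = -inner ℝ x y := fun y => by simp [reflForm, hP]
  -- Half a power of regularity is gained: x lies in the domain of L^{1/2}. This keeps the error
  -- term below bounded.
  have hT : ∀ F : Finset ι, √(∑ i ∈ F, l i * ‖(V i).starProjection x‖ ^ 2) ≤ C₁ * ‖x‖ := by
    intro F
    refine h.sum_weighted_le F x (fun b hb => ?_) (by positivity)
    have := hbound x hx F b hb
    rw [hJ, abs_neg] at this
    exact (le_abs_self _).trans this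
  have hmem : ∀ i, (V i).starProjection x ∈ V i := fun i => (V i).starProjection_apply_mem x
  have hmem' : ∀ i, l i • (V i).starProjection x ∈ V i := fun i => (V i).smul_mem _ (hmem i)
  -- With x_F the partial sum, J(x, Lx_F) is split into J(x_F, Lx_F) = k(x_F, x_F), which tends to 0
  -- with Px_F, and J(x − x_F, Lx_F), which is at most C₁ ‖x − x_F‖ ‖L^{1/2}x_F‖.
  have hle : ∀ F : Finset ι, ∑ i ∈ F, l i * ‖(V i).starProjection x‖ ^ 2
      ≤ C * (‖P (partialProj V F x)‖ * ‖P (partialProj V F x)‖)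
        + C₁ * ‖x - partialProj V F x‖ * (C₁ * ‖x‖) := by
    intro F
    have h1 := h.reflForm_weighted_eq F hmem
    rw [← partialProj_apply] at h1
    have h2 := (abs_le.1 (h.bound (partialProj V F x) (partialProj V F x))).1
    have h3 := hbound (x - partialProj V F x)
      (Submodule.sub_mem _ hx (partialProj_mem F x)) F _ hmem'
    have e2 : ∑ i ∈ F, ‖l i • (V i).starProjection x‖ ^ 2 / l i
        = ∑ i ∈ F, l i * ‖(V i).starProjection x‖ ^ 2 :=
      Finset.sum_congr rfl fun i _ => by
        have := (h.pos i).ne'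
        rw [norm_smul, mul_pow, Real.norm_eq_abs, sq_abs]
        field_simp
    rw [e2, reflForm_sub_left, hJ, inner_sum_right_eq F x hmem', reflForm_comm P (partialProj V F x),
      h1] at h3
    have e1 : ∑ i ∈ F, inner ℝ ((V i).starProjection x) (l i • (V i).starProjection x)
        = ∑ i ∈ F, l i * ‖(V i).starProjection x‖ ^ 2 :=
      Finset.sum_congr rfl fun i _ => by rw [real_inner_smul_right, real_inner_self_eq_norm_sq]
    rw [e1] at h3
    have h4 := (abs_le.1 h3).1
    have h5 : C₁ * ‖x - partialProj V F x‖ * √(∑ i ∈ F, l i * ‖(V i).starProjection x‖ ^ 2)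
        ≤ C₁ * ‖x - partialProj V F x‖ * (C₁ * ‖x‖) := by
      gcongr
      exact hT F
    linarith
  have hlim : Tendsto (fun F : Finset ι => C * (‖P (partialProj V F x)‖ * ‖P (partialProj V F x)‖)
        + C₁ * ‖x - partialProj V F x‖ * (C₁ * ‖x‖)) atTop (𝓝 0) := by
    have hc : Continuous fun y : E => C * (‖P y‖ * ‖P y‖) + C₁ * ‖x - y‖ * (C₁ * ‖x‖) := by fun_prop
    have := (hc.tendsto x).comp (tendsto_partialProj h.orth hx)
    simpa [hP, Function.comp_def] using this
  have hzero : ∀ i, (V i).starProjection x = 0 := by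
    intro i
    have h1 : l i * ‖(V i).starProjection x‖ ^ 2 ≤ 0 := by
      refine ge_of_tendsto hlim ?_
      filter_upwards [eventually_ge_atTop {i}] with F hF
      refine le_trans ?_ (hle F)
      exact Finset.single_le_sum (f := fun i => l i * ‖(V i).starProjection x‖ ^ 2)
        (fun j _ => mul_nonneg (h.pos j).le (sq_nonneg _)) (hF (Finset.mem_singleton_self i))
    have h2 : ‖(V i).starProjection x‖ ^ 2 ≤ 0 := nonpos_of_mul_nonpos_right h1 (h.pos i)
    exact norm_eq_zero.1 (pow_eq_zero_iff two_ne_zero |>.1 (le_antisymm h2 (sq_nonneg _)))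
  refine tendsto_nhds_unique (tendsto_partialProj h.orth hx) ?_
  have : (fun F : Finset ι => partialProj V F x) = fun _ => 0 := by
    ext F
    simp [partialProj_apply, hzero]
  rw [this]
  exact tendsto_const_nhds

end LyapunovFamily

/-- The compression of `P` to a subspace `W`. -/
noncomputable def compress (P : E →L[ℝ] E) (W : Submodule ℝ E) [W.HasOrthogonalProjection] :
    W →L[ℝ] W :=
  W.orthogonalProjectionOnto ∘L P ∘L W.subtypeL

/-! ### Invertibility of the compression and bounds for its inverse -/

namespace LyapunovFamily

variable {V : ι → Submodule ℝ E} {l : ι → ℝ} {P : E →L[ℝ] E} {k : E →ₗ[ℝ] E →ₗ[ℝ] ℝ} {C : ℝ}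
  {W : Submodule ℝ E} [W.HasOrthogonalProjection]

theorem inner_compress (h : LyapunovFamily V l P k C) (x : W) {y : E} (hy : y ∈ W) :
    inner ℝ (compress P W x : E) y = inner ℝ (P x) (P y) := by
  rw [← h.proj]
  change inner ℝ (W.starProjection (P x)) y = _
  rw [Submodule.inner_starProjection_left_eq_right, Submodule.starProjection_eq_self_iff.2 hy]

theorem inner_reflection (h : LyapunovFamily V l P k C) (x : W) {y : E} (hy : y ∈ W) :
    inner ℝ (((2 : ℝ) • compress P W - ContinuousLinearMap.id ℝ W) x : E) y = reflForm P x y := by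
  have : (((2 : ℝ) • compress P W - ContinuousLinearMap.id ℝ W) x : E)
      = (2 : ℝ) • (compress P W x : E) - x := rfl
  rw [this, inner_sub_left, real_inner_smul_left, h.inner_compress x hy]
  rfl

/-- For x in the kernel of the compression, ‖Px‖² is the inner product of the compression at x with
x, hence zero. -/
theorem compress_injective (h : LyapunovFamily V l P k C)
    (hW : W = (⨆ i, V i).topologicalClosure) : Function.Injective (compress P W) := by
  refine (injective_iff_map_eq_zero _).2 fun x hx => ?_
  have h1 := h.inner_compress x x.2
  rw [hx] at h1
  have h2 : P x = 0 := by
    rw [← inner_self_eq_zero (𝕜 := ℝ), ← h1]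
    simp
  exact Subtype.ext (h.eq_zero_of_proj_eq_zero (hW ▸ x.2) h2)

theorem isCompactOperator_partialProj [∀ i, FiniteDimensional ℝ (V i)] (F : Finset ι) :
    IsCompactOperator (partialProj V F) := by
  classical
  induction F using Finset.induction_on with
  | empty =>
    have : partialProj V ∅ = 0 := by simp [partialProj]
    rw [this]
    exact isCompactOperator_zero
  | insert i F hi ih =>
    have : partialProj V (insert i F) = (V i).starProjection + partialProj V F := by
      simp [partialProj, Finset.sum_insert hi]
    rw [this]
    refine IsCompactOperator.add ?_ ih
    have h1 : IsCompactOperator (V i).subtypeL :=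
      isCompactOperator_of_locallyCompactSpace_rng (V i).subtypeL
    exact h1.comp_clm (V i).orthogonalProjectionOnto

/-- A limit in norm of finite-rank operators: the weighted estimate for J makes the part of Qx in
the eigenspaces with weight above n + 1 of size at most C₁ ‖x‖ / √(n + 1). -/
theorem isCompactOperator_reflection [CompleteSpace E] (h : LyapunovFamily V l P k C)
    (hW : W = (⨆ i, V i).topologicalClosure) :
    IsCompactOperator ((2 : ℝ) • compress P W - ContinuousLinearMap.id ℝ W) := by
  classical
  have := h.finite_dim
  obtain ⟨C₁, hC₁, hbound⟩ := h.exists_abs_reflForm_le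
  set Q := (2 : ℝ) • compress P W - ContinuousLinearMap.id ℝ W with hQ
  have hWc : IsClosed (W : Set E) := by
    rw [hW]; exact Submodule.isClosed_topologicalClosure _
  set T : W →L[ℝ] E := W.subtypeL ∘L Q with hT
  have hTW : ∀ x, T x ∈ (⨆ i, V i).topologicalClosure := fun x => hW ▸ (Q x).2
  suffices hc : IsCompactOperator T from hc.codRestrict (fun x => (Q x).2) hWc
  set F : ℕ → Finset ι := fun n => (h.discrete (n + 1)).toFinset with hF
  have hest : ∀ n x, ‖T x - partialProj V (F n) (T x)‖ ≤ C₁ * ‖x‖ / √(n + 1) := by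
    intro n x
    have hlim : Tendsto (fun G : Finset ι => ‖partialProj V G (T x) - partialProj V (F n) (T x)‖)
        atTop (𝓝 ‖T x - partialProj V (F n) (T x)‖) :=
      ((tendsto_partialProj h.orth (hTW x)).sub_const _).norm
    refine le_of_tendsto hlim ?_
    filter_upwards [eventually_ge_atTop (F n)] with G hG
    have e : partialProj V G (T x) - partialProj V (F n) (T x) = partialProj V (G \ F n) (T x) := by
      rw [partialProj_apply, partialProj_apply, partialProj_apply, sub_eq_iff_eq_add,
        Finset.sum_sdiff hG]
    rw [e]
    set z := partialProj V (G \ F n) (T x) with hz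
    have hzW : z ∈ W := hW ▸ partialProj_mem _ _
    -- The tail z of Tx lies in W, so pairing Tx with z computes both ‖z‖² and J(x, z). The estimate
    -- of J then has a factor ‖z‖ / √(n + 1), and one factor ‖z‖ cancels.
    have h1 : ‖z‖ ^ 2 = reflForm P x z := by
      rw [← h.inner_reflection x hzW, hz, ← inner_partialProj_self h.orth]
      rfl
    have hmem : ∀ i, (V i).starProjection (T x) ∈ V i := fun i => (V i).starProjection_apply_mem _
    have h2 := hbound x (hW ▸ x.2) (G \ F n) _ hmem
    rw [← partialProj_apply, ← hz, ← h1] at h2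
    have h3 : ∑ i ∈ G \ F n, ‖(V i).starProjection (T x)‖ ^ 2 / l i ≤ ‖z‖ ^ 2 / (n + 1) := by
      rw [hz, norm_partialProj_sq h.orth, Finset.sum_div]
      refine Finset.sum_le_sum fun i hi => ?_
      by_cases h0 : V i = ⊥
      · have : (V i).starProjection (T x) = 0 := by simp [h0]
        simp [this]
      · have : (n + 1 : ℝ) ≤ l i := by
          have := (Finset.mem_sdiff.1 hi).2
          simp only [hF, Set.Finite.mem_toFinset, Set.mem_ofPred_eq, not_and, not_le] at this
          exact (this h0).le
        gcongr
    have h4 : ‖z‖ ^ 2 ≤ C₁ * ‖x‖ * (‖z‖ / √(n + 1)) := by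
      refine (le_abs_self _).trans (h2.trans ?_)
      have h5 : √(∑ i ∈ G \ F n, ‖(V i).starProjection (T x)‖ ^ 2 / l i) ≤ ‖z‖ / √(n + 1) := by
        refine (Real.sqrt_le_sqrt h3).trans (le_of_eq ?_)
        rw [Real.sqrt_div (sq_nonneg _), Real.sqrt_sq (norm_nonneg _)]
      have e3 : ‖(x : E)‖ = ‖x‖ := rfl
      rw [e3]
      gcongr
    rcases (norm_nonneg z).eq_or_lt with h0 | h0
    · rw [← h0]; positivity
    · refine le_of_mul_le_mul_right ?_ h0
      calc ‖z‖ * ‖z‖ = ‖z‖ ^ 2 := (sq _).symm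
        _ ≤ _ := h4
        _ = _ := by ring
  refine isCompactOperator_of_tendsto (l := atTop) (F := fun n => partialProj V (F n) ∘L T) ?_
    (Eventually.of_forall fun n => (isCompactOperator_partialProj (F n)).comp_clm T)
  rw [tendsto_iff_norm_sub_tendsto_zero]
  have hz : Tendsto (fun n : ℕ => C₁ / √((n : ℝ) + 1)) atTop (𝓝 0) :=
    tendsto_const_nhds.div_atTop
      (Real.tendsto_sqrt_atTop.comp (tendsto_atTop_add_const_right _ _ tendsto_natCast_atTop_atTop))
  refine squeeze_zero (fun _ => norm_nonneg _) (fun n => ?_) hz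
  rw [norm_sub_rev]
  refine ContinuousLinearMap.opNorm_le_bound _ (by positivity) fun x => ?_
  refine (hest n x).trans (le_of_eq ?_)
  ring

/-- The Fredholm alternative for the compact operator Q = 2T − 1, where T is the compression, at the
point −1: since −1 − Q = −2T, an eigenvector would lie in the kernel of T, and otherwise the
resolvent inverts T. -/
theorem isInvertible_compress [CompleteSpace E] (h : LyapunovFamily V l P k C)
    (hW : W = (⨆ i, V i).topologicalClosure) : (compress P W).IsInvertible := by
  have hWc : IsClosed (W : Set E) := by
    rw [hW]; exact Submodule.isClosed_topologicalClosure _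
  have : CompleteSpace W := hWc.completeSpace_coe
  have hc := h.isCompactOperator_reflection hW
  set Q := (2 : ℝ) • compress P W - ContinuousLinearMap.id ℝ W with hQ
  have hQx : ∀ x, Q x = (2 : ℝ) • compress P W x - x := fun x => rfl
  have hinj := h.compress_injective hW
  have hbij : Function.Bijective (compress P W) := by
    rcases hc.hasEigenvalue_or_mem_resolventSet (μ := -1) (by norm_num) with he | he
    · exfalso
      obtain ⟨x, hx⟩ := he.exists_hasEigenvector
      have h1 : Q x = (-1 : ℝ) • x := hx.apply_eq_smul
      rw [hQx, neg_one_smul, sub_eq_neg_self, smul_eq_zero] at h1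
      rcases h1 with h1 | h1
      · norm_num at h1
      · exact hx.2 (hinj (h1.trans (map_zero _).symm))
    · refine ⟨hinj, ?_⟩
      have hu : IsUnit ((algebraMap ℝ (W →L[ℝ] W)) (-1) - Q) := he
      obtain ⟨u, hu⟩ := hu
      intro y
      refine ⟨(-2 : ℝ) • (u⁻¹.1 y), ?_⟩
      have h2 : u.1 (u⁻¹.1 y) = y := by
        rw [← mul_apply_eq_comp, Units.mul_inv]; rfl
      rw [hu] at h2
      have h3 : ((algebraMap ℝ (W →L[ℝ] W)) (-1) - Q) (u⁻¹.1 y)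
          = (-2 : ℝ) • compress P W (u⁻¹.1 y) := by
        rw [sub_apply, hQx, Algebra.algebraMap_eq_smul_one]
        simp
        abel
      rw [map_smul, ← h3, h2]
  exact ⟨ContinuousLinearEquiv.ofBijective _ (LinearMap.ker_eq_bot.2 hinj)
    (LinearMap.range_eq_top.2 hbij.2), by ext; rfl⟩

/-- The square of the weighted norm with weights `l`. -/
noncomputable def weightedSq (V : ι → Submodule ℝ E) [∀ i, FiniteDimensional ℝ (V i)] (l : ι → ℝ)
    (x : E) : ℝ≥0∞ :=
  ∑' i, ENNReal.ofReal (l i) * ‖(V i).starProjection x‖ₑ ^ 2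

theorem ofReal_sum_weighted (h : LyapunovFamily V l P k C) [∀ i, FiniteDimensional ℝ (V i)]
    (F : Finset ι) (x : E) :
    ENNReal.ofReal (∑ i ∈ F, l i * ‖(V i).starProjection x‖ ^ 2)
      = ∑ i ∈ F, ENNReal.ofReal (l i) * ‖(V i).starProjection x‖ₑ ^ 2 := by
  rw [ENNReal.ofReal_sum_of_nonneg fun i _ => mul_nonneg (h.pos i).le (sq_nonneg _)]
  refine Finset.sum_congr rfl fun i _ => ?_
  rw [ENNReal.ofReal_mul (h.pos i).le, ENNReal.ofReal_pow (norm_nonneg _), ofReal_norm]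

/-- The norm bound is the boundedness of the inverse. For the weighted norm, x = 2y − Qx with y the
compression of x, and Q maps boundedly into the domain of L^{1/2}. -/
theorem exists_bounds [CompleteSpace E] (h : LyapunovFamily V l P k C)
    [∀ i, FiniteDimensional ℝ (V i)]
    (hW : W = (⨆ i, V i).topologicalClosure) : ∃ M : ℝ, 0 < M ∧ ∀ x : W,
      ‖x‖ ≤ M * ‖compress P W x‖ ∧
      weightedSq V l x ≤ ENNReal.ofReal (M ^ 2) * weightedSq V l (compress P W x : E) := by
  obtain ⟨C₁, hC₁, hbound⟩ := h.exists_abs_reflForm_le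
  obtain ⟨δ, hδ, hgap⟩ := h.exists_gap
  obtain ⟨e, he⟩ := h.isInvertible_compress hW
  set M₀ := ‖(e.symm : W →L[ℝ] W)‖ with hM₀
  have hM : ∀ x : W, ‖x‖ ≤ M₀ * ‖compress P W x‖ := by
    intro x
    have := (e.symm : W →L[ℝ] W).le_opNorm (compress P W x)
    rw [← he] at this ⊢
    simpa using this
  have hM₀' : 0 ≤ M₀ := norm_nonneg (e.symm : W →L[ℝ] W)
  -- The second entry comes from ‖L^{1/2}x‖ ≤ 2√Y + C₁‖x‖ together with ‖x‖ ≤ M₀‖y‖ ≤ M₀ √Y / √δ,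
  -- where Y is the weighted square of y.
  refine ⟨max (M₀ + 1) (2 + C₁ * M₀ / √δ), by positivity, fun x => ⟨?_, ?_⟩⟩
  · refine (hM x).trans ?_
    gcongr
    exact (le_add_of_nonneg_right zero_le_one).trans (le_max_left _ _)
  set y := compress P W x with hy
  by_cases htop : weightedSq V l (y : E) = ⊤
  · rw [htop, ENNReal.mul_top (by positivity)]
    exact le_top
  set Y := (weightedSq V l (y : E)).toReal with hY
  have hY0 : 0 ≤ Y := ENNReal.toReal_nonneg
  have hYF : ∀ F : Finset ι, ∑ i ∈ F, l i * ‖(V i).starProjection (y : E)‖ ^ 2 ≤ Y := by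
    intro F
    rw [hY, ← ENNReal.ofReal_le_iff_le_toReal htop, h.ofReal_sum_weighted]
    exact ENNReal.sum_le_tsum F
  have hyY : ‖y‖ ^ 2 ≤ Y / δ := by
    have hlim : Tendsto (fun F : Finset ι => ‖partialProj V F (y : E)‖ ^ 2) atTop
        (𝓝 (‖(y : E)‖ ^ 2)) := ((tendsto_partialProj h.orth (hW ▸ y.2)).norm).pow 2
    refine le_of_tendsto hlim (Eventually.of_forall fun F => ?_)
    rw [norm_partialProj_sq h.orth, le_div_iff₀ hδ, Finset.sum_mul]
    refine le_trans (Finset.sum_le_sum fun i _ => ?_) (hYF F)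
    by_cases h0 : V i = ⊥
    · have : (V i).starProjection (y : E) = 0 := by simp [h0]
      simp [this]
    · rw [mul_comm]
      have := hgap i h0
      gcongr
  have hyY' : ‖y‖ ≤ √Y / √δ := by
    rw [← Real.sqrt_div hY0]
    exact Real.le_sqrt_of_sq_le hyY
  -- By duality it suffices to test x = 2y − Qx against finite sums b: the first term is estimated
  -- by Cauchy–Schwarz with the weights split as √(l i) and 1/√(l i), the second by the estimate of
  -- J.
  have hF : ∀ F : Finset ι, √(∑ i ∈ F, l i * ‖(V i).starProjection (x : E)‖ ^ 2)
      ≤ 2 * √Y + C₁ * ‖x‖ := by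
    intro F
    refine h.sum_weighted_le F x (fun b hb => ?_) (by positivity)
    have hbW : ∑ i ∈ F, b i ∈ W := by
      rw [hW]
      exact Submodule.le_topologicalClosure _
        (Submodule.sum_mem _ fun i _ => Submodule.mem_iSup_of_mem i (hb i))
    have h1 := h.inner_reflection x hbW
    have h2 : (((2 : ℝ) • compress P W - ContinuousLinearMap.id ℝ W) x : E)
      = (2 : ℝ) • (y : E) - x := rfl
    rw [h2, inner_sub_left, real_inner_smul_left] at h1
    have h3 := (abs_le.1 (hbound x (hW ▸ x.2) F b hb)).1
    have e3 : ‖(x : E)‖ = ‖x‖ := rfl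
    rw [e3] at h3
    have h4 : inner ℝ (y : E) (∑ i ∈ F, b i) ≤ √Y * √(∑ i ∈ F, ‖b i‖ ^ 2 / l i) := by
      rw [inner_sum_right_eq F _ hb]
      calc _ ≤ ∑ i ∈ F, (√(l i) * ‖(V i).starProjection (y : E)‖) * (‖b i‖ / √(l i)) := by
            refine Finset.sum_le_sum fun i _ => ?_
            refine (real_inner_le_norm _ _).trans (le_of_eq ?_)
            have := (Real.sqrt_pos.2 (h.pos i)).ne'
            field_simp
        _ ≤ √(∑ i ∈ F, (√(l i) * ‖(V i).starProjection (y : E)‖) ^ 2)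
            * √(∑ i ∈ F, (‖b i‖ / √(l i)) ^ 2) := Real.sum_mul_le_sqrt_mul_sqrt _ _ _
        _ ≤ _ := by
            have e4 : ∀ i ∈ F, (√(l i) * ‖(V i).starProjection (y : E)‖) ^ 2
                = l i * ‖(V i).starProjection (y : E)‖ ^ 2 := fun i _ => by
              rw [mul_pow, Real.sq_sqrt (h.pos i).le]
            have e5 : ∀ i ∈ F, (‖b i‖ / √(l i)) ^ 2 = ‖b i‖ ^ 2 / l i := fun i _ => by
              rw [div_pow, Real.sq_sqrt (h.pos i).le]
            rw [Finset.sum_congr rfl e4, Finset.sum_congr rfl e5]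
            gcongr
            exact hYF F
    linarith
  have hF' : ∀ F : Finset ι, ∑ i ∈ F, l i * ‖(V i).starProjection (x : E)‖ ^ 2
      ≤ (max (M₀ + 1) (2 + C₁ * M₀ / √δ)) ^ 2 * Y := by
    intro F
    have h1 : √(∑ i ∈ F, l i * ‖(V i).starProjection (x : E)‖ ^ 2)
        ≤ max (M₀ + 1) (2 + C₁ * M₀ / √δ) * √Y := by
      calc _ ≤ 2 * √Y + C₁ * (M₀ * (√Y / √δ)) := by
            refine (hF F).trans ?_
            have := (hM x).trans (mul_le_mul_of_nonneg_left hyY' hM₀')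
            gcongr
        _ = (2 + C₁ * M₀ / √δ) * √Y := by ring
        _ ≤ _ := by gcongr; exact le_max_right _ _
    rw [Real.sqrt_le_left (by positivity), mul_pow, Real.sq_sqrt hY0] at h1
    exact h1
  rw [weightedSq, ENNReal.tsum_eq_iSup_sum]
  refine iSup_le fun F => ?_
  rw [← h.ofReal_sum_weighted]
  refine (ENNReal.ofReal_le_ofReal (hF' F)).trans (le_of_eq ?_)
  rw [ENNReal.ofReal_mul (by positivity), hY, ENNReal.ofReal_toReal htop]

end LyapunovFamily

end Lyapunov

end Graetz

/-! ### Estimates along segments -/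

namespace Graetz

theorem sq_lintegral_le {α : Type*} [MeasurableSpace α] {μ : Measure α} {f : α → ℝ≥0∞}
    (hf : AEMeasurable f μ) : (∫⁻ x, f x ∂μ) ^ 2 ≤ μ univ * ∫⁻ x, f x ^ 2 ∂μ := by
  have h := ENNReal.lintegral_mul_le_Lp_mul_Lq μ Real.HolderConjugate.two_two
    (aemeasurable_const (b := (1 : ℝ≥0∞))) hf
  simp only [Pi.mul_apply, one_mul, one_pow, lintegral_const, ENNReal.rpow_two] at h
  calc _ ≤ (μ univ ^ (1 / 2 : ℝ) * (∫⁻ x, f x ^ 2 ∂μ) ^ (1 / 2 : ℝ)) ^ 2 := by gcongr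
    _ = _ := by
      rw [mul_pow, ← ENNReal.rpow_two, ← ENNReal.rpow_two, ← ENNReal.rpow_mul, ← ENNReal.rpow_mul]
      norm_num

theorem ennreal_add_sq_le (a b : ℝ≥0∞) : (a + b) ^ 2 ≤ 2 * (a ^ 2 + b ^ 2) := by
  have := ENNReal.rpow_add_le_mul_rpow_add_rpow a b (p := 2) (by norm_num)
  norm_num at this
  exact this

theorem enorm_gradient (f : Plane → ℝ) (x : Plane) : ‖gradient f x‖ₑ = ‖fderiv ℝ f x‖ₑ := by
  rw [← ofReal_norm, ← ofReal_norm, gradient, LinearIsometryEquiv.norm_map]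

theorem continuous_gradient {f : Plane → ℝ} (hf : ContDiff ℝ ∞ f) : Continuous (gradient f) :=
  Data.contDiff_gradient_continuous hf

/-- The fundamental theorem of calculus and Cauchy–Schwarz; integrating over all of (0, ρ) makes the
bound independent of s and t. -/
theorem enorm_sub_sq_le_segment {f : Plane → ℝ} (hf : ContDiff ℝ ∞ f) (x v : Plane) {ρ s t : ℝ}
    (hs : s ∈ Icc 0 ρ) (ht : t ∈ Icc 0 ρ) :
    ‖f (x + t • v) - f (x + s • v)‖ₑ ^ 2
      ≤ ENNReal.ofReal ρ * (‖v‖ₑ ^ 2 * ∫⁻ r in Ioo 0 ρ, ‖gradient f (x + r • v)‖ₑ ^ 2) := by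
  have hcont : Continuous fun r : ℝ => fderiv ℝ f (x + r • v) v := by
    have := hf.continuous_fderiv (by simp)
    fun_prop
  have hder : ∀ r : ℝ, HasDerivAt (fun r : ℝ => f (x + r • v)) (fderiv ℝ f (x + r • v) v) r := by
    intro r
    have h1 : HasDerivAt (fun r : ℝ => x + r • v) v r := by
      simpa using ((hasDerivAt_id r).smul_const v).const_add x
    exact ((hf.differentiable (by simp)) _).hasFDerivAt.comp_hasDerivAt r h1
  have e : f (x + t • v) - f (x + s • v) = ∫ r in s..t, fderiv ℝ f (x + r • v) v :=
    (intervalIntegral.integral_eq_sub_of_hasDerivAt (fun r _ => hder r)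
      (hcont.intervalIntegrable _ _)).symm
  have hsub : uIoc s t ⊆ Icc 0 ρ := by
    intro r hr
    rcases mem_uIoc.1 hr with h | h
    · exact ⟨hs.1.trans h.1.le, h.2.trans ht.2⟩
    · exact ⟨ht.1.trans h.1.le, h.2.trans hs.2⟩
  have h1 : ‖f (x + t • v) - f (x + s • v)‖ₑ
      ≤ ∫⁻ r in Ioo 0 ρ, ‖gradient f (x + r • v)‖ₑ * ‖v‖ₑ := by
    rw [e, ← ofReal_norm, intervalIntegral.norm_intervalIntegral_eq, ofReal_norm]
    refine (enorm_integral_le_lintegral_enorm _).trans ?_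
    rw [Measure.restrict_congr_set Ioo_ae_eq_Icc]
    refine (lintegral_mono_set hsub).trans (lintegral_mono fun r => ?_)
    rw [enorm_gradient]
    exact ContinuousLinearMap.le_opENorm _ _
  have hg := continuous_gradient hf
  have hmeas : Measurable fun r : ℝ => ‖gradient f (x + r • v)‖ₑ :=
    (Continuous.comp (by fun_prop : Continuous fun y => gradient f y)
      (by fun_prop : Continuous fun r : ℝ => x + r • v)).measurable.enorm
  calc _ ≤ (∫⁻ r in Ioo 0 ρ, ‖gradient f (x + r • v)‖ₑ * ‖v‖ₑ) ^ 2 := by gcongr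
    _ ≤ _ := sq_lintegral_le (hmeas.mul_const _).aemeasurable
    _ = _ := by
      simp only [mul_pow]
      rw [lintegral_mul_const _ (hmeas.pow_const 2)]
      simp [mul_comm]

/-- The value at t is compared with the value at s, and the comparison is averaged over s in (0, ρ).
The endpoint t = 0 is allowed, which later gives the trace. -/
theorem enorm_sq_le_line {f : Plane → ℝ} (hf : ContDiff ℝ ∞ f) (x : Plane) {v : Plane}
    (hv : ‖v‖ₑ ≤ 1) {ρ t : ℝ} (hρ : 0 < ρ) (ht : t ∈ Icc 0 ρ) :
    ‖f (x + t • v)‖ₑ ^ 2 ≤ ENNReal.ofReal (2 / ρ + 2 * ρ) *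
      ∫⁻ r in Ioo 0 ρ, (‖f (x + r • v)‖ₑ ^ 2 + ‖gradient f (x + r • v)‖ₑ ^ 2) := by
  set A := ∫⁻ r in Ioo 0 ρ, ‖f (x + r • v)‖ₑ ^ 2 with hA
  set B := ∫⁻ r in Ioo 0 ρ, ‖gradient f (x + r • v)‖ₑ ^ 2 with hB
  have hfm : Measurable fun r : ℝ => ‖f (x + r • v)‖ₑ ^ 2 := by
    have := hf.continuous
    exact (Continuous.measurable (by fun_prop : Continuous fun r : ℝ => f (x + r • v))).enorm.pow_const 2
  have hAB : ∫⁻ r in Ioo 0 ρ, (‖f (x + r • v)‖ₑ ^ 2 + ‖gradient f (x + r • v)‖ₑ ^ 2) = A + B :=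
    lintegral_add_left hfm _
  have hpt : ∀ s ∈ Ioo 0 ρ, ‖f (x + t • v)‖ₑ ^ 2
      ≤ 2 * ‖f (x + s • v)‖ₑ ^ 2 + 2 * (ENNReal.ofReal ρ * B) := by
    intro s hs
    have h1 := enorm_sub_sq_le_segment hf x v (Ioo_subset_Icc_self hs) ht
    have h2 : ‖f (x + t • v)‖ₑ ≤ ‖f (x + s • v)‖ₑ + ‖f (x + t • v) - f (x + s • v)‖ₑ := by
      refine le_trans (le_of_eq ?_) (enorm_add_le _ _)
      congr 1; ring
    calc _ ≤ (‖f (x + s • v)‖ₑ + ‖f (x + t • v) - f (x + s • v)‖ₑ) ^ 2 := by gcongr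
      _ ≤ 2 * (‖f (x + s • v)‖ₑ ^ 2 + ‖f (x + t • v) - f (x + s • v)‖ₑ ^ 2) :=
        ennreal_add_sq_le _ _
      _ ≤ 2 * (‖f (x + s • v)‖ₑ ^ 2 + ENNReal.ofReal ρ * B) := by
        gcongr
        refine h1.trans ?_
        gcongr
        calc _ ≤ (1 : ℝ≥0∞) ^ 2 * B := by gcongr
          _ = B := by simp
      _ = _ := by ring
  have hint : ENNReal.ofReal ρ * ‖f (x + t • v)‖ₑ ^ 2
      ≤ 2 * A + 2 * (ENNReal.ofReal ρ * B) * ENNReal.ofReal ρ := by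
    calc _ = ∫⁻ s in Ioo 0 ρ, ‖f (x + t • v)‖ₑ ^ 2 := by simp [mul_comm]
      _ ≤ ∫⁻ s in Ioo 0 ρ, (2 * ‖f (x + s • v)‖ₑ ^ 2 + 2 * (ENNReal.ofReal ρ * B)) :=
        setLIntegral_mono' measurableSet_Ioo hpt
      _ = _ := by
        rw [lintegral_add_left (hfm.const_mul 2), lintegral_const_mul _ hfm]
        simp [hA]
  have hρ' : ENNReal.ofReal ρ ≠ 0 := by simpa using hρ
  rw [hAB]
  calc ‖f (x + t • v)‖ₑ ^ 2 = (ENNReal.ofReal ρ)⁻¹ * (ENNReal.ofReal ρ * ‖f (x + t • v)‖ₑ ^ 2) := by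
        rw [← mul_assoc, ENNReal.inv_mul_cancel hρ' ENNReal.ofReal_ne_top, one_mul]
    _ ≤ (ENNReal.ofReal ρ)⁻¹ * (2 * A + 2 * (ENNReal.ofReal ρ * B) * ENNReal.ofReal ρ) := by gcongr
    _ = 2 * (ENNReal.ofReal ρ)⁻¹ * A + 2 * ENNReal.ofReal ρ * B
        * ((ENNReal.ofReal ρ)⁻¹ * ENNReal.ofReal ρ) := by ring
    _ = ENNReal.ofReal (2 / ρ) * A + ENNReal.ofReal (2 * ρ) * B := by
        rw [ENNReal.inv_mul_cancel hρ' ENNReal.ofReal_ne_top, mul_one, ENNReal.ofReal_div_of_pos hρ,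
          ENNReal.ofReal_mul two_pos.le]
        simp [div_eq_mul_inv]
    _ ≤ ENNReal.ofReal (2 / ρ + 2 * ρ) * A + ENNReal.ofReal (2 / ρ + 2 * ρ) * B := by
        gcongr
        · linarith
        · have : 0 < 2 / ρ := by positivity
          linarith
    _ = _ := by ring

/-- The square of the norm of `f` in `H¹(Ω)`. -/
noncomputable def sobolevSq (Ω : Set Plane) (f : Plane → ℝ) : ℝ≥0∞ :=
  ∫⁻ x in Ω, (‖f x‖ₑ ^ 2 + ‖gradient f x‖ₑ ^ 2)

/-! ### Lipschitz charts, the trace inequality and thin boundary layers -/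

section Chart

variable (p : Plane) (e : Plane ≃ₗᵢ[ℝ] Plane) (γ : ℝ → ℝ)

/-- The parametrization of the plane by a coordinate along a Lipschitz graph and the height over the
graph. -/
noncomputable def chart (q : ℝ × ℝ) : Plane := p + e.symm (!₂[q.1, γ q.1 + q.2])

/-- The height of `x` over the graph. -/
noncomputable def height (x : Plane) : ℝ := e (x - p) 1 - γ (e (x - p) 0)

theorem chart_coord (x : Plane) : chart p e γ (e (x - p) 0, height p e γ x) = x := by
  have : !₂[e (x - p) 0, e (x - p) 1] = e (x - p) := by
    ext i; fin_cases i <;> rfl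
  rw [chart, height, add_sub_cancel, this]
  simp

theorem coord_chart (q : ℝ × ℝ) : e (chart p e γ q - p) 0 = q.1 := by simp [chart]

theorem height_chart (q : ℝ × ℝ) : height p e γ (chart p e γ q) = q.2 := by simp [chart, height]

theorem chart_eq_add (y t : ℝ) : chart p e γ (y, t) = chart p e γ (y, 0) + t • e.symm !₂[0, 1] := by
  rw [chart, chart, add_assoc, ← map_smul, ← map_add]
  congr 2
  ext i; fin_cases i <;> simp

theorem enorm_direction : ‖e.symm !₂[(0 : ℝ), 1]‖ₑ ≤ 1 := by
  rw [← ofReal_norm, LinearIsometryEquiv.norm_map, EuclideanSpace.norm_eq]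
  simp

variable {γ}

/-- A shear along the second coordinate followed by an isometry; no differentiability of γ is
involved. -/
theorem measurePreserving_chart (hγ : Continuous γ) :
    MeasurePreserving (chart p e γ) (volume : Measure (ℝ × ℝ)) volume := by
  have h1 : MeasurePreserving (fun q : ℝ × ℝ => (q.1, γ q.1 + q.2)) volume volume := by
    refine (MeasurePreserving.id (volume : Measure ℝ)).skew_product
      (g := fun a b => γ a + b) (by fun_prop) ?_
    exact Eventually.of_forall fun a => map_add_left_eq_self _ _
  have h2 := (volume_preserving_finTwoArrow ℝ).symm
  have h3 := EuclideanSpace.volume_preserving_symm_measurableEquiv_toLp (Fin 2)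
  have h4 := e.symm.measurePreserving
  have h5 := measurePreserving_add_left (volume : Measure Plane) p
  have := h5.comp (h4.comp (h3.symm.comp (h2.comp h1)))
  convert this using 1
  funext q
  have : !₂[q.1, γ q.1 + q.2] = (MeasurableEquiv.toLp 2 (Fin 2 → ℝ)).symm.symm
      (MeasurableEquiv.finTwoArrow.symm (q.1, γ q.1 + q.2)) := by
    ext j; fin_cases j <;> rfl
  rw [chart, this]
  rfl

theorem lipschitz_height {K : NNReal} (hγ : LipschitzWith K γ) (x z : Plane) :
    |height p e γ x - height p e γ z| ≤ (1 + K) * dist x z := by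
  have hc : ∀ i, |e (x - p) i - e (z - p) i| ≤ dist x z := by
    intro i
    have h1 : e (x - p) i - e (z - p) i = e (x - z) i := by
      rw [← PiLp.sub_apply, ← map_sub, sub_sub_sub_cancel_right]
    rw [h1, dist_eq_norm, ← LinearIsometryEquiv.norm_map e, ← Real.norm_eq_abs]
    exact PiLp.norm_apply_le _ _
  have h2 := hγ.dist_le_mul (e (x - p) 0) (e (z - p) 0)
  rw [Real.dist_eq, Real.dist_eq] at h2
  have h3 : |γ (e (x - p) 0) - γ (e (z - p) 0)| ≤ K * dist x z :=
    h2.trans (mul_le_mul_of_nonneg_left (hc 0) K.2)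
  calc _ = |(e (x - p) 1 - e (z - p) 1) - (γ (e (x - p) 0) - γ (e (z - p) 0))| := by
        unfold height; congr 1; ring
    _ ≤ _ := abs_sub _ _
    _ ≤ dist x z + K * dist x z := add_le_add (hc 1) h3
    _ = _ := by ring

theorem continuous_height (hγ : Continuous γ) : Continuous (height p e γ) := by
  unfold height; fun_prop

theorem lipschitz_graph {K : NNReal} (hγ : LipschitzWith K γ) :
    LipschitzWith (1 + K) fun y : ℝ => chart p e γ (y, 0) := by
  refine LipschitzWith.of_dist_le_mul fun y z => ?_
  have h1 : dist (chart p e γ (y, 0)) (chart p e γ (z, 0)) = ‖!₂[y - z, γ y - γ z]‖ := by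
    rw [dist_eq_norm, chart, chart, add_sub_add_left_eq_sub, ← map_sub, LinearIsometryEquiv.norm_map]
    congr 1
    ext i; fin_cases i <;> simp
  have h2 := hγ.dist_le_mul y z
  rw [Real.dist_eq, Real.dist_eq] at h2
  rw [h1, EuclideanSpace.norm_eq, Real.dist_eq]
  simp only [Fin.sum_univ_two, Real.norm_eq_abs, NNReal.coe_add, NNReal.coe_one]
  refine Real.sqrt_le_iff.2 ⟨by positivity, ?_⟩
  simp only [Matrix.cons_val_zero, Matrix.cons_val_one]
  have := abs_nonneg (y - z)
  have := K.2
  calc _ ≤ |y - z| ^ 2 + (K * |y - z|) ^ 2 := by gcongr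
    _ ≤ _ := by nlinarith [mul_nonneg K.2 (sq_nonneg |y - z|)]

/-- A Lipschitz map increases one-dimensional Hausdorff measure at most by its Lipschitz constant,
so length on the graph is dominated by a multiple of the image of Lebesgue measure. -/
theorem lintegral_graph_le {K : NNReal} (hγ : LipschitzWith K γ) {A : Set Plane} {I : Set ℝ}
    (hA : A ⊆ (fun y : ℝ => chart p e γ (y, 0)) '' I) {g : Plane → ℝ≥0∞}
    (hg : Measurable g) :
    ∫⁻ x in A, g x ∂len ≤ (1 + K : NNReal) * ∫⁻ y in I, g (chart p e γ (y, 0)) := by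
  set φ := fun y : ℝ => chart p e γ (y, 0)
  have hφ : LipschitzWith (1 + K) φ := lipschitz_graph p e hγ
  have hle : len.restrict A ≤ ((1 + K : NNReal) : ℝ≥0∞) • Measure.map φ (volume.restrict I) := by
    refine Measure.le_intro fun s hs _ => ?_
    rw [Measure.restrict_apply hs, Measure.smul_apply, Measure.map_apply hφ.continuous.measurable hs,
      Measure.restrict_apply (hφ.continuous.measurable hs), smul_eq_mul]
    calc len (s ∩ A) ≤ len (φ '' (φ ⁻¹' s ∩ I)) := by
          refine measure_mono ?_
          rintro x ⟨hx, hxA⟩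
          obtain ⟨y, hy, rfl⟩ := hA hxA
          exact ⟨y, ⟨hx, hy⟩, rfl⟩
      _ ≤ _ := hφ.hausdorffMeasure_image_le zero_le_one _
      _ = _ := by rw [hausdorffMeasure_real]; simp
  calc _ ≤ ∫⁻ x, g x ∂(((1 + K : NNReal) : ℝ≥0∞) • Measure.map φ (volume.restrict I)) :=
        lintegral_mono' hle le_rfl
    _ = _ := by rw [lintegral_smul_measure, lintegral_map hg hφ.continuous.measurable, smul_eq_mul]

/-- The one-dimensional estimate integrated over the base, with a constant uniform in the height t.
Height 0 yields the trace inequality, and integration over small heights the layer estimate. -/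
theorem lintegral_line_le {f : Plane → ℝ} (hf : ContDiff ℝ ∞ f) (hγ : Continuous γ) {Ω : Set Plane}
    (hΩ : MeasurableSet Ω) {I : Set ℝ} {ρ : ℝ} (hρ : 0 < ρ)
    (hsub : ∀ y ∈ I, ∀ t ∈ Ioo 0 ρ, chart p e γ (y, t) ∈ Ω) {t : ℝ} (ht : t ∈ Icc 0 ρ) :
    ∫⁻ y in I, ‖f (chart p e γ (y, t))‖ₑ ^ 2
      ≤ ENNReal.ofReal (2 / ρ + 2 * ρ) * sobolevSq Ω f := by
  set g : Plane → ℝ≥0∞ := fun x => ‖f x‖ₑ ^ 2 + ‖gradient f x‖ₑ ^ 2 with hg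
  have hgm : Measurable g :=
    (hf.continuous.measurable.enorm.pow_const 2).add
      ((continuous_gradient hf).measurable.enorm.pow_const 2)
  have hchart := (measurePreserving_chart p e hγ)
  have h1 : ∀ y, ‖f (chart p e γ (y, t))‖ₑ ^ 2
      ≤ ENNReal.ofReal (2 / ρ + 2 * ρ) * ∫⁻ r in Ioo 0 ρ, g (chart p e γ (y, r)) := by
    intro y
    have := enorm_sq_le_line hf (chart p e γ (y, 0)) (enorm_direction e) hρ ht
    simp only [← chart_eq_add] at this
    exact this
  calc _ ≤ ∫⁻ y in I, ENNReal.ofReal (2 / ρ + 2 * ρ) * ∫⁻ r in Ioo 0 ρ, g (chart p e γ (y, r)) :=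
        lintegral_mono h1
    _ = ENNReal.ofReal (2 / ρ + 2 * ρ) * ∫⁻ y in I, ∫⁻ r in Ioo 0 ρ, g (chart p e γ (y, r)) :=
        lintegral_const_mul' _ _ ENNReal.ofReal_ne_top
    _ = ENNReal.ofReal (2 / ρ + 2 * ρ) * ∫⁻ q in I ×ˢ Ioo 0 ρ, g (chart p e γ q) := by
        rw [Measure.volume_eq_prod, setLIntegral_prod]
        exact (hgm.comp hchart.measurable).aemeasurable
    _ ≤ ENNReal.ofReal (2 / ρ + 2 * ρ) * ∫⁻ q in chart p e γ ⁻¹' Ω, g (chart p e γ q) := by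
        gcongr
        exact fun q hq => hsub q.1 hq.1 q.2 hq.2
    _ = _ := by rw [hchart.setLIntegral_comp_preimage hΩ hgm, sobolevSq]

theorem lintegral_strip_le {f : Plane → ℝ} (hf : ContDiff ℝ ∞ f) (hγ : Continuous γ)
    {Ω : Set Plane} (hΩ : MeasurableSet Ω) {I : Set ℝ} {ρ : ℝ} (hρ : 0 < ρ)
    (hsub : ∀ y ∈ I, ∀ t ∈ Ioo 0 ρ, chart p e γ (y, t) ∈ Ω) {A : Set Plane} (hA : MeasurableSet A)
    {δ : ℝ} (hAsub : ∀ x ∈ A, e (x - p) 0 ∈ I ∧ height p e γ x ∈ Ioo 0 (min ρ δ)) :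
    ∫⁻ x in A, ‖f x‖ₑ ^ 2
      ≤ ENNReal.ofReal (2 / ρ + 2 * ρ) * ENNReal.ofReal δ * sobolevSq Ω f := by
  have hchart := (measurePreserving_chart p e hγ)
  have hfm : Measurable fun x => ‖f x‖ₑ ^ 2 := hf.continuous.measurable.enorm.pow_const 2
  have hfm' : Measurable fun q => ‖f (chart p e γ q)‖ₑ ^ 2 := hfm.comp hchart.measurable
  calc _ = ∫⁻ q in chart p e γ ⁻¹' A, ‖f (chart p e γ q)‖ₑ ^ 2 :=
        (hchart.setLIntegral_comp_preimage hA hfm).symm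
    _ ≤ ∫⁻ q in I ×ˢ Ioo 0 (min ρ δ), ‖f (chart p e γ q)‖ₑ ^ 2 := by
        refine lintegral_mono_set fun q hq => ?_
        have := hAsub _ hq
        rw [coord_chart, height_chart] at this
        exact this
    _ = ∫⁻ t in Ioo 0 (min ρ δ), ∫⁻ y in I, ‖f (chart p e γ (y, t))‖ₑ ^ 2 := by
        rw [Measure.volume_eq_prod, setLIntegral_prod_symm]
        exact hfm'.aemeasurable
    _ ≤ ∫⁻ t in Ioo 0 (min ρ δ), ENNReal.ofReal (2 / ρ + 2 * ρ) * sobolevSq Ω f := by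
        refine setLIntegral_mono' measurableSet_Ioo fun t ht => ?_
        exact lintegral_line_le p e hf hγ hΩ hρ hsub
          ⟨ht.1.le, (ht.2.trans_le (min_le_left _ _)).le⟩
    _ = ENNReal.ofReal (2 / ρ + 2 * ρ) * sobolevSq Ω f * ENNReal.ofReal (min ρ δ) := by simp
    _ ≤ ENNReal.ofReal (2 / ρ + 2 * ρ) * sobolevSq Ω f * ENNReal.ofReal δ := by
        gcongr; exact min_le_right _ _
    _ = _ := by ring

end Chart

/-- The trace inequality on the part `s` of the boundary, and the smallness of smooth functions in
thin layers along `s`. -/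
def BoundaryEstimate (Ω s : Set Plane) : Prop :=
  ∃ (C : ℝ≥0∞) (δ₀ : ℝ), C ≠ ⊤ ∧ 0 < δ₀ ∧ ∀ f : Plane → ℝ, ContDiff ℝ ∞ f →
    ∫⁻ x in frontier Ω ∩ s, ‖f x‖ₑ ^ 2 ∂len ≤ C * sobolevSq Ω f ∧
    ∀ δ, 0 < δ → δ ≤ δ₀ → ∫⁻ x in Ω ∩ Metric.thickening δ (frontier Ω ∩ s), ‖f x‖ₑ ^ 2
      ≤ C * ENNReal.ofReal δ * sobolevSq Ω f

theorem exists_boundaryEstimate_ball {Ω : Set Plane} (hΩ : IsOpen Ω) (hL : HasLipschitzBoundary Ω)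
    {p : Plane} (hp : p ∈ frontier Ω) : ∃ R > 0, BoundaryEstimate Ω (Metric.ball p R) := by
  obtain ⟨e, γ, K, r, hγ, hr, hball⟩ := hL p hp
  have hγc := hγ.continuous
  have hhc := continuous_height p e hγc
  have hK : (0 : ℝ) ≤ K := K.2
  have hpΩ : p ∉ Ω := fun h => by
    have := hp.2
    rw [hΩ.interior_eq] at this
    exact this h
  have hball' : ∀ x ∈ Metric.ball p r, x ∈ Ω ↔ 0 < height p e γ x := fun x hx => by
    rw [hball x hx, height, sub_pos]
  -- points of the frontier near `p` have height zero
  have hfr : ∀ x ∈ frontier Ω, x ∈ Metric.ball p r → height p e γ x = 0 := by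
    intro x hx hxr
    refine le_antisymm ?_ ?_
    · by_contra hlt
      have := hx.2
      rw [hΩ.interior_eq] at this
      exact this ((hball' x hxr).2 (not_le.1 hlt))
    · by_contra hlt
      have hopen : IsOpen (Metric.ball p r ∩ {x | height p e γ x < 0}) :=
        Metric.isOpen_ball.inter (isOpen_lt hhc continuous_const)
      obtain ⟨y, hy, hyΩ⟩ := mem_closure_iff.1 hx.1 _ hopen ⟨hxr, not_le.1 hlt⟩
      exact lt_asymm hy.2 ((hball' y hy.1).1 hyΩ)
  have h0 : γ 0 = 0 := by
    have := hfr p hp (Metric.mem_ball_self hr)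
    simpa [height] using this
  -- These sizes keep the chart inside the ball where the boundary is a graph: |y| + |γ y| ≤ (1 +
  -- K)η = r/4, and the height adds at most ρ = r/4.
  set η := r / (4 * (1 + K)) with hη
  set ρ := r / 4 with hρ
  have hη0 : 0 < η := by positivity
  have hρ0 : 0 < ρ := by positivity
  set I := Ioo (-η) η with hI
  have hchart : ∀ y ∈ I, ∀ t, |t| ≤ ρ → chart p e γ (y, t) ∈ Metric.ball p r := by
    intro y hy t ht
    have hy' : |y| ≤ η := abs_le.2 ⟨hy.1.le, hy.2.le⟩
    have h1 := hγ.dist_le_mul y 0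
    rw [h0, Real.dist_eq, Real.dist_eq, sub_zero, sub_zero] at h1
    have h2 : (1 + K) * |y| ≤ r / 4 := by
      calc (1 + K) * |y| ≤ (1 + K) * η := by gcongr
        _ = r / 4 := by rw [hη]; field_simp
    have h3 : ‖!₂[y, γ y + t]‖ ≤ |y| + |γ y + t| := by
      rw [EuclideanSpace.norm_eq]
      simp only [Fin.sum_univ_two, Real.norm_eq_abs, Matrix.cons_val_zero, Matrix.cons_val_one]
      refine Real.sqrt_le_iff.2 ⟨by positivity, ?_⟩
      nlinarith [mul_nonneg (abs_nonneg y) (abs_nonneg (γ y + t))]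
    have h4 := abs_add_le (γ y) t
    rw [Metric.mem_ball, dist_eq_norm, chart, add_sub_cancel_left, LinearIsometryEquiv.norm_map]
    simp only
    linarith
  have hsub : ∀ y ∈ I, ∀ t ∈ Ioo 0 ρ, chart p e γ (y, t) ∈ Ω := by
    intro y hy t ht
    rw [hball' _ (hchart y hy t (by rw [abs_of_pos ht.1]; exact ht.2.le)), height_chart]
    exact ht.1
  -- a neighbourhood of `p` that the chart covers
  set U := {x : Plane | e (x - p) 0 ∈ I ∧ |height p e γ x| < ρ} with hU
  have hUopen : IsOpen U := by
    have h1 : Continuous fun x : Plane => e (x - p) 0 := by fun_prop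
    exact IsOpen.inter (isOpen_Ioo.preimage h1) (isOpen_lt hhc.abs continuous_const)
  have hpU : p ∈ U := by
    simp only [hU, Set.mem_ofPred_eq, height, sub_self, map_zero, PiLp.zero_apply, h0, abs_zero]
    exact ⟨⟨by linarith, hη0⟩, hρ0⟩
  have hUr : U ⊆ Metric.ball p r := by
    intro x hx
    rw [← chart_coord p e γ x]
    exact hchart _ hx.1 _ hx.2.le
  obtain ⟨R', hR', hR'U⟩ := Metric.isOpen_iff.1 hUopen p hpU
  -- Half the radius serves twice: a point within δ ≤ R'/2 of the boundary part in the half ball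
  -- still lies in the ball of radius R', which the chart covers.
  refine ⟨R' / 2, by positivity,
    ENNReal.ofReal (2 / ρ + 2 * ρ) * ((1 + K : NNReal) : ℝ≥0∞), R' / 2, by
      exact ENNReal.mul_ne_top ENNReal.ofReal_ne_top ENNReal.coe_ne_top, by positivity,
    fun f hf => ⟨?_, fun δ hδ hδ' => ?_⟩⟩
  · have hA : frontier Ω ∩ Metric.ball p (R' / 2) ⊆ (fun y : ℝ => chart p e γ (y, 0)) '' I := by
      rintro x ⟨hx, hxR⟩
      have hxU : x ∈ U := hR'U (Metric.ball_subset_ball (by linarith) hxR)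
      refine ⟨_, hxU.1, ?_⟩
      have h1 := chart_coord p e γ x
      rwa [hfr x hx (hUr hxU)] at h1
    refine (lintegral_graph_le p e hγ hA (hf.continuous.measurable.enorm.pow_const 2)).trans ?_
    have h1 := lintegral_line_le p e hf hγc hΩ.measurableSet hρ0 hsub
      (t := 0) ⟨le_rfl, hρ0.le⟩
    calc _ ≤ ((1 + K : NNReal) : ℝ≥0∞) * (ENNReal.ofReal (2 / ρ + 2 * ρ) * sobolevSq Ω f) := by gcongr
      _ = _ := by ring
  · have h1 := lintegral_strip_le p e hf hγc hΩ.measurableSet hρ0 hsub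
      (A := Ω ∩ Metric.thickening δ (frontier Ω ∩ Metric.ball p (R' / 2)))
      (hΩ.inter Metric.isOpen_thickening).measurableSet (δ := (1 + K) * δ) ?_
    · refine h1.trans (le_of_eq ?_)
      rw [ENNReal.ofReal_mul (by positivity), ENNReal.ofReal_add zero_le_one hK,
        ENNReal.ofReal_coe_nnreal, ENNReal.ofReal_one, ENNReal.coe_add, ENNReal.coe_one]
      ring
    · rintro x ⟨hxΩ, hx⟩
      obtain ⟨z, ⟨hz, hzR⟩, hxz⟩ := Metric.mem_thickening_iff.1 hx
      have hzU : z ∈ U := hR'U (Metric.ball_subset_ball (by linarith) hzR)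
      have hxU : x ∈ U := by
        apply hR'U
        have := dist_triangle x z p
        rw [Metric.mem_ball] at hzR ⊢
        linarith
      have hpos := (hball' x (hUr hxU)).1 hxΩ
      refine ⟨hxU.1, hpos, lt_min (lt_of_abs_lt hxU.2) ?_⟩
      have h2 := (le_abs_self _).trans (lipschitz_height p e hγ x z)
      rw [hfr z hz (hUr hzU), sub_zero] at h2
      exact h2.trans_lt (by gcongr)

/-- The estimates pass to subsets and finite unions and hold near each boundary point, so
compactness of the boundary makes them global. -/
theorem boundaryEstimate_univ {Ω : Set Plane} (hΩ : IsOpen Ω) (hb : Bornology.IsBounded Ω)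
    (hL : HasLipschitzBoundary Ω) : BoundaryEstimate Ω univ := by
  have hc : IsCompact (frontier Ω) :=
    Metric.isCompact_of_isClosed_isBounded isClosed_frontier
      (hb.closure.subset frontier_subset_closure)
  have hmono : ∀ s t : Set Plane, frontier Ω ∩ s ⊆ frontier Ω ∩ t →
      BoundaryEstimate Ω t → BoundaryEstimate Ω s := by
    rintro s t hst ⟨C, δ₀, hC, hδ₀, h⟩
    refine ⟨C, δ₀, hC, hδ₀, fun f hf => ⟨(lintegral_mono_set hst).trans (h f hf).1,
      fun δ hδ hδ' => (lintegral_mono_set ?_).trans ((h f hf).2 δ hδ hδ')⟩⟩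
    exact inter_subset_inter_right _ (Metric.thickening_subset_of_subset δ hst)
  have main : BoundaryEstimate Ω (frontier Ω) := by
    refine hc.induction_on (p := BoundaryEstimate Ω) ?_ ?_ ?_ ?_
    · refine ⟨0, 1, ENNReal.zero_ne_top, one_pos, fun f _ => ⟨?_, fun δ _ _ => ?_⟩⟩ <;> simp
    · exact fun s t hst h => hmono s t (inter_subset_inter_right _ hst) h
    · rintro s t ⟨C, δ₀, hC, hδ₀, h⟩ ⟨C', δ₀', hC', hδ₀', h'⟩
      refine ⟨C + C', min δ₀ δ₀', by simp [hC, hC'], lt_min hδ₀ hδ₀', fun f hf => ⟨?_, fun δ hδ hδ' => ?_⟩⟩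
      · rw [inter_union_distrib_left, add_mul]
        exact (lintegral_union_le _ _ _).trans (add_le_add (h f hf).1 (h' f hf).1)
      · rw [inter_union_distrib_left, Metric.thickening_union, inter_union_distrib_left, add_mul, add_mul]
        exact (lintegral_union_le _ _ _).trans (add_le_add
          ((h f hf).2 δ hδ (hδ'.trans (min_le_left _ _)))
          ((h' f hf).2 δ hδ (hδ'.trans (min_le_right _ _))))
    · intro p hp
      obtain ⟨R, hR, h⟩ := exists_boundaryEstimate_ball hΩ hL hp
      exact ⟨_, mem_nhdsWithin_of_mem_nhds (Metric.ball_mem_nhds p hR), h⟩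
  exact hmono _ _ (by simp) main

end Graetz

/-! ### Poincaré inequality on convex sets and the grid of squares -/

namespace Graetz

/-- The homothety with centre y and ratio t maps the convex set Q into itself, with Jacobian t² ≥
1/4. -/
theorem lintegral_homothety_le {Q : Set Plane} (hQ : Convex ℝ Q) (hQm : MeasurableSet Q)
    {g : Plane → ℝ≥0∞} (hg : Measurable g) {y : Plane} (hy : y ∈ Q) {t : ℝ} (ht : 1 / 2 ≤ t)
    (ht1 : t ≤ 1) : ∫⁻ x in Q, g (y + t • (x - y)) ≤ 4 * ∫⁻ x in Q, g x := by
  have hG : Measurable (Q.indicator g) := hg.indicator hQm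
  have ht0 : 0 < t := by linarith
  have h1 : ∫⁻ x in Q, g (y + t • (x - y)) ≤ ∫⁻ x, Q.indicator g ((y - t • y) + t • x) := by
    rw [← lintegral_indicator hQm]
    refine lintegral_mono fun x => ?_
    by_cases hx : x ∈ Q
    · have e : (y - t • y) + t • x = y + t • (x - y) := by rw [smul_sub]; abel
      have hmem : y + t • (x - y) ∈ Q := hQ.add_smul_sub_mem hy hx ⟨ht0.le, ht1⟩
      rw [indicator_of_mem hx, e, indicator_of_mem hmem]
    · rw [indicator_of_notMem hx]; exact zero_le
  have h2 : ∫⁻ x, Q.indicator g ((y - t • y) + t • x)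
      = ENNReal.ofReal |(t ^ 2)⁻¹| * ∫⁻ x in Q, g x := by
    have hG' : Measurable fun z : Plane => Q.indicator g ((y - t • y) + z) :=
      hG.comp (measurable_const_add _)
    rw [← lintegral_map (f := fun z => Q.indicator g ((y - t • y) + z)) hG' (measurable_const_smul t),
      Measure.map_addHaar_smul _ ht0.ne', lintegral_smul_measure,
      lintegral_add_left_eq_self (μ := (volume : Measure Plane)) (Q.indicator g),
      lintegral_indicator hQm]
    simp
  refine h1.trans (h2.le.trans ?_)
  gcongr
  rw [← ENNReal.ofReal_ofNat 4]
  refine ENNReal.ofReal_le_ofReal ?_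
  rw [abs_of_pos (by positivity), inv_le_comm₀ (by positivity) (by norm_num)]
  nlinarith

theorem lintegral_segment_le {Q : Set Plane} (hQ : Convex ℝ Q) (hQm : MeasurableSet Q)
    {g : Plane → ℝ≥0∞} (hg : Measurable g) {t : ℝ} (ht : t ∈ Ioo (0 : ℝ) 1) :
    ∫⁻ y in Q, ∫⁻ x in Q, g (y + t • (x - y)) ≤ 4 * volume Q * ∫⁻ x in Q, g x := by
  have hc : ∫⁻ _ in Q, 4 * ∫⁻ x in Q, g x = 4 * volume Q * ∫⁻ x in Q, g x := by
    simp; ring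
  rcases le_or_gt (1 / 2) t with h | h
  · rw [← hc]
    exact setLIntegral_mono' hQm fun y hy => lintegral_homothety_le hQ hQm hg hy h ht.2.le
  -- For small t the homothety degenerates, so the roles of x and y are exchanged: the point on the
  -- segment is also the image of y under the homothety with centre x and ratio 1 − t.
  · rw [lintegral_lintegral_swap, ← hc]
    · refine setLIntegral_mono' hQm fun x hx => ?_
      have := lintegral_homothety_le hQ hQm hg hx (t := 1 - t) (by linarith) (by linarith [ht.1])
      refine le_trans (le_of_eq ?_) this
      refine lintegral_congr fun y => ?_
      congr 1
      simp only [smul_sub, sub_smul, one_smul]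
      abel
    · refine (hg.comp ?_).aemeasurable
      fun_prop

theorem lintegral_sub_sq_le {Q : Set Plane} (hQ : Convex ℝ Q) (hQm : MeasurableSet Q) {d : ℝ≥0∞}
    (hd : ∀ x ∈ Q, ∀ y ∈ Q, ‖x - y‖ₑ ≤ d) {f : Plane → ℝ} (hf : ContDiff ℝ ∞ f) :
    ∫⁻ y in Q, ∫⁻ x in Q, ‖f x - f y‖ₑ ^ 2
      ≤ 4 * d ^ 2 * volume Q * ∫⁻ x in Q, ‖gradient f x‖ₑ ^ 2 := by
  set g : Plane → ℝ≥0∞ := fun x => ‖gradient f x‖ₑ ^ 2 with hg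
  have hgm : Measurable g := (continuous_gradient hf).measurable.enorm.pow_const 2
  have hpt : ∀ y ∈ Q, ∀ x ∈ Q, ‖f x - f y‖ₑ ^ 2
      ≤ d ^ 2 * ∫⁻ t in Ioo (0 : ℝ) 1, g (y + t • (x - y)) := by
    intro y hy x hx
    have := enorm_sub_sq_le_segment hf y (x - y) (ρ := 1) (s := 0) (t := 1) (by simp) (by simp)
    simp only [one_smul, add_sub_cancel, zero_smul, add_zero, ENNReal.ofReal_one, one_mul] at this
    refine this.trans ?_
    gcongr
    exact hd x hx y hy
  have hm1 : ∀ y : Plane, Measurable (Function.uncurry fun (x : Plane) (t : ℝ) => g (y + t • (x - y))) :=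
    fun y => hgm.comp (by fun_prop)
  have hm2 : Measurable (fun z : (Plane × ℝ) × Plane => g (z.1.1 + z.1.2 • (z.2 - z.1.1))) :=
    hgm.comp (by fun_prop)
  calc _ ≤ ∫⁻ y in Q, ∫⁻ x in Q, d ^ 2 * ∫⁻ t in Ioo (0 : ℝ) 1, g (y + t • (x - y)) :=
        setLIntegral_mono' hQm fun y hy => setLIntegral_mono' hQm fun x hx => hpt y hy x hx
    _ = d ^ 2 * ∫⁻ y in Q, ∫⁻ x in Q, ∫⁻ t in Ioo (0 : ℝ) 1, g (y + t • (x - y)) := by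
        have : ∀ y : Plane, ∫⁻ x in Q, d ^ 2 * ∫⁻ t in Ioo (0 : ℝ) 1, g (y + t • (x - y))
            = d ^ 2 * ∫⁻ x in Q, ∫⁻ t in Ioo (0 : ℝ) 1, g (y + t • (x - y)) := fun y =>
          lintegral_const_mul _ (hm1 y).lintegral_prod_right'
        simp only [this]
        refine lintegral_const_mul _ ?_
        have hm3 : Measurable (fun z : (Plane × Plane) × ℝ => g (z.1.1 + z.2 • (z.1.2 - z.1.1))) :=
          hgm.comp (by fun_prop)
        exact hm3.lintegral_prod_right'.lintegral_prod_right'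
    _ = d ^ 2 * ∫⁻ y in Q, ∫⁻ t in Ioo (0 : ℝ) 1, ∫⁻ x in Q, g (y + t • (x - y)) := by
        congr 1
        refine lintegral_congr fun y => ?_
        exact lintegral_lintegral_swap (hm1 y).aemeasurable
    _ = d ^ 2 * ∫⁻ t in Ioo (0 : ℝ) 1, ∫⁻ y in Q, ∫⁻ x in Q, g (y + t • (x - y)) := by
        congr 1
        refine lintegral_lintegral_swap ?_
        exact hm2.lintegral_prod_right'.aemeasurable
    _ ≤ d ^ 2 * ∫⁻ t in Ioo (0 : ℝ) 1, 4 * volume Q * ∫⁻ x in Q, g x := by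
        gcongr 1
        exact setLIntegral_mono' measurableSet_Ioo fun t ht => lintegral_segment_le hQ hQm hgm ht
    _ = _ := by simp; ring

/-- Poincaré's inequality with the mean kept as a separate term: |Q| f(x) is the integral of f over
Q minus that of f(y) − f(x) over y, and the latter is estimated through `lintegral_sub_sq_le`. -/
theorem lintegral_sq_le_mean {Q : Set Plane} (hQ : Convex ℝ Q) (hQm : MeasurableSet Q)
    (hQb : Bornology.IsBounded Q) {d : ℝ≥0∞} (hd : ∀ x ∈ Q, ∀ y ∈ Q, ‖x - y‖ₑ ≤ d)
    {f : Plane → ℝ} (hf : ContDiff ℝ ∞ f) :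
    ∫⁻ x in Q, ‖f x‖ₑ ^ 2 ≤ 8 * d ^ 2 * (∫⁻ x in Q, ‖gradient f x‖ₑ ^ 2)
      + ENNReal.ofReal (2 / volume.real Q) * ‖∫ x in Q, f x‖ₑ ^ 2 := by
  have hfin : volume Q ≠ ⊤ := hQb.measure_lt_top.ne
  rcases eq_or_ne (volume Q) 0 with h0 | h0
  · rw [Measure.restrict_eq_zero.2 h0]; simp
  have hv : 0 < volume.real Q := ENNReal.toReal_pos h0 hfin
  have hint : IntegrableOn f Q :=
    (hf.continuous.continuousOn.integrableOn_compact hQb.isCompact_closure).mono_set subset_closure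
  have hfm := hf.continuous.measurable
  set m := ∫ x in Q, f x with hm
  have hpt : ∀ x, volume Q ^ 2 * ‖f x‖ₑ ^ 2
      ≤ 2 * (volume Q * ∫⁻ y in Q, ‖f y - f x‖ₑ ^ 2) + 2 * ‖m‖ₑ ^ 2 := by
    intro x
    have e1 : volume.real Q * f x = m - ∫ y in Q, (f y - f x) := by
      rw [integral_sub hint (integrableOn_const hfin)]
      simp [hm]
    have h1 : volume Q * ‖f x‖ₑ ≤ ‖m‖ₑ + ∫⁻ y in Q, ‖f y - f x‖ₑ := by
      have e2 : volume Q * ‖f x‖ₑ = ‖volume.real Q * f x‖ₑ := by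
        rw [enorm_mul, Real.enorm_eq_ofReal hv.le, ofReal_measureReal hfin]
      rw [e2, e1]
      refine enorm_sub_le.trans ?_
      gcongr
      exact enorm_integral_le_lintegral_enorm _
    calc _ = (volume Q * ‖f x‖ₑ) ^ 2 := by ring
      _ ≤ (‖m‖ₑ + ∫⁻ y in Q, ‖f y - f x‖ₑ) ^ 2 := by gcongr
      _ ≤ 2 * (‖m‖ₑ ^ 2 + (∫⁻ y in Q, ‖f y - f x‖ₑ) ^ 2) := ennreal_add_sq_le _ _
      _ ≤ 2 * (‖m‖ₑ ^ 2 + volume Q * ∫⁻ y in Q, ‖f y - f x‖ₑ ^ 2) := by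
        gcongr
        have := sq_lintegral_le (μ := volume.restrict Q) (f := fun y => ‖f y - f x‖ₑ)
          (hfm.sub_const _).enorm.aemeasurable
        simpa using this
      _ = _ := by ring
  have hm2 : Measurable fun x => ∫⁻ y in Q, ‖f y - f x‖ₑ ^ 2 := by
    have : Measurable fun z : Plane × Plane => ‖f z.2 - f z.1‖ₑ ^ 2 :=
      ((hfm.comp measurable_snd).sub (hfm.comp measurable_fst)).enorm.pow_const 2
    exact this.lintegral_prod_right'
  have h1 : volume Q ^ 2 * ∫⁻ x in Q, ‖f x‖ₑ ^ 2
      ≤ volume Q ^ 2 * (8 * d ^ 2 * (∫⁻ x in Q, ‖gradient f x‖ₑ ^ 2) + 2 * (volume Q)⁻¹ * ‖m‖ₑ ^ 2) := by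
    calc _ = ∫⁻ x in Q, volume Q ^ 2 * ‖f x‖ₑ ^ 2 :=
          (lintegral_const_mul _ (hfm.enorm.pow_const 2)).symm
      _ ≤ ∫⁻ x in Q, (2 * (volume Q * ∫⁻ y in Q, ‖f y - f x‖ₑ ^ 2) + 2 * ‖m‖ₑ ^ 2) :=
          lintegral_mono hpt
      _ = 2 * (volume Q * ∫⁻ x in Q, ∫⁻ y in Q, ‖f y - f x‖ₑ ^ 2) + 2 * ‖m‖ₑ ^ 2 * volume Q := by
          rw [lintegral_add_right _ measurable_const, lintegral_const_mul _ (hm2.const_mul _),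
            lintegral_const_mul _ hm2]
          simp
      _ ≤ 2 * (volume Q * (4 * d ^ 2 * volume Q * ∫⁻ x in Q, ‖gradient f x‖ₑ ^ 2))
          + 2 * ‖m‖ₑ ^ 2 * volume Q := by
          gcongr
          exact lintegral_sub_sq_le hQ hQm hd hf
      _ = 8 * d ^ 2 * volume Q ^ 2 * (∫⁻ x in Q, ‖gradient f x‖ₑ ^ 2)
          + 2 * ‖m‖ₑ ^ 2 * volume Q * (volume Q * (volume Q)⁻¹) := by
          rw [ENNReal.mul_inv_cancel h0 hfin]; ring
      _ = _ := by ring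
  have h2 := (ENNReal.mul_le_mul_iff_right (pow_ne_zero 2 h0) (ENNReal.pow_ne_top hfin)).1 h1
  refine h2.trans (le_of_eq ?_)
  rw [ENNReal.ofReal_div_of_pos hv, ofReal_measureReal hfin, ENNReal.ofReal_ofNat, div_eq_mul_inv]

/-- The cells of the square grid of mesh `ε`. -/
def gridCell (ε : ℝ) (i : ℤ × ℤ) : Set Plane := {x | ⌊x 0 / ε⌋ = i.1 ∧ ⌊x 1 / ε⌋ = i.2}

theorem mem_gridCell_iff {ε : ℝ} (hε : 0 < ε) (i : ℤ × ℤ) (x : Plane) : x ∈ gridCell ε i ↔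
    (i.1 * ε ≤ x 0 ∧ x 0 < (i.1 + 1) * ε) ∧ (i.2 * ε ≤ x 1 ∧ x 1 < (i.2 + 1) * ε) := by
  simp only [gridCell, Set.mem_ofPred_eq, Int.floor_eq_iff, le_div_iff₀ hε, div_lt_iff₀ hε]

theorem measurableSet_gridCell (ε : ℝ) (i : ℤ × ℤ) : MeasurableSet (gridCell ε i) := by
  have h : ∀ k : Fin 2, Measurable fun x : Plane => ⌊x k / ε⌋ := fun k =>
    Int.measurable_floor.comp (by fun_prop)
  exact ((h 0) (measurableSet_singleton i.1)).inter ((h 1) (measurableSet_singleton i.2))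

theorem convex_gridCell {ε : ℝ} (hε : 0 < ε) (i : ℤ × ℤ) : Convex ℝ (gridCell ε i) := by
  have hl : ∀ k : Fin 2, IsLinearMap ℝ fun x : Plane => x k := fun k => ⟨by simp, by simp⟩
  have e : gridCell ε i = ({x : Plane | i.1 * ε ≤ x 0} ∩ {x : Plane | x 0 < (i.1 + 1) * ε})
      ∩ ({x : Plane | i.2 * ε ≤ x 1} ∩ {x : Plane | x 1 < (i.2 + 1) * ε}) := by
    ext x; rw [mem_gridCell_iff hε]; rfl
  rw [e]
  exact ((convex_halfSpace_ge (hl 0) _).inter (convex_halfSpace_lt (hl 0) _)).inter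
    ((convex_halfSpace_ge (hl 1) _).inter (convex_halfSpace_lt (hl 1) _))

theorem norm_sub_le_of_mem_gridCell {ε : ℝ} (hε : 0 < ε) {i : ℤ × ℤ} {x y : Plane}
    (hx : x ∈ gridCell ε i) (hy : y ∈ gridCell ε i) : ‖x - y‖ ≤ 2 * ε := by
  rw [mem_gridCell_iff hε] at hx hy
  rw [EuclideanSpace.norm_eq]
  refine Real.sqrt_le_iff.2 ⟨by positivity, ?_⟩
  simp only [Fin.sum_univ_two, Real.norm_eq_abs, sq_abs, PiLp.sub_apply]
  obtain ⟨⟨a1, a2⟩, a3, a4⟩ := hx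
  obtain ⟨⟨b1, b2⟩, b3, b4⟩ := hy
  have h1 : (x 0 - y 0) ^ 2 ≤ ε ^ 2 := sq_le_sq' (by linarith) (by linarith)
  have h2 : (x 1 - y 1) ^ 2 ≤ ε ^ 2 := sq_le_sq' (by linarith) (by linarith)
  nlinarith

theorem finite_gridCell_inter {Ω : Set Plane} (hb : Bornology.IsBounded Ω) {ε : ℝ} (hε : 0 < ε) :
    {i | (gridCell ε i ∩ Ω).Nonempty}.Finite := by
  obtain ⟨M, hM⟩ := hb.exists_norm_le
  refine ((Set.finite_Icc (⌊-M / ε⌋) (⌊M / ε⌋)).prod (Set.finite_Icc (⌊-M / ε⌋) (⌊M / ε⌋))).subset ?_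
  rintro i ⟨x, hx, hxΩ⟩
  have h : ∀ k, |x k| ≤ M := fun k => (PiLp.norm_apply_le x k).trans (hM x hxΩ)
  have h' : ∀ k, ⌊x k / ε⌋ ∈ Icc (⌊-M / ε⌋) (⌊M / ε⌋) := fun k => by
    have := abs_le.1 (h k)
    constructor
    · gcongr; exact this.1
    · gcongr; exact this.2
  rw [← Prod.mk.eta (p := i), ← hx.1, ← hx.2]
  exact ⟨h' 0, h' 1⟩

/-- A function on a bounded Lipschitz domain is controlled in `L²` by a small multiple of its norm in
`H¹` and by finitely many of its means. -/
theorem exists_means_estimate {Ω : Set Plane} (hΩ : IsOpen Ω) (hb : Bornology.IsBounded Ω)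
    (hL : HasLipschitzBoundary Ω) {η : ℝ} (hη : 0 < η) :
    ∃ (J : Finset (ℤ × ℤ)) (Q : ℤ × ℤ → Set Plane) (c : ℤ × ℤ → ℝ),
      (∀ i ∈ J, MeasurableSet (Q i) ∧ Q i ⊆ Ω) ∧ (∀ i, 0 ≤ c i) ∧
      ∀ f : Plane → ℝ, ContDiff ℝ ∞ f → ∫⁻ x in Ω, ‖f x‖ₑ ^ 2
        ≤ ENNReal.ofReal η * sobolevSq Ω f
          + ∑ i ∈ J, ENNReal.ofReal (c i) * ‖∫ x in Q i, f x‖ₑ ^ 2 := by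
  classical
  obtain ⟨C, δ₀, hC, hδ₀, hbd⟩ := boundaryEstimate_univ hΩ hb hL
  -- The layer of width δ along the boundary contributes at most η/2 times the square of the H¹
  -- norm; the mesh ε chosen next makes the Poincaré constant of the cells at most η/2 as well.
  obtain ⟨δ, hδ, hδ1, hδ2⟩ : ∃ δ, 0 < δ ∧ δ ≤ δ₀ ∧ C.toReal * δ ≤ η / 2 := by
    refine ⟨min δ₀ (η / (2 * (C.toReal + 1))), by positivity, min_le_left _ _, ?_⟩
    calc C.toReal * min δ₀ (η / (2 * (C.toReal + 1)))
        ≤ (C.toReal + 1) * (η / (2 * (C.toReal + 1))) := by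
          gcongr
          · linarith
          · exact min_le_right _ _
      _ = η / 2 := by field_simp
  obtain ⟨ε, hε, hε1, hε2⟩ : ∃ ε : ℝ, 0 < ε ∧ 2 * ε < δ ∧ 8 * (2 * ε) ^ 2 ≤ η / 2 := by
    refine ⟨min 1 (min (δ / 4) (η / 64)), by positivity, ?_, ?_⟩
    · have : min 1 (min (δ / 4) (η / 64)) ≤ δ / 4 := (min_le_right _ _).trans (min_le_left _ _)
      linarith
    · have h1 : min 1 (min (δ / 4) (η / 64)) ≤ η / 64 := (min_le_right _ _).trans (min_le_right _ _)
      have h2 : min 1 (min (δ / 4) (η / 64)) ≤ 1 := min_le_left _ _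
      have h3 : 0 < min 1 (min (δ / 4) (η / 64)) := by positivity
      nlinarith
  set J := (finite_gridCell_inter hb hε).toFinset.filter fun i => gridCell ε i ⊆ Ω with hJ
  have hJΩ : ∀ i ∈ J, gridCell ε i ⊆ Ω := fun i hi => (Finset.mem_filter.1 hi).2
  refine ⟨J, gridCell ε, fun i => 2 / volume.real (gridCell ε i),
    fun i hi => ⟨measurableSet_gridCell ε i, hJΩ i hi⟩, fun i => by positivity, fun f hf => ?_⟩
  -- A cell that meets Ω without lying in it is crossed by the boundary. Its diameter is at most 2ε
  -- < δ, so its part in Ω belongs to the layer.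
  have hcover : Ω ⊆ (Ω ∩ Metric.thickening δ (frontier Ω ∩ univ)) ∪ ⋃ i ∈ J, gridCell ε i := by
    intro x hx
    set i : ℤ × ℤ := (⌊x 0 / ε⌋, ⌊x 1 / ε⌋) with hi
    have hxi : x ∈ gridCell ε i := ⟨rfl, rfl⟩
    by_cases hsub : gridCell ε i ⊆ Ω
    · refine Or.inr (mem_iUnion₂.2 ⟨i, ?_, hxi⟩)
      rw [hJ, Finset.mem_filter]
      exact ⟨by simpa using ⟨x, hxi, hx⟩, hsub⟩
    · left
      refine ⟨hx, ?_⟩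
      obtain ⟨y, hy, hyΩ⟩ := not_subset.1 hsub
      -- A segment from a point of Ω to a point outside is connected, hence cannot be covered by the
      -- disjoint open sets Ω and the complement of its closure.
      obtain ⟨z, hz, hzf⟩ : (segment ℝ x y ∩ frontier Ω).Nonempty := by
        by_contra hne
        have hpre : IsPreconnected (segment ℝ x y) := (convex_segment x y).isPreconnected
        have hmem : ∀ z ∈ segment ℝ x y, z ∉ Ω → z ∈ (closure Ω)ᶜ := fun z hz hzΩ hzc =>
          hne ⟨z, hz, hzc, by rwa [hΩ.interior_eq]⟩
        obtain ⟨z, -, hz1, hz2⟩ := hpre Ω (closure Ω)ᶜ hΩ isClosed_closure.isOpen_compl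
          (fun z hz => or_iff_not_imp_left.2 (hmem z hz)) ⟨x, left_mem_segment ℝ x y, hx⟩
          ⟨y, right_mem_segment ℝ x y, hmem y (right_mem_segment ℝ x y) hyΩ⟩
        exact hz2 (subset_closure hz1)
      rw [inter_univ, Metric.mem_thickening_iff]
      refine ⟨z, hzf, ?_⟩
      have h1 := norm_sub_le_of_mem_gridCell hε hxi hy
      have h2 : z ∈ gridCell ε i := (convex_gridCell hε i).segment_subset hxi hy hz
      rw [dist_eq_norm]
      exact (norm_sub_le_of_mem_gridCell hε hxi h2).trans_lt hε1
  have hd : ∀ i, ∀ x ∈ gridCell ε i, ∀ y ∈ gridCell ε i, ‖x - y‖ₑ ≤ ENNReal.ofReal (2 * ε) :=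
    fun i x hx y hy => by
      rw [← ofReal_norm]
      exact ENNReal.ofReal_le_ofReal (norm_sub_le_of_mem_gridCell hε hx hy)
  have hgm : Measurable fun x => ‖gradient f x‖ₑ ^ 2 :=
    (continuous_gradient hf).measurable.enorm.pow_const 2
  have hgrad : ∑ i ∈ J, ∫⁻ x in gridCell ε i, ‖gradient f x‖ₑ ^ 2 ≤ sobolevSq Ω f := by
    rw [← lintegral_biUnion_finset _ fun i _ => measurableSet_gridCell ε i]
    · refine (lintegral_mono_set (iUnion₂_subset hJΩ)).trans (lintegral_mono fun x => ?_)
      exact le_add_self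
    · intro i _ j _ hij
      refine Set.disjoint_left.2 fun x hx hx' => hij ?_
      exact Prod.ext (hx.1.symm.trans hx'.1) (hx.2.symm.trans hx'.2)
  have e1 : ENNReal.ofReal (2 * ε) ^ 2 * 8 = ENNReal.ofReal (8 * (2 * ε) ^ 2) := by
    rw [← ENNReal.ofReal_pow (by positivity), mul_comm, ← ENNReal.ofReal_ofNat 8,
      ← ENNReal.ofReal_mul (by norm_num)]
  calc ∫⁻ x in Ω, ‖f x‖ₑ ^ 2
      ≤ ∫⁻ x in (Ω ∩ Metric.thickening δ (frontier Ω ∩ univ)) ∪ ⋃ i ∈ J, gridCell ε i, ‖f x‖ₑ ^ 2 :=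
        lintegral_mono_set hcover
    _ ≤ (∫⁻ x in Ω ∩ Metric.thickening δ (frontier Ω ∩ univ), ‖f x‖ₑ ^ 2)
        + ∑ i ∈ J, ∫⁻ x in gridCell ε i, ‖f x‖ₑ ^ 2 := by
        refine (lintegral_union_le _ _ _).trans ?_
        gcongr
        clear_value J
        clear hcover hgrad hJΩ hJ
        induction J using Finset.induction_on with
        | empty => simp
        | insert i J hi ih =>
          rw [Finset.set_biUnion_insert, Finset.sum_insert hi]
          refine (lintegral_union_le _ _ _).trans ?_
          gcongr
    _ ≤ C * ENNReal.ofReal δ * sobolevSq Ω f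
        + ∑ i ∈ J, (8 * ENNReal.ofReal (2 * ε) ^ 2 * (∫⁻ x in gridCell ε i, ‖gradient f x‖ₑ ^ 2)
          + ENNReal.ofReal (2 / volume.real (gridCell ε i)) * ‖∫ x in gridCell ε i, f x‖ₑ ^ 2) := by
        gcongr with i hi
        · exact (hbd f hf).2 δ hδ hδ1
        · exact lintegral_sq_le_mean (convex_gridCell hε i) (measurableSet_gridCell ε i)
            (hb.subset (hJΩ i hi)) (hd i) hf
    _ = C * ENNReal.ofReal δ * sobolevSq Ω f + ENNReal.ofReal (8 * (2 * ε) ^ 2)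
          * (∑ i ∈ J, ∫⁻ x in gridCell ε i, ‖gradient f x‖ₑ ^ 2)
        + ∑ i ∈ J, ENNReal.ofReal (2 / volume.real (gridCell ε i))
          * ‖∫ x in gridCell ε i, f x‖ₑ ^ 2 := by
        rw [Finset.sum_add_distrib, ← Finset.mul_sum, ← e1]; ring
    _ ≤ ENNReal.ofReal (η / 2) * sobolevSq Ω f + ENNReal.ofReal (η / 2) * sobolevSq Ω f
        + ∑ i ∈ J, ENNReal.ofReal (2 / volume.real (gridCell ε i))
          * ‖∫ x in gridCell ε i, f x‖ₑ ^ 2 := by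
        gcongr
        rw [← ENNReal.ofReal_toReal hC, ← ENNReal.ofReal_mul ENNReal.toReal_nonneg]
        exact ENNReal.ofReal_le_ofReal hδ2
    _ = _ := by
        rw [← add_mul, ← ENNReal.ofReal_add (by positivity) (by positivity), add_halves]

end Graetz

/-! ### Traces, Rellich's theorem and functions with zero gradient -/

namespace Graetz

theorem ofReal_norm_sq_Lp {α E : Type*} [MeasurableSpace α] {μ : Measure α} [NormedAddCommGroup E]
    (f : Lp E 2 μ) : ENNReal.ofReal (‖f‖ ^ 2) = ∫⁻ x, ‖f x‖ₑ ^ 2 ∂μ := by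
  rw [ENNReal.ofReal_pow (norm_nonneg _), ofReal_norm, Lp.enorm_def,
    eLpNorm_eq_lintegral_rpow_enorm_toReal two_ne_zero ENNReal.ofNat_ne_top, ← ENNReal.rpow_two,
    ← ENNReal.rpow_mul]
  simp

theorem sq_eLpNorm_two {α E : Type*} [MeasurableSpace α] {μ : Measure α} [NormedAddCommGroup E]
    (f : α → E) : eLpNorm f 2 μ ^ 2 = ∫⁻ x, ‖f x‖ₑ ^ 2 ∂μ := by
  rw [eLpNorm_eq_lintegral_rpow_enorm_toReal two_ne_zero ENNReal.ofNat_ne_top, ← ENNReal.rpow_two,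
    ← ENNReal.rpow_mul]
  simp

namespace Data

variable (D : Data)

theorem isCompact_closure_Ω : IsCompact (closure D.Ω) := D.isBounded_Ω.isCompact_closure

instance : IsFiniteMeasure D.vol := ⟨by
  rw [Measure.restrict_apply_univ]; exact D.isBounded_Ω.measure_lt_top⟩

/-- The trace inequality for the constant function 1. -/
theorem len_frontier_lt_top : len (frontier D.Ω) < ⊤ := by
  obtain ⟨C, δ₀, hC, -, h⟩ := boundaryEstimate_univ D.isOpen_Ω D.isBounded_Ω D.lipschitz_Ω
  have h1 := (h (fun _ => 1) contDiff_const).1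
  have e : sobolevSq D.Ω (fun _ => 1) = volume D.Ω := by simp [sobolevSq, gradient]
  rw [e] at h1
  simp only [enorm_one, one_pow, lintegral_const, Measure.restrict_apply_univ, inter_univ, one_mul]
    at h1
  exact h1.trans_lt (ENNReal.mul_lt_top hC.lt_top D.isBounded_Ω.measure_lt_top)

instance : IsFiniteMeasure D.bd := ⟨by
  rw [Measure.restrict_apply_univ]; exact D.len_frontier_lt_top⟩

theorem memLp_vol {E : Type*} [NormedAddCommGroup E] [SecondCountableTopology E] {f : Plane → E}
    (hf : Continuous f) : MemLp f 2 D.vol := by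
  obtain ⟨M, hM⟩ := D.isCompact_closure_Ω.exists_bound_of_continuousOn hf.continuousOn
  refine MemLp.of_bound hf.aestronglyMeasurable M ?_
  filter_upwards [ae_restrict_mem D.isOpen_Ω.measurableSet] with x hx
  exact hM x (subset_closure hx)

theorem memLp_bd {f : Plane → ℝ} (hf : Continuous f) : MemLp f 2 D.bd := by
  obtain ⟨M, hM⟩ := D.isCompact_closure_Ω.exists_bound_of_continuousOn hf.continuousOn
  refine MemLp.of_bound hf.aestronglyMeasurable M ?_
  filter_upwards [ae_restrict_mem isClosed_frontier.measurableSet] with x hx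
  exact hM x (frontier_subset_closure hx)

/-- A smooth function with its gradient and its boundary values. -/
noncomputable def smoothTriple (f : Plane → ℝ) (hf : ContDiff ℝ ∞ f) : D.Triple :=
  ((D.memLp_vol hf.continuous).toLp f, (D.memLp_vol (continuous_gradient hf)).toLp (gradient f),
    (D.memLp_bd hf.continuous).toLp f)

theorem eLpNorm_sub_eq_edist {E : Type*} [NormedAddCommGroup E] {μ : Measure Plane} {f : Plane → E}
    (hf : MemLp f 2 μ) (s : Lp E 2 μ) :
    eLpNorm (fun x => f x - s x) 2 μ = edist (hf.toLp f) s := by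
  rw [Lp.edist_def]
  refine eLpNorm_congr_ae ?_
  filter_upwards [hf.coeFn_toLp] with x hx
  simp only [Pi.sub_apply, hx]

/-- Triples with a trace form the closure of the smooth triples in the product of the L² spaces;
estimates for smooth functions thus extend by continuity. -/
theorem isTrace_iff (w : D.Triple) : D.IsTrace w.1 w.2.1 w.2.2 ↔
    w ∈ closure {w | ∃ f hf, w = D.smoothTriple f hf} := by
  rw [EMetric.mem_closure_iff]
  have key : ∀ f (hf : ContDiff ℝ ∞ f), edist w (D.smoothTriple f hf)
      = max (eLpNorm (fun x => f x - w.1 x) 2 D.vol)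
        (max (eLpNorm (fun x => gradient f x - w.2.1 x) 2 D.vol)
          (eLpNorm (fun x => f x - w.2.2 x) 2 D.bd)) := by
    intro f hf
    rw [eLpNorm_sub_eq_edist (D.memLp_vol hf.continuous), eLpNorm_sub_eq_edist
      (D.memLp_vol (continuous_gradient hf)), eLpNorm_sub_eq_edist (D.memLp_bd hf.continuous),
      edist_comm w]
    rfl
  constructor
  · intro h ε hε
    obtain ⟨ε', hε', hlt⟩ := exists_between hε
    obtain ⟨f, hf, h1, h2, h3⟩ := h ε' hε'
    refine ⟨_, ⟨f, hf, rfl⟩, ?_⟩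
    rw [key]
    exact (max_le h1 (max_le h2 h3)).trans_lt hlt
  · intro h ε hε
    obtain ⟨_, ⟨f, hf, rfl⟩, h1⟩ := h ε hε
    rw [key] at h1
    have := h1.le
    simp only [max_le_iff] at this
    exact ⟨f, hf, this.1, this.2.1, this.2.2⟩

variable {D} in
theorem IsTrace.induction {p : D.Triple → Prop} (hp : IsClosed {w | p w})
    (hs : ∀ f (hf : ContDiff ℝ ∞ f), p (D.smoothTriple f hf)) {w : D.Triple}
    (hw : D.IsTrace w.1 w.2.1 w.2.2) : p w := by
  have h1 := (D.isTrace_iff w).1 hw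
  refine closure_minimal ?_ hp h1
  rintro _ ⟨f, hf, rfl⟩
  exact hs f hf

theorem isClosed_isTrace : IsClosed {w : D.Triple | D.IsTrace w.1 w.2.1 w.2.2} := by
  simp only [isTrace_iff]
  exact isClosed_closure

variable {D} in
theorem IsTrace.sub {w w' : D.Triple} (h : D.IsTrace w.1 w.2.1 w.2.2)
    (h' : D.IsTrace w'.1 w'.2.1 w'.2.2) :
    D.IsTrace (w - w').1 (w - w').2.1 (w - w').2.2 := by
  have := D.isTrace_add h (D.isTrace_smul (-1) h')
  simpa [sub_eq_add_neg] using this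

theorem isTrace_smooth (f : Plane → ℝ) (hf : ContDiff ℝ ∞ f) :
    D.IsTrace (D.smoothTriple f hf).1 (D.smoothTriple f hf).2.1 (D.smoothTriple f hf).2.2 :=
  (D.isTrace_iff _).2 (subset_closure ⟨f, hf, rfl⟩)

theorem ofReal_norm_sq_toLp {E : Type*} [NormedAddCommGroup E] {μ : Measure Plane} {f : Plane → E}
    (hf : MemLp f 2 μ) : ENNReal.ofReal (‖hf.toLp f‖ ^ 2) = ∫⁻ x, ‖f x‖ₑ ^ 2 ∂μ := by
  rw [ofReal_norm_sq_Lp]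
  refine lintegral_congr_ae ?_
  filter_upwards [hf.coeFn_toLp] with x hx
  rw [hx]

theorem sobolevSq_eq (f : Plane → ℝ) (hf : ContDiff ℝ ∞ f) : sobolevSq D.Ω f
    = ENNReal.ofReal (‖(D.smoothTriple f hf).1‖ ^ 2 + ‖(D.smoothTriple f hf).2.1‖ ^ 2) := by
  rw [ENNReal.ofReal_add (by positivity) (by positivity), smoothTriple, ofReal_norm_sq_toLp,
    ofReal_norm_sq_toLp, sobolevSq, lintegral_add_left]
  exact hf.continuous.measurable.enorm.pow_const 2

/-- Besides bounding the trace, this shows that it is determined by the function and its gradient,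
since differences of triples are again triples. -/
theorem exists_trace_bound : ∃ C : ℝ, 0 < C ∧ ∀ w : D.Triple, D.IsTrace w.1 w.2.1 w.2.2 →
    ‖w.2.2‖ ^ 2 ≤ C * (‖w.1‖ ^ 2 + ‖w.2.1‖ ^ 2) := by
  obtain ⟨C, δ₀, hC, -, h⟩ := boundaryEstimate_univ D.isOpen_Ω D.isBounded_Ω D.lipschitz_Ω
  refine ⟨C.toReal + 1, by positivity, fun w hw => ?_⟩
  refine IsTrace.induction (p := fun w : D.Triple =>
    ‖w.2.2‖ ^ 2 ≤ (C.toReal + 1) * (‖w.1‖ ^ 2 + ‖w.2.1‖ ^ 2)) ?_ (fun f hf => ?_) hw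
  · exact isClosed_le (by fun_prop) (by fun_prop)
  · have h1 := (h f hf).1
    rw [inter_univ, ← ofReal_norm_sq_toLp (D.memLp_bd hf.continuous), D.sobolevSq_eq f hf,
      ← ENNReal.ofReal_toReal hC, ← ENNReal.ofReal_mul ENNReal.toReal_nonneg,
      ENNReal.ofReal_le_ofReal_iff (by positivity)] at h1
    refine le_trans h1 ?_
    gcongr
    linarith

/-- Up to a small multiple of the H¹ norm, the L² norm is seen by finitely many functionals, namely
weighted means over cells. This is the quantitative form of Rellich's theorem. -/
theorem exists_functionals_estimate {η : ℝ} (hη : 0 < η) :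
    ∃ (J : Finset (ℤ × ℤ)) (L : ℤ × ℤ → (Lp ℝ 2 D.vol →L[ℝ] ℝ)), ∀ w : D.Triple,
      D.IsTrace w.1 w.2.1 w.2.2 →
        ‖w.1‖ ^ 2 ≤ η * (‖w.1‖ ^ 2 + ‖w.2.1‖ ^ 2) + ∑ i ∈ J, (L i w.1) ^ 2 := by
  classical
  obtain ⟨J, Q, c, hQ, hc, h⟩ := exists_means_estimate D.isOpen_Ω D.isBounded_Ω D.lipschitz_Ω hη
  refine ⟨J, fun i => if hi : i ∈ J then √(c i) • innerSL ℝ (indicatorConstLp 2 (hQ i hi).1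
    (measure_ne_top D.vol (Q i)) (1 : ℝ)) else 0, fun w hw => ?_⟩
  set L : ℤ × ℤ → (Lp ℝ 2 D.vol →L[ℝ] ℝ) := fun i => if hi : i ∈ J then √(c i) • innerSL ℝ
    (indicatorConstLp 2 (hQ i hi).1 (measure_ne_top D.vol (Q i)) (1 : ℝ)) else 0 with hL
  refine IsTrace.induction (p := fun w : D.Triple =>
    ‖w.1‖ ^ 2 ≤ η * (‖w.1‖ ^ 2 + ‖w.2.1‖ ^ 2) + ∑ i ∈ J, (L i w.1) ^ 2) ?_ (fun f hf => ?_) hw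
  · exact isClosed_le (by fun_prop) (by fun_prop)
  · have h1 := h f hf
    rw [← ofReal_norm_sq_toLp (D.memLp_vol hf.continuous), D.sobolevSq_eq f hf] at h1
    have e : ∀ i ∈ J, ENNReal.ofReal (c i) * ‖∫ x in Q i, f x‖ₑ ^ 2
        = ENNReal.ofReal ((L i (D.smoothTriple f hf).1) ^ 2) := by
      intro i hi
      have e1 : L i (D.smoothTriple f hf).1 = √(c i) * ∫ x in Q i, f x := by
        rw [hL]
        simp only [hi, dite_true]
        rw [smul_apply, innerSL_apply_apply, smul_eq_mul]
        congr 1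
        rw [L2.inner_indicatorConstLp_one, Measure.restrict_restrict (hQ i hi).1,
          inter_eq_left.2 (hQ i hi).2]
        have h2 := ae_restrict_of_ae_restrict_of_subset (hQ i hi).2
          (D.memLp_vol hf.continuous).coeFn_toLp
        exact integral_congr_ae h2
      rw [e1, mul_pow, Real.sq_sqrt (hc i), ENNReal.ofReal_mul (hc i), Real.enorm_eq_ofReal_abs,
        ← ENNReal.ofReal_pow (abs_nonneg _), sq_abs]
    rw [Finset.sum_congr rfl e, ← ENNReal.ofReal_mul hη.le, ← ENNReal.ofReal_sum_of_nonneg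
      (fun i _ => sq_nonneg _), ← ENNReal.ofReal_add (by positivity)
      (Finset.sum_nonneg fun i _ => sq_nonneg _), ENNReal.ofReal_le_ofReal_iff] at h1
    · exact h1
    · exact add_nonneg (by positivity) (Finset.sum_nonneg fun i _ => sq_nonneg _)

/-- Rellich's theorem: sets that are bounded in `H¹(Ω)` are totally bounded in `L²(Ω)`. -/
theorem totallyBounded_fn (R : ℝ) : TotallyBounded {s : Lp ℝ 2 D.vol | ∃ w : D.Triple,
    D.IsTrace w.1 w.2.1 w.2.2 ∧ ‖w.1‖ ≤ R ∧ ‖w.2.1‖ ≤ R ∧ w.1 = s} := by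
  classical
  rw [Metric.totallyBounded_iff]
  intro ε hε
  -- For the difference of two triples of the set, the squared norms of function and gradient sum to
  -- at most 8(R² + 1), so the first term contributes at most ε²/2; with the radius r below, the
  -- functionals contribute at most ε²/4.
  set η := ε ^ 2 / (16 * (R ^ 2 + 1)) with hη
  obtain ⟨J, L, hJ⟩ := D.exists_functionals_estimate (η := η) (by positivity)
  set A := {s : Lp ℝ 2 D.vol | ∃ w : D.Triple,
    D.IsTrace w.1 w.2.1 w.2.2 ∧ ‖w.1‖ ≤ R ∧ ‖w.2.1‖ ≤ R ∧ w.1 = s} with hA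
  set T : Lp ℝ 2 D.vol →L[ℝ] (J → ℝ) := ContinuousLinearMap.pi fun i : J => L i with hT
  have hAb : Bornology.IsBounded A := by
    rw [isBounded_iff_forall_norm_le]
    refine ⟨R, ?_⟩
    rintro _ ⟨w, -, h, -, rfl⟩
    exact h
  have hTb : TotallyBounded (T '' A) := by
    refine TotallyBounded.subset subset_closure ?_
    exact (Metric.isCompact_of_isClosed_isBounded isClosed_closure
      (T.lipschitz.isBounded_image hAb).closure).totallyBounded
  set r := ε / (2 * (J.card + 1)) with hr
  have hr0 : 0 < r := by positivity
  obtain ⟨t, htA, htf, hcov⟩ := totallyBounded_iff_subset.1 hTb _ (Metric.dist_mem_uniformity hr0)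
  have htA' : ∀ y ∈ t, ∃ a, a ∈ A ∧ T a = y := fun y hy => htA hy
  choose! a haA ha using htA'
  refine ⟨a '' t, htf.image a, fun s hs => ?_⟩
  obtain ⟨y, hy, hdist⟩ := mem_iUnion₂.1 (hcov (mem_image_of_mem T hs))
  refine mem_iUnion₂.2 ⟨a y, mem_image_of_mem a hy, ?_⟩
  rw [Metric.mem_ball, dist_eq_norm]
  obtain ⟨w, hw, hw1, hw2, rfl⟩ := hs
  obtain ⟨w', hw', hw1', hw2', e'⟩ := haA y hy
  rw [← ha y hy, ← e'] at hdist
  rw [← e']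
  have h1 := hJ (w - w') (hw.sub hw')
  have hd : ∀ i ∈ J, (L i (w - w').1) ^ 2 ≤ r ^ 2 := by
    intro i hi
    have h2 : dist (T w.1 ⟨i, hi⟩) (T w'.1 ⟨i, hi⟩) ≤ r := (dist_le_pi_dist _ _ _).trans hdist.le
    have e2 : L i (w - w').1 = T w.1 ⟨i, hi⟩ - T w'.1 ⟨i, hi⟩ := by
      simp [hT, map_sub]
    rw [e2, ← sq_abs]
    rw [Real.dist_eq] at h2
    gcongr
  have h3 : ∑ i ∈ J, (L i (w - w').1) ^ 2 ≤ ε ^ 2 / 4 := by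
    calc _ ≤ ∑ i ∈ J, r ^ 2 := Finset.sum_le_sum hd
      _ = J.card * r ^ 2 := by simp
      _ ≤ (J.card + 1) ^ 2 * r ^ 2 := by gcongr; nlinarith [(Nat.cast_nonneg J.card : (0 : ℝ) ≤ _)]
      _ = ε ^ 2 / 4 := by rw [hr]; field_simp; norm_num
  have h4 : ‖(w - w').1‖ ≤ 2 * R := (norm_sub_le _ _).trans (by linarith)
  have h5 : ‖(w - w').2.1‖ ≤ 2 * R := (norm_sub_le _ _).trans (by linarith)
  have h6 : ‖(w - w').1‖ ^ 2 + ‖(w - w').2.1‖ ^ 2 ≤ 8 * (R ^ 2 + 1) := by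
    have h7 : ‖(w - w').1‖ ^ 2 ≤ (2 * R) ^ 2 := by gcongr
    have h8 : ‖(w - w').2.1‖ ^ 2 ≤ (2 * R) ^ 2 := by gcongr
    nlinarith
  have h9 : ‖w.1 - w'.1‖ ^ 2 < ε ^ 2 := by
    calc ‖w.1 - w'.1‖ ^ 2 ≤ η * (8 * (R ^ 2 + 1)) + ε ^ 2 / 4 := by
          refine h1.trans ?_
          gcongr
      _ = ε ^ 2 * (3 / 4) := by rw [hη]; field_simp; norm_num
      _ < _ := by nlinarith [sq_pos_of_pos hε]
  exact lt_of_pow_lt_pow_left₀ 2 hε.le h9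

variable {D} in
-- The double integral of |s(x) − s(y)|² over the ball vanishes: smooth approximants have gradients
-- tending to zero, and the ball is convex, so `lintegral_sub_sq_le` applies to them.
theorem IsTrace.exists_const_on_ball {s : Lp ℝ 2 D.vol} {g : Lp ℝ 2 D.bd} (h : D.IsTrace s 0 g)
    {x₀ : Plane} {r : ℝ} (hr : 0 < r) (hB : Metric.ball x₀ r ⊆ D.Ω) :
    ∃ k : ℝ, ∀ᵐ x ∂(volume.restrict (Metric.ball x₀ r)), s x = k := by
  set B := Metric.ball x₀ r with hBdef
  set μ := (volume : Measure Plane).restrict B with hμ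
  have hBm : MeasurableSet B := Metric.isOpen_ball.measurableSet
  have hBt : volume B ≠ ⊤ := Metric.isBounded_ball.measure_lt_top.ne
  have hsm : AEStronglyMeasurable s μ := (Lp.aestronglyMeasurable s).mono_measure
    (Measure.restrict_mono hB le_rfl)
  have hd : ∀ x ∈ B, ∀ y ∈ B, ‖x - y‖ₑ ≤ ENNReal.ofReal (2 * r) := by
    intro x hx y hy
    rw [← ofReal_norm, ← dist_eq_norm]
    refine ENNReal.ofReal_le_ofReal ?_
    rw [hBdef, Metric.mem_ball] at hx hy
    linarith [dist_triangle_right x y x₀]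
  have hzero : ∫⁻ y, ∫⁻ x, ‖s x - s y‖ₑ ^ 2 ∂μ ∂μ = 0 := by
    have hbound : ∀ ε : ℝ≥0∞, 0 < ε → ∫⁻ y, ∫⁻ x, ‖s x - s y‖ₑ ^ 2 ∂μ ∂μ
        ≤ (8 * volume B + 8 * ENNReal.ofReal (2 * r) ^ 2 * volume B) * ε ^ 2 := by
      intro ε hε
      obtain ⟨f, hf, h1, h2, -⟩ := h ε hε
      have hfm := hf.continuous.measurable
      have e1 : ∫⁻ x, ‖f x - s x‖ₑ ^ 2 ∂μ ≤ ε ^ 2 := by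
        refine (lintegral_mono_set hB).trans ?_
        rw [← sq_eLpNorm_two]
        gcongr
      have e2 : ∫⁻ x, ‖gradient f x‖ₑ ^ 2 ∂μ ≤ ε ^ 2 := by
        refine (lintegral_mono_set hB).trans ?_
        have : eLpNorm (fun x => gradient f x - (0 : Lp Plane 2 D.vol) x) 2 D.vol
            = eLpNorm (gradient f) 2 D.vol := by
          refine eLpNorm_congr_ae ?_
          filter_upwards [Lp.coeFn_zero Plane 2 D.vol] with x hx
          rw [hx]; simp
        rw [this] at h2
        rw [← sq_eLpNorm_two]
        gcongr
      have e3 := lintegral_sub_sq_le (convex_ball x₀ r) hBm hd hf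
      have hpt : ∀ x y, ‖s x - s y‖ₑ ^ 2
          ≤ 4 * ‖f x - s x‖ₑ ^ 2 + (2 * ‖f x - f y‖ₑ ^ 2 + 4 * ‖f y - s y‖ₑ ^ 2) := by
        intro x y
        have a1 : ‖s x - s y‖ₑ ≤ (‖f x - s x‖ₑ + ‖f y - s y‖ₑ) + ‖f x - f y‖ₑ := by
          have : s x - s y = ((f y - s y) - (f x - s x)) + (f x - f y) := by ring
          rw [this]
          refine (enorm_add_le _ _).trans ?_
          gcongr
          rw [add_comm]
          exact enorm_sub_le
        calc _ ≤ ((‖f x - s x‖ₑ + ‖f y - s y‖ₑ) + ‖f x - f y‖ₑ) ^ 2 := by gcongr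
          _ ≤ 2 * ((‖f x - s x‖ₑ + ‖f y - s y‖ₑ) ^ 2 + ‖f x - f y‖ₑ ^ 2) := ennreal_add_sq_le _ _
          _ ≤ 2 * (2 * (‖f x - s x‖ₑ ^ 2 + ‖f y - s y‖ₑ ^ 2) + ‖f x - f y‖ₑ ^ 2) := by
            gcongr; exact ennreal_add_sq_le _ _
          _ = _ := by ring
      have hm1 : AEMeasurable (fun x => ‖f x - s x‖ₑ ^ 2) μ :=
        (hfm.aestronglyMeasurable.sub hsm).enorm.pow_const 2
      have hm2 : ∀ y, Measurable fun x => ‖f x - f y‖ₑ ^ 2 := fun y =>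
        (hfm.sub_const _).enorm.pow_const 2
      have hm3 : Measurable fun y => ∫⁻ x, ‖f x - f y‖ₑ ^ 2 ∂μ := by
        have : Measurable fun z : Plane × Plane => ‖f z.2 - f z.1‖ₑ ^ 2 :=
          ((hfm.comp measurable_snd).sub (hfm.comp measurable_fst)).enorm.pow_const 2
        exact this.lintegral_prod_right'
      have hμu : μ univ = volume B := by simp [hμ]
      calc _ ≤ ∫⁻ y, ∫⁻ x, (4 * ‖f x - s x‖ₑ ^ 2
            + (2 * ‖f x - f y‖ₑ ^ 2 + 4 * ‖f y - s y‖ₑ ^ 2)) ∂μ ∂μ :=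
            lintegral_mono fun y => lintegral_mono fun x => hpt x y
        _ = ∫⁻ y, (4 * (∫⁻ x, ‖f x - s x‖ₑ ^ 2 ∂μ) + (2 * (∫⁻ x, ‖f x - f y‖ₑ ^ 2 ∂μ)
            + 4 * ‖f y - s y‖ₑ ^ 2 * volume B)) ∂μ := by
            refine lintegral_congr fun y => ?_
            rw [lintegral_add_left' (hm1.const_mul 4), lintegral_add_left ((hm2 y).const_mul 2),
              lintegral_const_mul'' _ hm1, lintegral_const_mul _ (hm2 y), lintegral_const, hμu]
        _ = 4 * (∫⁻ x, ‖f x - s x‖ₑ ^ 2 ∂μ) * volume B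
            + (2 * (∫⁻ y, ∫⁻ x, ‖f x - f y‖ₑ ^ 2 ∂μ ∂μ)
              + 4 * (∫⁻ x, ‖f x - s x‖ₑ ^ 2 ∂μ) * volume B) := by
            rw [lintegral_add_left measurable_const, lintegral_add_left (hm3.const_mul 2),
              lintegral_const, hμu, lintegral_const_mul _ hm3, lintegral_mul_const' _ _ hBt,
              lintegral_const_mul'' _ hm1]
        _ ≤ 4 * ε ^ 2 * volume B + (2 * (4 * ENNReal.ofReal (2 * r) ^ 2 * volume B * ε ^ 2)
              + 4 * ε ^ 2 * volume B) := by
            have e4 : ∫⁻ y, ∫⁻ x, ‖f x - f y‖ₑ ^ 2 ∂μ ∂μ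
                ≤ 4 * ENNReal.ofReal (2 * r) ^ 2 * volume B * ε ^ 2 :=
              e3.trans (by gcongr)
            gcongr
        _ = _ := by ring
    set M := 8 * volume B + 8 * ENNReal.ofReal (2 * r) ^ 2 * volume B with hM
    have hMt : M ≠ ⊤ := by
      rw [hM]
      exact ENNReal.add_ne_top.2 ⟨ENNReal.mul_ne_top (by simp) hBt, ENNReal.mul_ne_top
        (ENNReal.mul_ne_top (by simp) (ENNReal.pow_ne_top ENNReal.ofReal_ne_top)) hBt⟩
    have hlim : Tendsto (fun n : ℕ => M * ((n : ℝ≥0∞)⁻¹) ^ 2) atTop (𝓝 0) := by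
      have h1 := (ENNReal.continuous_pow 2).tendsto 0 |>.comp ENNReal.tendsto_inv_nat_nhds_zero
      have h2 := ENNReal.Tendsto.const_mul h1 (Or.inr hMt)
      simpa [Function.comp_def] using h2
    exact le_antisymm (ge_of_tendsto' hlim fun n => hbound _ (by simp)) zero_le
  have hmeas : AEMeasurable (fun y => ∫⁻ x, ‖s x - s y‖ₑ ^ 2 ∂μ) μ := by
    have h1 : AEMeasurable (fun z : Plane × Plane => ‖s z.2 - s z.1‖ₑ ^ 2) (μ.prod μ) :=
      (hsm.comp_snd.sub hsm.comp_fst).enorm.pow_const 2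
    exact h1.lintegral_prod_right'
  rw [lintegral_eq_zero_iff' hmeas] at hzero
  have hne : μ ≠ 0 := by
    rw [hμ, Ne, Measure.restrict_eq_zero]
    exact (Metric.measure_ball_pos volume x₀ hr).ne'
  have : (ae μ).NeBot := ae_neBot.2 hne
  -- The inner integral vanishes for almost every y, hence for some y because the ball has positive
  -- measure; s(y) is the constant.
  obtain ⟨y, hy⟩ := hzero.exists
  refine ⟨s y, ?_⟩
  have hy' : ∫⁻ x, ‖s x - s y‖ₑ ^ 2 ∂μ = 0 := hy
  have hm : AEMeasurable (fun x => ‖s x - s y‖ₑ ^ 2) μ :=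
    (hsm.sub aestronglyMeasurable_const).enorm.pow_const 2
  rw [lintegral_eq_zero_iff' hm] at hy'
  filter_upwards [hy'] with x hx
  simpa [sub_eq_zero] using hx

variable {D} in
-- Overlapping balls have an open intersection of positive measure, so their constants agree;
-- connectedness then makes the locally constant value global.
theorem IsTrace.exists_const {s : Lp ℝ 2 D.vol} {g : Lp ℝ 2 D.bd} (h : D.IsTrace s 0 g) :
    ∃ k : ℝ, ∀ᵐ x ∂D.vol, s x = k := by
  have hball : ∀ x ∈ D.Ω, ∃ r > 0, Metric.ball x r ⊆ D.Ω := fun x hx =>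
    Metric.isOpen_iff.1 D.isOpen_Ω x hx
  choose! r hr hrΩ using hball
  have hk : ∀ x ∈ D.Ω, ∃ k : ℝ, ∀ᵐ y ∂(volume.restrict (Metric.ball x (r x))), s y = k :=
    fun x hx => h.exists_const_on_ball (hr x hx) (hrΩ x hx)
  choose! κ hκ using hk
  have hloc : ∀ x ∈ D.Ω, ∀ y ∈ D.Ω, y ∈ Metric.ball x (r x) → κ x = κ y := by
    intro x hx y hy hyx
    have hopen : IsOpen (Metric.ball x (r x) ∩ Metric.ball y (r y)) :=
      Metric.isOpen_ball.inter Metric.isOpen_ball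
    have hpos := hopen.measure_pos volume ⟨y, hyx, Metric.mem_ball_self (hr y hy)⟩
    have h1 := ae_restrict_of_ae_restrict_of_subset (inter_subset_left (t := Metric.ball y (r y))) (hκ x hx)
    have h2 := ae_restrict_of_ae_restrict_of_subset (inter_subset_right (s := Metric.ball x (r x))) (hκ y hy)
    have : (ae (volume.restrict (Metric.ball x (r x) ∩ Metric.ball y (r y)))).NeBot := by
      rw [ae_neBot, Ne, Measure.restrict_eq_zero]
      exact hpos.ne'
    obtain ⟨z, h3, h4⟩ := (h1.and h2).exists
    exact h3.symm.trans h4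
  obtain ⟨x₀, hx₀⟩ := D.isConnected_Ω.nonempty
  have hconst : ∀ x ∈ D.Ω, κ x = κ x₀ := by
    intro x hx
    refine D.isConnected_Ω.isPreconnected.induction₂ (fun a b => κ a = κ b) ?_ ?_ ?_ hx hx₀
    · intro a ha
      filter_upwards [self_mem_nhdsWithin,
        mem_nhdsWithin_of_mem_nhds (Metric.ball_mem_nhds a (hr a ha))] with b hb hba
      exact hloc a ha b hb hba
    · intro a b c _ _ _ h1 h2; exact h1.trans h2
    · intro a b _ _ h1; exact h1.symm
  refine ⟨κ x₀, ?_⟩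
  rw [ae_restrict_iff' D.isOpen_Ω.measurableSet, ae_iff]
  refine measure_null_of_locally_null _ fun x hx => ?_
  simp only [Set.mem_ofPred_eq, Classical.not_imp] at hx
  refine ⟨{y | ¬ (y ∈ D.Ω → s y = κ x₀)} ∩ Metric.ball x (r x),
    inter_mem self_mem_nhdsWithin (mem_nhdsWithin_of_mem_nhds
      (Metric.ball_mem_nhds x (hr x hx.1))), ?_⟩
  have h1 := hκ x hx.1
  rw [ae_restrict_iff' Metric.isOpen_ball.measurableSet, ae_iff] at h1
  refine measure_mono_null ?_ h1
  rintro y ⟨hy, hyB⟩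
  simp only [Set.mem_ofPred_eq, Classical.not_imp] at hy ⊢
  exact ⟨hyB, by rw [hconst x hx.1]; exact hy.2⟩

end Data

end Graetz

/-! ### Closedness of the Sobolev space and definiteness of the energy -/

namespace Graetz

namespace Data

variable (D : Data)

theorem integral_gradient_eq_zero {φ : Plane → ℝ} (hφ : ContDiff ℝ ∞ φ) (hc : HasCompactSupport φ)
    (hs : tsupport φ ⊆ D.Ω) : ∫ x in D.Ω, gradient φ x = 0 := by
  have hg := continuous_gradient hφ
  have hgc := gradient_compact hc
  have hint : Integrable (gradient φ) := hg.integrable_of_hasCompactSupport hgc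
  have e : ∫ x in D.Ω, gradient φ x = ∫ x, gradient φ x := by
    refine setIntegral_eq_integral_of_forall_compl_eq_zero fun x hx => ?_
    have : x ∉ tsupport φ := fun h => hx (hs h)
    have h1 : fderiv ℝ φ x = 0 := by
      by_contra h2
      exact this (support_fderiv_subset ℝ h2)
    simp [gradient, h1]
  rw [e]
  refine ext_inner_left ℝ fun v => ?_
  rw [← integral_inner hint, inner_zero_right]
  have h1 : ∀ x, inner ℝ v (gradient φ x) = fderiv ℝ φ x v := fun x => by
    rw [real_inner_comm, gradient, InnerProductSpace.toDual_symm_apply]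
  simp only [h1]
  have h2 := integral_mul_fderiv_eq_neg_fderiv_mul_of_integrable (μ := (volume : Measure Plane))
    (f := fun _ => (1 : ℝ)) (g := φ) (v := v) (by simp) ?_ ?_
    (fun x _ => by fun_prop) (fun x _ => (hφ.differentiable (by simp)) x)
  · simpa using h2
  · simp only [one_mul, ← h1]
    exact (hint.const_inner v)
  · simpa using hφ.continuous.integrable_of_hasCompactSupport hc

variable {D} in
-- Derivatives of compactly supported test functions integrate to zero, so the weak gradient is
-- orthogonal to all test functions.
theorem IsWeakGradient.eq_zero_of_const {s : Lp ℝ 2 D.vol} {G : Lp Plane 2 D.vol}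
    (h : D.IsWeakGradient s G) {k : ℝ} (hk : ∀ᵐ x ∂D.vol, s x = k) : G = 0 := by
  have hGi : IntegrableOn G D.Ω := (Lp.memLp G).integrable (by norm_num)
  have h1 : ∀ᵐ x, x ∈ D.Ω → G x = 0 := by
    refine D.isOpen_Ω.ae_eq_zero_of_integral_contDiff_smul_eq_zero hGi.locallyIntegrableOn ?_
    intro φ hφ hc hs
    have e1 : ∫ x, φ x • G x = ∫ x in D.Ω, φ x • G x := by
      symm
      refine setIntegral_eq_integral_of_forall_compl_eq_zero fun x hx => ?_
      have : φ x = 0 := by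
        by_contra h2
        exact hx (hs (subset_tsupport φ h2))
      simp [this]
    have e2 : ∫ x in D.Ω, s x • gradient φ x = 0 := by
      have : ∫ x in D.Ω, s x • gradient φ x = ∫ x in D.Ω, k • gradient φ x := by
        refine integral_congr_ae ?_
        filter_upwards [hk] with x hx
        rw [hx]
      rw [this, integral_smul, D.integral_gradient_eq_zero hφ hc hs, smul_zero]
    have := h φ hφ hc hs
    rw [e2] at this
    rw [e1]
    exact neg_eq_zero.1 this.symm
  rw [Lp.eq_zero_iff_ae_eq_zero, Filter.EventuallyEq, ae_restrict_iff' D.isOpen_Ω.measurableSet]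
  exact h1

theorem isClosed_isWeakGradient : IsClosed {w : D.Triple | D.IsWeakGradient w.1 w.2.1} := by
  simp only [IsWeakGradient, Set.ofPred_forall]
  refine isClosed_iInter fun φ => isClosed_iInter fun hφ => isClosed_iInter fun hc =>
    isClosed_iInter fun _ => ?_
  set B : ℝ →L[ℝ] Plane →L[ℝ] Plane := ContinuousLinearMap.lsmul ℝ ℝ with hB
  have hφL := D.memLp_vol hφ.continuous
  have hgL := D.memLp_vol (continuous_gradient hφ)
  have e1 : ∀ s : Lp ℝ 2 D.vol, ∫ x in D.Ω, s x • gradient φ x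
      = B.lpPairing D.vol 2 2 s (hgL.toLp _) := by
    intro s
    rw [ContinuousLinearMap.lpPairing_eq_integral]
    refine integral_congr_ae ?_
    filter_upwards [hgL.coeFn_toLp] with x hx
    rw [hx]; rfl
  have e2 : ∀ G : Lp Plane 2 D.vol, ∫ x in D.Ω, φ x • G x
      = B.lpPairing D.vol 2 2 (hφL.toLp _) G := by
    intro G
    rw [ContinuousLinearMap.lpPairing_eq_integral]
    refine integral_congr_ae ?_
    filter_upwards [hφL.coeFn_toLp] with x hx
    rw [hx]; rfl
  simp only [e1, e2]
  exact isClosed_eq (by fun_prop) (by fun_prop)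

/-- A sequence convergent in L² has a subsequence convergent almost everywhere; translations
preserve length, so it converges almost everywhere at the shifted points too. -/
theorem isClosed_boundaryConditions :
    IsClosed {g : Lp ℝ 2 D.bd | D.VanishesOnDirichlet g ∧ D.IsPeriodic g} := by
  refine IsSeqClosed.isClosed fun g g₀ hg hlim => ?_
  obtain ⟨ns, -, hns⟩ := (tendstoInMeasure_of_tendsto_Lp hlim).exists_seq_tendsto_ae
  refine ⟨?_, fun j => ?_⟩
  · have h1 : ∀ᵐ x ∂(len.restrict D.ΓD), ∀ n, g n x = 0 := ae_all_iff.2 fun n => (hg n).1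
    filter_upwards [h1, ae_restrict_of_ae_restrict_of_subset D.ΓD_subset hns] with x hx hx'
    refine tendsto_nhds_unique hx' ?_
    simp only [hx]
    exact tendsto_const_nhds
  · have h1 : ∀ᵐ x ∂(len.restrict (D.piece j)), ∀ n, g n (x + D.shift j) = g n x :=
      ae_all_iff.2 fun n => (hg n).2 j
    filter_upwards [h1, D.ae_piece hns j, D.ae_shift hns j] with x hx h2 h3
    simp only [hx] at h3
    exact tendsto_nhds_unique h3 h2

theorem isClosed_sobolev : IsClosed (D.sobolev : Set D.Triple) := by
  have h := (D.isClosed_isWeakGradient.inter D.isClosed_isTrace).inter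
    (D.isClosed_boundaryConditions.preimage (continuous_snd.comp continuous_snd))
  convert h using 1
  ext w
  constructor
  · rintro ⟨h1, h2, h3, h4⟩; exact ⟨⟨h1, h2⟩, h3, h4⟩
  · rintro ⟨⟨h1, h2⟩, h3, h4⟩; exact ⟨h1, h2, h3, h4⟩

instance : CompleteSpace D.sobolev := D.isClosed_sobolev.completeSpace_coe

variable {D}

theorem V.isWeakGradient (s : D.V) : D.IsWeakGradient s.fn s.grad := s.2.1

theorem V.isTrace (s : D.V) : D.IsTrace s.fn s.grad s.trace := s.2.2.1

theorem V.vanishes (s : D.V) : D.VanishesOnDirichlet s.trace := s.2.2.2.1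

theorem norm_sq_eq_energy (s : D.V) : ‖s‖ ^ 2 = energy s s := (real_inner_self_eq_norm_sq s).symm

theorem norm_sq_Lp_eq {α E : Type*} [MeasurableSpace α] {μ : Measure α} [NormedAddCommGroup E]
    [InnerProductSpace ℝ E] (G : Lp E 2 μ) : ‖G‖ ^ 2 = ∫ x, inner ℝ (G x) (G x) ∂μ := by
  rw [← real_inner_self_eq_norm_sq, L2.inner_def]

theorem robin_nonneg (s : D.V) : 0 ≤ ∫ x in D.ΓR, D.a x * (s.trace x * s.trace x) ∂len := by
  obtain ⟨M, hM⟩ := D.a_bound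
  apply integral_nonneg_of_ae
  filter_upwards [ae_restrict_mem D.measurableSet_ΓR] with x hx
  exact mul_nonneg (hM x hx).1.le (mul_self_nonneg _)

theorem mul_norm_grad_sq_le {m : ℝ} (hm : ∀ᵐ x ∂D.vol, m ≤ D.σ x) (s : D.V) :
    m * ‖s.grad‖ ^ 2 ≤ ∫ x in D.Ω, D.σ x * inner ℝ (s.grad x) (s.grad x) := by
  rw [norm_sq_Lp_eq, ← integral_const_mul]
  refine integral_mono_ae ((L2.integrable_inner (𝕜 := ℝ) s.grad s.grad).const_mul m)
    (integrable_grad _ _) ?_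
  filter_upwards [hm] with x hx
  exact mul_le_mul_of_nonneg_right hx real_inner_self_nonneg

variable (D) in
theorem exists_grad_bound : ∃ C : ℝ, 0 < C ∧ ∀ s : D.V, ‖s.grad‖ ≤ C * ‖s‖ := by
  obtain ⟨m, M, hm, hM⟩ := D.σ_bound
  refine ⟨(√m)⁻¹, by positivity, fun s => ?_⟩
  have h1 := mul_norm_grad_sq_le (hM.mono fun x hx => hx.1) s
  have h2 : m * ‖s.grad‖ ^ 2 ≤ ‖s‖ ^ 2 := by
    rw [norm_sq_eq_energy, energy]
    linarith [robin_nonneg s]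
  rw [inv_mul_eq_div, le_div_iff₀ (Real.sqrt_pos.2 hm)]
  refine le_of_sq_le_sq ?_ (norm_nonneg _)
  rw [mul_pow, Real.sq_sqrt hm.le]
  linarith

variable (D) in
theorem exists_norm_bound : ∃ C : ℝ, 0 < C ∧ ∀ s : D.V, ‖s‖ ≤ C * ‖(s.1 : D.Triple)‖ := by
  obtain ⟨m, M, hm, hM⟩ := D.σ_bound
  obtain ⟨A, hA⟩ := D.a_bound
  refine ⟨√(|M| + |A| + 1), by positivity, fun s => ?_⟩
  have hG : ‖s.grad‖ ≤ ‖(s.1 : D.Triple)‖ := (norm_fst_le s.1.2).trans (norm_snd_le s.1)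
  have hg : ‖s.trace‖ ≤ ‖(s.1 : D.Triple)‖ := (norm_snd_le s.1.2).trans (norm_snd_le s.1)
  have h1 : ∫ x in D.Ω, D.σ x * inner ℝ (s.grad x) (s.grad x) ≤ |M| * ‖s.grad‖ ^ 2 := by
    rw [norm_sq_Lp_eq, ← integral_const_mul]
    refine integral_mono_ae (integrable_grad _ _)
      ((L2.integrable_inner (𝕜 := ℝ) s.grad s.grad).const_mul _) ?_
    filter_upwards [hM] with x hx
    exact mul_le_mul_of_nonneg_right (hx.2.trans (le_abs_self M)) real_inner_self_nonneg
  have h2 : ∫ x in D.ΓR, D.a x * (s.trace x * s.trace x) ∂len ≤ |A| * ‖s.trace‖ ^ 2 := by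
    have hint : Integrable (fun x => s.trace x * s.trace x) D.bd :=
      MemLp.integrable_mul (Lp.memLp _) (Lp.memLp _)
    have e : ‖s.trace‖ ^ 2 = ∫ x, s.trace x * s.trace x ∂D.bd := by
      rw [norm_sq_Lp_eq]; rfl
    have h3 : ∫ x in D.ΓR, s.trace x * s.trace x ∂len ≤ ‖s.trace‖ ^ 2 := by
      rw [e, ← bd_restrict]
      exact setIntegral_le_integral hint (Eventually.of_forall fun x => mul_self_nonneg _)
    refine le_trans ?_ (mul_le_mul_of_nonneg_left h3 (abs_nonneg A))
    rw [← integral_const_mul]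
    refine integral_mono_ae (integrable_trace _ _) ?_ ?_
    · rw [← bd_restrict]; exact hint.restrict.const_mul _
    · filter_upwards [ae_restrict_mem D.measurableSet_ΓR] with x hx
      exact mul_le_mul_of_nonneg_right ((hA x hx).2.trans (le_abs_self A)) (mul_self_nonneg _)
  refine le_of_sq_le_sq ?_ (by positivity)
  rw [mul_pow, Real.sq_sqrt (by positivity), norm_sq_eq_energy, energy]
  have h3 : ‖s.grad‖ ^ 2 ≤ ‖(s.1 : D.Triple)‖ ^ 2 := by gcongr
  have h4 : ‖s.trace‖ ^ 2 ≤ ‖(s.1 : D.Triple)‖ ^ 2 := by gcongr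
  nlinarith [mul_le_mul_of_nonneg_left h3 (abs_nonneg M), mul_le_mul_of_nonneg_left h4 (abs_nonneg A),
    sq_nonneg ‖(s.1 : D.Triple)‖]

/-- Subtracting the smooth constant leaves a triple with zero function and zero gradient, whose
trace vanishes by the trace inequality. -/
theorem V.trace_of_const (s : D.V) {k : ℝ} (hk : ∀ᵐ x ∂D.vol, s.fn x = k) :
    ∀ᵐ x ∂D.bd, s.trace x = k := by
  obtain ⟨C, hC, hT⟩ := D.exists_trace_bound
  have hG : s.grad = 0 := s.isWeakGradient.eq_zero_of_const hk
  set c := D.smoothTriple (fun _ => k) contDiff_const with hc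
  have hc1 : ∀ᵐ x ∂D.vol, c.1 x = k := (D.memLp_vol continuous_const).coeFn_toLp
  have hc3 : ∀ᵐ x ∂D.bd, c.2.2 x = k := (D.memLp_bd continuous_const).coeFn_toLp
  have hc2 : c.2.1 = 0 := by
    rw [Lp.eq_zero_iff_ae_eq_zero]
    filter_upwards [(D.memLp_vol (continuous_gradient (contDiff_const (c := k)))).coeFn_toLp] with x hx
    refine hx.trans ?_
    simp [gradient]
  have h1 := hT (s.1 - c) (IsTrace.sub s.isTrace (D.isTrace_smooth _ _))
  have e1 : (s.1 - c).1 = 0 := by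
    refine sub_eq_zero.2 (Lp.ext ?_)
    filter_upwards [hk, hc1] with x h2 h3
    exact h2.trans h3.symm
  have e2 : (s.1 - c).2.1 = 0 := sub_eq_zero.2 (hG.trans hc2.symm)
  rw [e1, e2] at h1
  have h2 : ‖(s.1 - c).2.2‖ ^ 2 ≤ 0 := by simpa using h1
  have h3 : (s.1 - c).2.2 = 0 :=
    norm_eq_zero.1 (pow_eq_zero_iff two_ne_zero |>.1 (le_antisymm h2 (sq_nonneg _)))
  have h4 : s.trace = c.2.2 := sub_eq_zero.1 h3
  rw [h4]
  exact hc3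

/-- Zero energy forces zero gradient, hence a constant with constant trace. A nonzero constant
violates the Dirichlet condition on a part of positive length and has positive Robin energy on such
a part, which is impossible when the constants are controlled. -/
theorem energy_eq_zero_iff (s : D.V) : energy s s = 0 ↔ D.IsNegligible s := by
  constructor
  · intro h
    obtain ⟨C, hC, hG⟩ := D.exists_grad_bound
    have hs0 : ‖s‖ = 0 := by
      rw [← norm_sq_eq_energy] at h
      exact pow_eq_zero_iff two_ne_zero |>.1 h
    have hG0 : s.grad = 0 := by
      have := hG s
      rw [hs0, mul_zero] at this
      exact norm_le_zero_iff.1 this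
    have ht := s.isTrace
    rw [hG0] at ht
    obtain ⟨k, hk⟩ := ht.exists_const
    by_cases hcon : D.ConstantsControlled
    · left
      have htr := s.trace_of_const hk
      by_contra hne
      have hk0 : k ≠ 0 := by
        rintro rfl; exact hne hk
      have hD : len D.ΓD = 0 := by
        rw [← Measure.restrict_eq_zero, ← ae_eq_bot, ← Filter.empty_mem_iff_bot]
        filter_upwards [s.vanishes, ae_restrict_of_ae_restrict_of_subset D.ΓD_subset htr] with x h1 h2
        exact hk0 (h2.symm.trans h1)
      have hR : len D.ΓR = 0 := by
        obtain ⟨M, hM⟩ := D.a_bound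
        have hr : ∫ x in D.ΓR, D.a x * (s.trace x * s.trace x) ∂len = 0 := by
          have h1 := robin_nonneg s
          obtain ⟨m, M, hm, hM⟩ := D.σ_bound
          have h2 := mul_norm_grad_sq_le (hM.mono fun x hx => hx.1) s
          rw [hG0] at h2
          have h3 : 0 ≤ ∫ x in D.Ω, D.σ x * inner ℝ (s.grad x) (s.grad x) := by
            rw [hG0]; simpa using h2
          rw [energy] at h
          linarith
        rw [integral_eq_zero_iff_of_nonneg_ae _ (integrable_trace _ _)] at hr
        · rw [← Measure.restrict_eq_zero, ← ae_eq_bot, ← Filter.empty_mem_iff_bot]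
          filter_upwards [hr, ae_ΓR htr, ae_restrict_mem D.measurableSet_ΓR] with x h1 h2 h3
          rw [h2, Pi.zero_apply] at h1
          exact (mul_pos (hM x h3).1 (mul_self_pos.2 hk0)).ne' h1
        · filter_upwards [ae_restrict_mem D.measurableSet_ΓR] with x hx
          exact mul_nonneg (hM x hx).1.le (mul_self_nonneg _)
      exact hcon.ne' (measure_union_null hD hR)
    · exact Or.inr ⟨hcon, k, hk⟩
  · rintro h
    have hk : ∃ k : ℝ, (∀ᵐ x ∂D.vol, s.fn x = k) ∧ (k = 0 ∨ len D.ΓR = 0) := by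
      rcases h with h | ⟨hcon, k, h⟩
      · exact ⟨0, h, Or.inl rfl⟩
      · refine ⟨k, h, Or.inr ?_⟩
        have := nonpos_iff_eq_zero.1 (not_lt.1 hcon)
        exact measure_mono_null subset_union_right this
    obtain ⟨k, hk, hor⟩ := hk
    have hG0 : s.grad = 0 := s.isWeakGradient.eq_zero_of_const hk
    have htr := s.trace_of_const hk
    have e1 : ∫ x in D.Ω, D.σ x * inner ℝ (s.grad x) (s.grad x) = 0 := by
      rw [hG0]
      refine integral_eq_zero_of_ae ?_
      filter_upwards [Lp.coeFn_zero Plane 2 D.vol] with x hx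
      rw [hx]; simp
    have e2 : ∫ x in D.ΓR, D.a x * (s.trace x * s.trace x) ∂len = 0 := by
      rcases hor with rfl | h0
      · refine integral_eq_zero_of_ae ?_
        filter_upwards [ae_ΓR htr] with x hx
        rw [hx]; simp
      · rw [Measure.restrict_eq_zero.2 h0]; simp
    rw [energy, e1, e2, add_zero]

end Data

end Graetz

/-! ### Poincaré inequality and completeness in the energy norm -/

namespace Graetz

namespace Data

variable (D : Data)

/-- The integral over `Ω` as a continuous functional on `L²(Ω)`. -/
noncomputable def total : Lp ℝ 2 D.vol →L[ℝ] ℝ :=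
  innerSL ℝ (indicatorConstLp 2 MeasurableSet.univ (measure_ne_top D.vol univ) (1 : ℝ))

theorem total_apply (f : Lp ℝ 2 D.vol) : D.total f = ∫ x in D.Ω, f x := by
  rw [total, innerSL_apply_apply, L2.inner_indicatorConstLp_one, Measure.restrict_univ]

theorem volume_pos : 0 < D.vol.real univ := by
  have h := D.isOpen_Ω.measure_pos volume D.isConnected_Ω.nonempty
  rw [Measure.real, Measure.restrict_apply_univ]
  exact ENNReal.toReal_pos h.ne' D.isBounded_Ω.measure_lt_top.ne

variable {D}

/-- A representative of a class in `H`: any function if the constants are controlled, and the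
functions of mean zero otherwise. -/
def V.IsNormalized (s : D.V) : Prop := D.ConstantsControlled ∨ D.total s.fn = 0

theorem V.fn_eq_zero {s : D.V} (hs : s.IsNormalized) (h : ‖s‖ = 0) : s.fn = 0 := by
  have h1 : energy s s = 0 := by rw [← norm_sq_eq_energy, h]; simp
  rw [energy_eq_zero_iff] at h1
  rw [Lp.eq_zero_iff_ae_eq_zero]
  rcases h1 with h1 | ⟨hc, k, hk⟩
  · exact h1
  · rcases hs with hs | hs
    · exact absurd hs hc
    · rw [D.total_apply, integral_congr_ae hk, integral_const, smul_eq_mul] at hs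
      have hk0 : k = 0 := (mul_eq_zero.1 hs).resolve_left D.volume_pos.ne'
      rw [hk0] at hk
      exact hk

theorem V.norm_triple_le {C : ℝ} (hC : 0 < C) (hT : ∀ w : D.Triple, D.IsTrace w.1 w.2.1 w.2.2 →
    ‖w.2.2‖ ^ 2 ≤ C * (‖w.1‖ ^ 2 + ‖w.2.1‖ ^ 2)) (s : D.V) :
    ‖(s.1 : D.Triple)‖ ≤ (1 + √C) * (‖s.fn‖ + ‖s.grad‖) := by
  have h0 := Real.sqrt_nonneg C
  have h1 : ‖s.trace‖ ≤ √C * (‖s.fn‖ + ‖s.grad‖) := by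
    refine le_of_sq_le_sq ?_ (by positivity)
    refine (hT s.1 s.isTrace).trans ?_
    rw [mul_pow, Real.sq_sqrt hC.le]
    gcongr
    change ‖s.fn‖ ^ 2 + ‖s.grad‖ ^ 2 ≤ _
    nlinarith [mul_nonneg (norm_nonneg s.fn) (norm_nonneg s.grad)]
  have h2 : 0 ≤ √C * (‖s.fn‖ + ‖s.grad‖) := by positivity
  have h3 := norm_nonneg s.fn
  have h4 := norm_nonneg s.grad
  refine max_le ?_ (max_le ?_ ?_)
  · change ‖s.fn‖ ≤ _; linarith
  · change ‖s.grad‖ ≤ _; linarith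
  · change ‖s.trace‖ ≤ _; linarith

/-- Bounded sequences in `V` have subsequences that converge in `L²(Ω)`. -/
theorem exists_subseq_tendsto_fn (u : ℕ → D.V) {R : ℝ} (h1 : ∀ n, ‖(u n).fn‖ ≤ R)
    (h2 : ∀ n, ‖(u n).grad‖ ≤ R) : ∃ (f : Lp ℝ 2 D.vol) (ns : ℕ → ℕ), StrictMono ns ∧
      Tendsto (fun n => (u (ns n)).fn) atTop (𝓝 f) := by
  have hK : IsCompact (closure {s : Lp ℝ 2 D.vol | ∃ w : D.Triple,
      D.IsTrace w.1 w.2.1 w.2.2 ∧ ‖w.1‖ ≤ R ∧ ‖w.2.1‖ ≤ R ∧ w.1 = s}) :=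
    isCompact_iff_totallyBounded_isComplete.2
      ⟨(D.totallyBounded_fn R).closure, isClosed_closure.isComplete⟩
  obtain ⟨f, -, ns, hns, hlim⟩ := hK.tendsto_subseq (x := fun n => (u n).fn)
    fun n => subset_closure ⟨(u n).1, (u n).isTrace, h1 n, h2 n, rfl⟩
  exact ⟨f, ns, hns, hlim⟩

theorem V.fn_sub (s t : D.V) : (s - t).fn = s.fn - t.fn := rfl

theorem V.grad_sub (s t : D.V) : (s - t).grad = s.grad - t.grad := rfl

theorem V.fn_smul (k : ℝ) (s : D.V) : (k • s).fn = k • s.fn := rfl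

theorem V.norm_triple_sub (s t : D.V) : ‖((s - t).1 : D.Triple)‖ = ‖(s.1 : D.Triple) - t.1‖ := rfl

variable (D) in
/-- The Poincaré inequality. -/
theorem exists_poincare : ∃ C : ℝ, 0 < C ∧ ∀ s : D.V, s.IsNormalized → ‖s.fn‖ ≤ C * ‖s‖ := by
  obtain ⟨Cg, hCg, hgrad⟩ := D.exists_grad_bound
  obtain ⟨Ct, hCt, htr⟩ := D.exists_trace_bound
  obtain ⟨Cn, hCn, hnorm⟩ := D.exists_norm_bound
  by_contra! hcon
  -- If no constant works, rescaling gives normalized functions of norm 1 in L² with energy norm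
  -- tending to 0.
  have hex : ∀ n : ℕ, ∃ s : D.V, s.IsNormalized ∧ ‖s.fn‖ = 1 ∧ ‖s‖ ≤ 1 / ((n : ℝ) + 1) := by
    intro n
    obtain ⟨s, hs, hlt⟩ := hcon (n + 1) (by positivity)
    have hpos : 0 < ‖s.fn‖ := lt_of_le_of_lt (by positivity) hlt
    refine ⟨‖s.fn‖⁻¹ • s, ?_, ?_, ?_⟩
    · refine hs.imp id fun h => ?_
      rw [V.fn_smul, map_smul, h, smul_zero]
    · rw [V.fn_smul, norm_smul, norm_inv, norm_norm, inv_mul_cancel₀ hpos.ne']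
    · rw [norm_smul, norm_inv, norm_norm, inv_mul_le_iff₀ hpos, mul_one_div,
        le_div_iff₀ (by positivity)]
      linarith
  choose u huZ hu1 hu0 using hex
  have hulim : Tendsto (fun n => ‖u n‖) atTop (𝓝 0) :=
    squeeze_zero (fun _ => norm_nonneg _) hu0 tendsto_one_div_add_atTop_nhds_zero_nat
  have hu0' : ∀ n, ‖u n‖ ≤ 1 := fun n => (hu0 n).trans
    ((div_le_one (by positivity)).2 (by linarith [(Nat.cast_nonneg n : (0 : ℝ) ≤ n)]))
  obtain ⟨f, ns, hns, hf⟩ := exists_subseq_tendsto_fn u (R := max 1 Cg)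
    (fun n => (hu1 n).le.trans (le_max_left _ _))
    (fun n => (hgrad (u n)).trans ((mul_le_of_le_one_right hCg.le (hu0' n)).trans (le_max_right _ _)))
  set v : ℕ → D.sobolev := fun n => u (ns n) with hv
  have hgr : Tendsto (fun n => (u (ns n)).grad) atTop (𝓝 0) := by
    rw [tendsto_zero_iff_norm_tendsto_zero]
    refine squeeze_zero (fun _ => norm_nonneg _) (fun n => hgrad _) ?_
    have := (hulim.comp hns.tendsto_atTop).const_mul Cg
    simpa using this
  -- Rellich's theorem gives convergence of the functions, the energy that of the gradients, and the
  -- trace inequality then controls the traces. So the sequence converges in the complete space of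
  -- triples.
  have hcau : CauchySeq v := by
    rw [Metric.cauchySeq_iff']
    intro ε hε
    have hK : 0 < 1 + √Ct := by positivity
    obtain ⟨N1, hN1⟩ := Metric.cauchySeq_iff.1 hf.cauchySeq (ε / (2 * (1 + √Ct))) (by positivity)
    obtain ⟨N2, hN2⟩ := Metric.cauchySeq_iff.1 hgr.cauchySeq (ε / (2 * (1 + √Ct))) (by positivity)
    refine ⟨max N1 N2, fun n hn => ?_⟩
    have h3 := hN1 n ((le_max_left _ _).trans hn) (max N1 N2) (le_max_left _ _)
    have h4 := hN2 n ((le_max_right _ _).trans hn) (max N1 N2) (le_max_right _ _)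
    have h5 := V.norm_triple_le hCt htr (u (ns n) - u (ns (max N1 N2)))
    rw [V.fn_sub, V.grad_sub, ← dist_eq_norm, ← dist_eq_norm] at h5
    calc dist (v n) (v (max N1 N2)) ≤ (1 + √Ct) * (dist (u (ns n)).fn (u (ns (max N1 N2))).fn
          + dist (u (ns n)).grad (u (ns (max N1 N2))).grad) := (dist_eq_norm (v n) _).trans_le h5
      _ < (1 + √Ct) * (ε / (2 * (1 + √Ct)) + ε / (2 * (1 + √Ct))) := by gcongr
      _ = ε := by field_simp; norm_num
  obtain ⟨w, hw⟩ := cauchySeq_tendsto_of_complete hcau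
  let t : D.V := w
  have hfn : Continuous fun x : D.sobolev => x.1.1 := by fun_prop
  have h1 : Tendsto (fun n => (u (ns n)).fn) atTop (𝓝 t.fn) := (hfn.tendsto w).comp hw
  have ht1 : ‖t.fn‖ = 1 := by
    have h2 := h1.norm
    simp only [hu1] at h2
    exact tendsto_nhds_unique h2 tendsto_const_nhds
  have htZ : t.IsNormalized := by
    by_cases hc : D.ConstantsControlled
    · exact Or.inl hc
    · right
      have h2 := (D.total.continuous.tendsto _).comp h1
      have h3 : ∀ n, D.total (u n).fn = 0 := fun n => (huZ n).resolve_left hc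
      simp only [Function.comp_def, h3] at h2
      exact tendsto_nhds_unique h2 tendsto_const_nhds
  -- The energy norm is continuous for the triple norm, so the limit has energy zero. It is
  -- normalized, hence zero, although its L² norm is 1.
  have ht0 : ‖t‖ = 0 := by
    have h2 : Tendsto (fun n => Cn * ‖v n - w‖ + ‖u (ns n)‖) atTop (𝓝 0) := by
      have h3 := (tendsto_iff_norm_sub_tendsto_zero.1 hw).const_mul Cn
      have h4 := h3.add (hulim.comp hns.tendsto_atTop)
      rwa [mul_zero, add_zero] at h4
    refine le_antisymm (ge_of_tendsto' h2 fun n => ?_) (norm_nonneg _)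
    have h3 := hnorm (u (ns n) - t)
    have h4 : ‖t‖ ≤ ‖u (ns n) - t‖ + ‖u (ns n)‖ := by
      have := norm_sub_le (u (ns n)) (u (ns n) - t)
      rw [sub_sub_cancel] at this
      linarith
    exact h4.trans (add_le_add h3 le_rfl)
  rw [V.fn_eq_zero htZ ht0, norm_zero] at ht1
  exact zero_ne_one ht1

variable (D) in
/-- The constant functions belong to `V` if they are not controlled. -/
theorem exists_one (hc : ¬ D.ConstantsControlled) : ∃ s : D.V, ∀ᵐ x ∂D.vol, s.fn x = 1 := by
  have hnull : len (D.ΓD ∪ D.ΓR) = 0 := nonpos_iff_eq_zero.1 (not_lt.1 hc)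
  set w := D.smoothTriple (fun _ => 1) contDiff_const with hw
  have hw1 : ∀ᵐ x ∂D.vol, w.1 x = 1 := (D.memLp_vol continuous_const).coeFn_toLp
  have hw3 : ∀ᵐ x ∂D.bd, w.2.2 x = 1 := (D.memLp_bd continuous_const).coeFn_toLp
  have hw2 : ∀ᵐ x ∂D.vol, w.2.1 x = 0 := by
    filter_upwards [(D.memLp_vol (continuous_gradient (contDiff_const (c := (1 : ℝ))))).coeFn_toLp]
      with x hx
    refine hx.trans ?_
    simp [gradient]
  have hmem : w ∈ D.sobolev := by
    refine ⟨fun φ hφ hcφ hs => ?_, D.isTrace_smooth _ _, ?_, fun j => ?_⟩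
    · have e1 : ∫ x in D.Ω, w.1 x • gradient φ x = ∫ x in D.Ω, gradient φ x := by
        refine integral_congr_ae ?_
        filter_upwards [hw1] with x hx
        rw [hx, one_smul]
      have e2 : ∫ x in D.Ω, φ x • w.2.1 x = 0 := by
        refine integral_eq_zero_of_ae ?_
        filter_upwards [hw2] with x hx
        rw [hx, smul_zero, Pi.zero_apply]
      rw [e1, e2, D.integral_gradient_eq_zero hφ hcφ hs, neg_zero]
    · have : len D.ΓD = 0 := measure_mono_null subset_union_left hnull
      rw [VanishesOnDirichlet, Measure.restrict_eq_zero.2 this]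
      simp
    · filter_upwards [D.ae_piece hw3 j, D.ae_shift hw3 j] with x h1 h2
      rw [h1, h2]
  exact ⟨⟨w, hmem⟩, hw1⟩

variable (D) in
-- If the constants are not controlled, the mean is subtracted. Linearity lets one choose
-- representatives of differences consistently.
theorem exists_normalize : ∃ R : D.V →ₗ[ℝ] D.V, ∀ s, ‖s - R s‖ = 0 ∧ (R s).IsNormalized := by
  by_cases hc : D.ConstantsControlled
  · exact ⟨LinearMap.id, fun s => ⟨by simp, Or.inl hc⟩⟩
  · obtain ⟨o, ho⟩ := D.exists_one hc
    have ho1 : D.total o.fn = D.vol.real univ := by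
      rw [D.total_apply, integral_congr_ae ho]
      simp
    have ho0 : ‖o‖ = 0 := by
      have : energy o o = 0 := (energy_eq_zero_iff o).2 (Or.inr ⟨hc, 1, ho⟩)
      rw [← norm_sq_eq_energy] at this
      exact pow_eq_zero_iff two_ne_zero |>.1 this
    let fnL : D.V →ₗ[ℝ] Lp ℝ 2 D.vol :=
      { toFun := V.fn
        map_add' := fun _ _ => rfl
        map_smul' := fun _ _ => rfl }
    let R : D.V →ₗ[ℝ] D.V := LinearMap.id -
      (((D.vol.real univ)⁻¹ • (D.total : Lp ℝ 2 D.vol →ₗ[ℝ] ℝ) ∘ₗ fnL).smulRight o)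
    have hR : ∀ s, R s = s - ((D.vol.real univ)⁻¹ * D.total s.fn) • o := fun s => rfl
    refine ⟨R, fun s => ⟨?_, Or.inr ?_⟩⟩
    · rw [hR, sub_sub_cancel, norm_smul, ho0, mul_zero]
    · rw [hR, V.fn_sub, V.fn_smul, map_sub, map_smul, ho1, smul_eq_mul]
      have := D.volume_pos.ne'
      field_simp
      ring

variable (D) in
-- On normalized functions the energy norm controls the full norm of function, gradient and trace.
-- The energy only yields a seminorm on `V`, and this map transfers questions about it to the closed
-- subspace of triples.
theorem exists_bounded_normalize : ∃ (R : D.V →ₗ[ℝ] D.V) (C : ℝ), 0 < C ∧ ∀ s,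
    ‖s - R s‖ = 0 ∧ ‖((R s).1 : D.Triple)‖ ≤ C * ‖s‖ := by
  obtain ⟨Cg, hCg, hgrad⟩ := D.exists_grad_bound
  obtain ⟨Ct, hCt, htr⟩ := D.exists_trace_bound
  obtain ⟨Cp, hCp, hpoin⟩ := D.exists_poincare
  obtain ⟨R, hR⟩ := D.exists_normalize
  refine ⟨R, (1 + √Ct) * (Cp + Cg), by positivity, fun s => ⟨(hR s).1, ?_⟩⟩
  have h1 : ‖R s‖ ≤ ‖s‖ := by
    have := norm_sub_le s (s - R s)
    rwa [sub_sub_cancel, (hR s).1, add_zero] at this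
  calc _ ≤ (1 + √Ct) * (‖(R s).fn‖ + ‖(R s).grad‖) := V.norm_triple_le hCt htr (R s)
    _ ≤ (1 + √Ct) * (Cp * ‖R s‖ + Cg * ‖R s‖) := by
      gcongr
      · exact hpoin _ (hR s).2
      · exact hgrad _
    _ = (1 + √Ct) * (Cp + Cg) * ‖R s‖ := by ring
    _ ≤ _ := by gcongr

/-- Normalizing a Cauchy sequence for the energy makes it Cauchy in the triple norm, where the space
is complete. Its limit there is also a limit for the energy, since normalization changes nothing in
energy. -/
instance : CompleteSpace D.V := by
  obtain ⟨R, C, hC, hR⟩ := D.exists_bounded_normalize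
  obtain ⟨Cn, hCn, hnorm⟩ := D.exists_norm_bound
  refine Metric.complete_of_cauchySeq_tendsto fun u hu => ?_
  set v : ℕ → D.sobolev := fun n => R (u n) with hv
  have hle : ∀ n m, dist (v n) (v m) ≤ C * dist (u n) (u m) := by
    intro n m
    have h1 := (hR (u n - u m)).2
    rw [map_sub, V.norm_triple_sub, ← dist_eq_norm, ← dist_eq_norm] at h1
    exact h1
  have hcau : CauchySeq v := by
    rw [Metric.cauchySeq_iff] at hu ⊢
    intro ε hε
    obtain ⟨N, hN⟩ := hu (ε / C) (by positivity)
    refine ⟨N, fun m hm n hn => (hle m n).trans_lt ?_⟩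
    have := hN m hm n hn
    rw [lt_div_iff₀ hC] at this
    linarith
  obtain ⟨w, hw⟩ := cauchySeq_tendsto_of_complete hcau
  let t : D.V := w
  refine ⟨t, ?_⟩
  rw [tendsto_iff_norm_sub_tendsto_zero]
  have h2 : Tendsto (fun n => Cn * ‖v n - w‖) atTop (𝓝 0) := by
    have := (tendsto_iff_norm_sub_tendsto_zero.1 hw).const_mul Cn
    rwa [mul_zero] at this
  refine squeeze_zero (fun _ => norm_nonneg _) (fun n => ?_) h2
  have h3 := hnorm (R (u n) - t)
  have h4 : ‖u n - t‖ ≤ ‖u n - R (u n)‖ + ‖R (u n) - t‖ := by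
    have := norm_add_le (u n - R (u n)) (R (u n) - t)
    rwa [sub_add_sub_cancel] at this
  rw [(hR (u n)).1, zero_add] at h4
  exact h4.trans h3

end Data

end Graetz

/-! ### The Graetz operator: symmetry, Lyapunov relation, discrete spectrum -/

namespace Graetz

namespace Data

variable (D : Data)

/-- The measure `c dx` on `Ω`. -/
noncomputable abbrev cvol : Measure Plane := D.vol.withDensity fun x => ENNReal.ofReal (D.c x)

variable {D}

theorem cvol_ac : D.cvol ≪ D.vol := withDensity_absolutelyContinuous _ _

theorem integral_cvol (g : Plane → ℝ) : ∫ x, g x ∂D.cvol = ∫ x in D.Ω, D.c x * g x := by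
  obtain ⟨m, M, hm, hM⟩ := D.c_bound
  rw [integral_withDensity_eq_integral_toReal_smul (by have := D.measurable_c; fun_prop)
    (Eventually.of_forall fun x => ENNReal.ofReal_lt_top)]
  refine integral_congr_ae ?_
  filter_upwards [hM] with x hx
  rw [ENNReal.toReal_ofReal (hm.le.trans hx.1), smul_eq_mul]

theorem inner_L2c (f g : D.L2c) : inner ℝ f g = ∫ x in D.Ω, D.c x * (f x * g x) := by
  rw [L2.inner_def, integral_cvol]
  refine integral_congr_ae (Eventually.of_forall fun x => ?_)
  simp [mul_comm]

theorem memLp_cvol (g : Lp ℝ 2 D.vol) : MemLp g 2 D.cvol := by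
  obtain ⟨m, M, hm, hM⟩ := D.c_bound
  refine (Lp.memLp g).of_measure_le_smul (c := ENNReal.ofReal M) ENNReal.ofReal_ne_top ?_
  rw [← withDensity_const]
  refine withDensity_mono ?_
  filter_upwards [hM] with x hx
  exact ENNReal.ofReal_le_ofReal hx.2

/-- A function in `L²(Ω)` as an element of `L²(Ω, c dx)`. -/
noncomputable def toL2c (g : Lp ℝ 2 D.vol) : D.L2c := (memLp_cvol g).toLp g

theorem coeFn_toL2c (g : Lp ℝ 2 D.vol) : ∀ᵐ x ∂D.vol, toL2c g x = g x :=
  vol_ac.ae_le (memLp_cvol g).coeFn_toLp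

theorem eq_toL2c {f : D.L2c} {g : Lp ℝ 2 D.vol} (h : ∀ᵐ x ∂D.vol, f x = g x) : f = toL2c g := by
  refine Lp.ext ?_
  filter_upwards [cvol_ac.ae_le h, (memLp_cvol g).coeFn_toLp] with x h1 h2
  exact h1.trans h2.symm

theorem toL2c_sub (g g' : Lp ℝ 2 D.vol) : toL2c (g - g') = toL2c g - toL2c g' := by
  symm
  refine eq_toL2c ?_
  filter_upwards [vol_ac.ae_le (Lp.coeFn_sub (toL2c g) (toL2c g')), coeFn_toL2c g, coeFn_toL2c g',
    Lp.coeFn_sub g g'] with x h1 h2 h3 h4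
  rw [h1, h4, Pi.sub_apply, Pi.sub_apply, h2, h3]

variable (D) in
theorem exists_toL2c_bounds : ∃ C : ℝ, 0 < C ∧ ∀ g : Lp ℝ 2 D.vol,
    ‖toL2c g‖ ≤ C * ‖g‖ ∧ ‖g‖ ≤ C * ‖toL2c g‖ := by
  obtain ⟨m, M, hm, hM⟩ := D.c_bound
  have key : ∀ g : Lp ℝ 2 D.vol, m * ‖g‖ ^ 2 ≤ ‖toL2c g‖ ^ 2 ∧ ‖toL2c g‖ ^ 2 ≤ |M| * ‖g‖ ^ 2 := by
    intro g
    have e1 : ‖toL2c g‖ ^ 2 = ∫ x in D.Ω, D.c x * (g x * g x) := by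
      rw [← real_inner_self_eq_norm_sq, inner_L2c]
      refine integral_congr_ae ?_
      filter_upwards [coeFn_toL2c g] with x hx
      rw [hx]
    have e2 : ‖g‖ ^ 2 = ∫ x in D.Ω, g x * g x := by rw [norm_sq_Lp_eq]; rfl
    have hint : Integrable (fun x => g x * g x) D.vol :=
      MemLp.integrable_mul (Lp.memLp _) (Lp.memLp _)
    have hint' : Integrable (fun x => D.c x * (g x * g x)) D.vol := by
      refine hint.bdd_mul (c := |M|) D.measurable_c.aestronglyMeasurable ?_
      filter_upwards [hM] with x hx
      rw [Real.norm_eq_abs, abs_of_nonneg (hm.le.trans hx.1)]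
      exact hx.2.trans (le_abs_self M)
    rw [e1, e2, ← integral_const_mul, ← integral_const_mul]
    constructor
    · refine integral_mono_ae (hint.const_mul m) hint' ?_
      filter_upwards [hM] with x hx
      exact mul_le_mul_of_nonneg_right hx.1 (mul_self_nonneg _)
    · refine integral_mono_ae hint' (hint.const_mul _) ?_
      filter_upwards [hM] with x hx
      exact mul_le_mul_of_nonneg_right (hx.2.trans (le_abs_self M)) (mul_self_nonneg _)
  refine ⟨max √(|M|) (√m)⁻¹, lt_max_of_lt_right (by positivity), fun g => ⟨?_, ?_⟩⟩
  · calc ‖toL2c g‖ ≤ √(|M|) * ‖g‖ := by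
          refine le_of_sq_le_sq ?_ (by positivity)
          rw [mul_pow, Real.sq_sqrt (abs_nonneg M)]
          exact (key g).2
      _ ≤ _ := by gcongr; exact le_max_left _ _
  · calc ‖g‖ ≤ (√m)⁻¹ * ‖toL2c g‖ := by
          rw [inv_mul_eq_div, le_div_iff₀ (Real.sqrt_pos.2 hm)]
          refine le_of_sq_le_sq ?_ (norm_nonneg _)
          rw [mul_pow, Real.sq_sqrt hm.le]
          linarith [(key g).1]
      _ ≤ _ := by gcongr; exact le_max_right _ _

variable (D) in
theorem memLp_top_quotient : MemLp (fun x => D.h x / D.c x) ∞ D.cvol := by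
  obtain ⟨m, M, hm, hM⟩ := D.c_bound
  obtain ⟨A, hA⟩ := D.h_bound
  refine memLp_top_of_bound (D.measurable_h.div D.measurable_c).aestronglyMeasurable (|A| / m) ?_
  refine cvol_ac.ae_le ?_
  filter_upwards [hM, hA] with x h1 h2
  rw [Real.norm_eq_abs, abs_div, abs_of_pos (hm.trans_le h1.1)]
  exact div_le_div₀ (abs_nonneg A) (h2.trans (le_abs_self A)) hm h1.1

variable (D) in
/-- Multiplication by `h / c` on `L²(Ω, c dx)`. -/
noncomputable def velocity : D.L2c →L[ℝ] D.L2c :=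
  (ContinuousLinearMap.mul ℝ ℝ).holderL D.cvol ∞ 2 2 (D.memLp_top_quotient.toLp _)

theorem coeFn_velocity (f : D.L2c) :
    ∀ᵐ x ∂D.vol, D.velocity f x = D.h x / D.c x * f x := by
  have h1 : ∀ᵐ x ∂D.cvol, D.velocity f x = D.h x / D.c x * f x := by
    filter_upwards [(ContinuousLinearMap.mul ℝ ℝ).coeFn_holder (r := 2)
      (D.memLp_top_quotient.toLp _) f, D.memLp_top_quotient.coeFn_toLp] with x h1 h2
    refine h1.trans ?_
    rw [h2]
    rfl
  exact vol_ac.ae_le h1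

theorem inner_velocity_comm (f g : D.L2c) :
    inner ℝ (D.velocity f) g = inner ℝ (D.velocity g) f := by
  rw [inner_L2c, inner_L2c]
  refine integral_congr_ae ?_
  filter_upwards [coeFn_velocity f, coeFn_velocity g] with x h1 h2
  rw [h1, h2]
  ring

/-- The bilinear form `∫_Ω h u u'` on pairs `(u, s)`. -/
noncomputable def velocityForm (D : Data) : D.Space →ₗ[ℝ] D.Space →ₗ[ℝ] ℝ :=
  let fstL : D.Space →ₗ[ℝ] D.L2c :=
    { toFun := WithLp.fst
      map_add' := fun _ _ => rfl
      map_smul' := fun _ _ => rfl }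
  (innerₗ D.L2c).compl₁₂ ((D.velocity : D.L2c →ₗ[ℝ] D.L2c) ∘ₗ fstL) fstL

theorem velocityForm_apply (φ ψ : D.Space) :
    D.velocityForm φ ψ = inner ℝ (D.velocity φ.fst) ψ.fst := rfl

/-- The weight c in the inner product cancels the factor c⁻¹ of the operator, and the divergence
term becomes the energy product by its weak definition. -/
theorem inner_fst_of_isNegDiv {φ ψ : D.Space} {u s : D.V} {f : Lp ℝ 2 D.vol} (h1 : IsNegDiv s f)
    (h2 : ∀ᵐ x ∂D.vol, φ.fst x = u.fn x)
    (h4 : ∀ᵐ x ∂D.vol, ψ.fst x = (D.c x)⁻¹ * (D.h x * u.fn x + f x)) (v : D.V) :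
    inner ℝ ψ.fst (toL2c v.fn) = inner ℝ (D.velocity φ.fst) (toL2c v.fn) + inner ℝ s v := by
  obtain ⟨m, M, hm, hM⟩ := D.c_bound
  obtain ⟨A, hA⟩ := D.h_bound
  have hi1 : Integrable (fun x => f x * v.fn x) D.vol :=
    MemLp.integrable_mul (Lp.memLp _) (Lp.memLp _)
  have hi2 : Integrable (fun x => D.h x * (u.fn x * v.fn x)) D.vol := by
    refine Integrable.bdd_mul (c := A) (MemLp.integrable_mul (Lp.memLp _) (Lp.memLp _))
      D.measurable_h.aestronglyMeasurable ?_
    filter_upwards [hA] with x hx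
    exact hx
  have e1 : inner ℝ ψ.fst (toL2c v.fn) = ∫ x in D.Ω, (D.h x * (u.fn x * v.fn x) + f x * v.fn x) := by
    rw [inner_L2c]
    refine integral_congr_ae ?_
    filter_upwards [h4, coeFn_toL2c v.fn, hM] with x a1 a2 a3
    have : D.c x ≠ 0 := (hm.trans_le a3.1).ne'
    rw [a1, a2]
    field_simp
  have e2 : inner ℝ (D.velocity φ.fst) (toL2c v.fn) = ∫ x in D.Ω, D.h x * (u.fn x * v.fn x) := by
    rw [inner_L2c]
    refine integral_congr_ae ?_
    filter_upwards [coeFn_velocity φ.fst, h2, coeFn_toL2c v.fn, hM] with x a0 a1 a2 a3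
    have : D.c x ≠ 0 := (hm.trans_le a3.1).ne'
    rw [a0, a1, a2]
    field_simp
  rw [e1, e2, integral_add hi2 hi1, h1 v]

theorem inner_space (φ ψ : D.Space) :
    inner ℝ φ ψ = inner ℝ φ.fst ψ.fst + inner ℝ φ.snd ψ.snd :=
  WithLp.prod_inner_apply φ ψ

theorem inner_toH (s t : D.V) : inner ℝ s.toH t.toH = inner ℝ s t :=
  SeparationQuotient.inner_mk_mk s t

theorem P_fst (φ : D.Space) : (D.P φ).fst = φ.fst := rfl

theorem P_snd (φ : D.Space) : (D.P φ).snd = 0 := rfl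

theorem norm_P (φ : D.Space) : ‖D.P φ‖ = ‖φ.fst‖ := by
  have : ‖D.P φ‖ ^ 2 = ‖φ.fst‖ ^ 2 := by
    rw [← real_inner_self_eq_norm_sq, inner_space, P_fst, P_snd, inner_zero_left, add_zero,
      real_inner_self_eq_norm_sq]
  exact (sq_eq_sq₀ (norm_nonneg _) (norm_nonneg _)).1 this

theorem inner_P (φ ψ : D.Space) : inner ℝ (D.P φ) ψ = inner ℝ (D.P φ) (D.P ψ) := by
  rw [inner_space, inner_space, P_fst, P_fst, P_snd, P_snd, inner_zero_left, inner_zero_left]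

theorem reflForm_P (φ ψ : D.Space) :
    reflForm D.P φ ψ = inner ℝ φ.fst ψ.fst - inner ℝ φ.snd ψ.snd := by
  rw [reflForm, ← inner_P, inner_space (D.P φ), inner_space φ, P_fst, P_snd, inner_zero_left]
  ring

/-- Both pairings consist of the velocity term and the mixed products ⟨s, u'⟩ and ⟨u, s'⟩. In the
inner product the mixed terms add up symmetrically; in the form of 2P − 1 they have opposite signs
and cancel in the sum. -/
theorem IsImage.inner_symm {φ ψ φ' ψ' : D.Space} (h : IsImage φ ψ) (h' : IsImage φ' ψ') :
    inner ℝ ψ φ' = inner ℝ φ ψ' ∧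
      reflForm D.P ψ φ' + reflForm D.P φ ψ' = 2 * D.velocityForm φ φ' := by
  obtain ⟨u, s, f, h1, h2, h3, h4, h5⟩ := h
  obtain ⟨u', s', f', h1', h2', h3', h4', h5'⟩ := h'
  have a1 := inner_fst_of_isNegDiv h1 h2 h4 u'
  have a2 := inner_fst_of_isNegDiv h1' h2' h4' u
  rw [← eq_toL2c h2'] at a1
  rw [← eq_toL2c h2, real_inner_comm, inner_velocity_comm] at a2
  have a3 := real_inner_comm s' u
  have a4 := real_inner_comm s u'
  constructor
  · rw [inner_space, inner_space, a1, a2, h5, h5', h3, h3', inner_toH, inner_toH]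
    linarith
  · rw [reflForm_P, reflForm_P, a1, a2, h5, h5', h3, h3', inner_toH, inner_toH, velocityForm_apply]
    linarith

theorem norm_toH (s : D.V) : ‖s.toH‖ = ‖s‖ := SeparationQuotient.norm_mk s

theorem toH_sub (s t : D.V) : (s - t).toH = s.toH - t.toH := rfl

/-- The domain of the Graetz operator with the graph norm is compactly embedded: a bounded sequence
in it is not separated. -/
theorem exists_norm_sub_lt {φ ψ : ℕ → D.Space} (h : ∀ n, IsImage (φ n) (ψ n)) {R : ℝ}
    (hφ : ∀ n, ‖φ n‖ ≤ R) (hψ : ∀ n, ‖ψ n‖ ≤ R) : ∃ n m, n ≠ m ∧ ‖φ n - φ m‖ < 1 := by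
  choose u s f h1 h2 h3 h4 h5 using h
  obtain ⟨N, C, hC, hN⟩ := D.exists_bounded_normalize
  obtain ⟨Cg, hCg, hgrad⟩ := D.exists_grad_bound
  obtain ⟨Cc, hCc, htoL⟩ := D.exists_toL2c_bounds
  have hR : 0 ≤ R := (norm_nonneg _).trans (hφ 0)
  have hfst : ∀ x : D.Space, ‖x.fst‖ ≤ ‖x‖ := fun x => by
    rw [← norm_P]
    have h1 : ‖D.P x‖ ^ 2 ≤ ‖x‖ ^ 2 := by
      rw [norm_P, ← real_inner_self_eq_norm_sq, ← real_inner_self_eq_norm_sq, inner_space x x]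
      linarith [real_inner_self_nonneg (x := x.snd)]
    exact le_of_sq_le_sq h1 (norm_nonneg _)
  have hsnd : ∀ x : D.Space, ‖x.snd‖ ≤ ‖x‖ := fun x => by
    have h1 : ‖x.snd‖ ^ 2 ≤ ‖x‖ ^ 2 := by
      rw [← real_inner_self_eq_norm_sq, ← real_inner_self_eq_norm_sq, inner_space x x]
      linarith [real_inner_self_nonneg (x := x.fst)]
    exact le_of_sq_le_sq h1 (norm_nonneg _)
  -- A function of energy zero is orthogonal to everything in the energy product, so normalization
  -- changes neither inner products nor norms.
  have hinner : ∀ (t v : D.V), inner ℝ (N t) v = inner ℝ t v := fun t v => by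
    have a1 := abs_real_inner_le_norm (t - N t) v
    rw [(hN t).1, zero_mul] at a1
    have a2 := abs_nonpos_iff.1 a1
    rw [inner_sub_left] at a2
    linarith
  have hnorm : ∀ t, ‖N t‖ = ‖t‖ := fun t => by
    have a1 : ‖N t‖ ^ 2 = ‖t‖ ^ 2 := by
      rw [← real_inner_self_eq_norm_sq, ← real_inner_self_eq_norm_sq, hinner, real_inner_comm, hinner]
    exact (sq_eq_sq₀ (norm_nonneg _) (norm_nonneg _)).1 a1
  have hun : ∀ n, ‖u n‖ ≤ R := fun n => by
    rw [← norm_toH, ← h5]; exact (hsnd _).trans (hψ n)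
  have hsn : ∀ n, ‖s n‖ ≤ R := fun n => by
    rw [← norm_toH, ← h3]; exact (hsnd _).trans (hφ n)
  have hufn : ∀ n, ‖(u n).fn‖ ≤ Cc * R := fun n => by
    refine (htoL _).2.trans ?_
    rw [← eq_toL2c (h2 n)]
    gcongr
    exact (hfst _).trans (hφ n)
  -- The second component of the image is u, so its energy is bounded and Rellich's theorem applies
  -- to u; the normalized s is extracted along a further subsequence.
  obtain ⟨g, ns, hns, hg⟩ := exists_subseq_tendsto_fn u (R := max (Cc * R) (Cg * R))
    (fun n => (hufn n).trans (le_max_left _ _))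
    (fun n => ((hgrad _).trans (by gcongr; exact hun n)).trans (le_max_right _ _))
  obtain ⟨g', ms, hms, hg'⟩ := exists_subseq_tendsto_fn (fun n => N (s (ns n))) (R := C * R)
    (fun n => (norm_fst_le (N (s (ns n))).1).trans ((hN _).2.trans (by gcongr; exact hsn _)))
    (fun n => ((norm_fst_le (N (s (ns n))).1.2).trans (norm_snd_le (N (s (ns n))).1)).trans
      ((hN _).2.trans (by gcongr; exact hsn _)))
  have hg2 := hg.comp hms.tendsto_atTop
  set K := 2 * R * (1 + ‖D.velocity‖) * Cc + 1 with hK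
  have hK0 : 0 < K := by positivity
  obtain ⟨N1, hN1⟩ := Metric.cauchySeq_iff.1 hg2.cauchySeq (1 / (2 * Cc)) (by positivity)
  obtain ⟨N2, hN2⟩ := Metric.cauchySeq_iff.1 hg'.cauchySeq (1 / (4 * K)) (by positivity)
  set a := ns (ms (max N1 N2)) with ha
  set b := ns (ms (max N1 N2 + 1)) with hb
  refine ⟨a, b, (hns (hms (Nat.lt_succ_self _))).ne, ?_⟩
  have d1 : ‖(u a - u b).fn‖ < 1 / (2 * Cc) := by
    rw [V.fn_sub, ← dist_eq_norm]
    exact hN1 _ (le_max_left _ _) _ ((le_max_left _ _).trans (Nat.le_succ _))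
  have d2 : ‖(N (s a) - N (s b)).fn‖ < 1 / (4 * K) := by
    rw [V.fn_sub, ← dist_eq_norm]
    exact hN2 _ (le_max_right _ _) _ ((le_max_right _ _).trans (Nat.le_succ _))
  have b1 : ‖(φ a - φ b).fst‖ < 1 / 2 := by
    have e : (φ a - φ b).fst = toL2c (u a - u b).fn := by
      rw [V.fn_sub, toL2c_sub, ← eq_toL2c (h2 a), ← eq_toL2c (h2 b)]; rfl
    rw [e]
    refine (htoL _).1.trans_lt ?_
    calc Cc * ‖(u a - u b).fn‖ < Cc * (1 / (2 * Cc)) := by gcongr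
      _ = 1 / 2 := by field_simp
  set v := N (s a) - N (s b) with hv
  have b2 : ‖(φ a - φ b).snd‖ = ‖v‖ := by
    have e : (φ a - φ b).snd = (s a - s b).toH := by
      rw [toH_sub, ← h3, ← h3]; rfl
    rw [e, norm_toH, hv, ← map_sub, hnorm]
  -- L² convergence of s is upgraded to energy convergence by testing the equation with v: the
  -- energy of v equals an L² pairing of bounded data with v itself. The constant K collects the
  -- bounds of these data.
  have b3 : ‖v‖ ^ 2 ≤ 1 / 4 := by
    have c1 := inner_fst_of_isNegDiv (h1 a) (h2 a) (h4 a) v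
    have c2 := inner_fst_of_isNegDiv (h1 b) (h2 b) (h4 b) v
    have c3 : ‖v‖ ^ 2 = inner ℝ ((ψ a).fst - (ψ b).fst) (toL2c v.fn)
        - inner ℝ (D.velocity ((φ a).fst - (φ b).fst)) (toL2c v.fn) := by
      rw [← real_inner_self_eq_norm_sq, map_sub, inner_sub_left, inner_sub_left, c1, c2]
      nth_rewrite 1 [hv]
      rw [inner_sub_left, hinner, hinner]
      ring
    have c4 : ‖toL2c v.fn‖ ≤ Cc * (1 / (4 * K)) := (htoL _).1.trans (by gcongr)
    have c5 : ‖(ψ a).fst - (ψ b).fst‖ ≤ 2 * R :=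
      (norm_sub_le _ _).trans (by linarith [(hfst _).trans (hψ a), (hfst _).trans (hψ b)])
    have c6 : ‖(φ a).fst - (φ b).fst‖ ≤ 2 * R :=
      (norm_sub_le _ _).trans (by linarith [(hfst _).trans (hφ a), (hfst _).trans (hφ b)])
    have c7 : ‖D.velocity ((φ a).fst - (φ b).fst)‖ ≤ ‖D.velocity‖ * (2 * R) :=
      (D.velocity.le_opNorm _).trans (by gcongr)
    have c8 := abs_real_inner_le_norm ((ψ a).fst - (ψ b).fst) (toL2c v.fn)
    have c9 := abs_real_inner_le_norm (D.velocity ((φ a).fst - (φ b).fst)) (toL2c v.fn)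
    calc ‖v‖ ^ 2 ≤ 2 * R * (Cc * (1 / (4 * K))) + ‖D.velocity‖ * (2 * R) * (Cc * (1 / (4 * K))) := by
          have c10 : ‖(ψ a).fst - (ψ b).fst‖ * ‖toL2c v.fn‖ ≤ 2 * R * (Cc * (1 / (4 * K))) := by gcongr
          have c11 : ‖D.velocity ((φ a).fst - (φ b).fst)‖ * ‖toL2c v.fn‖
              ≤ ‖D.velocity‖ * (2 * R) * (Cc * (1 / (4 * K))) := by gcongr
          rw [c3]
          linarith [(abs_le.1 c8).2, (abs_le.1 c9).1]
      _ = (K - 1) / K * (1 / 4) := by rw [hK]; field_simp; ring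
      _ ≤ 1 * (1 / 4) := by
          gcongr
          rw [div_le_one hK0]; linarith
      _ = 1 / 4 := one_mul _
  have b4 : ‖φ a - φ b‖ ^ 2 < 1 := by
    rw [← real_inner_self_eq_norm_sq, inner_space, real_inner_self_eq_norm_sq,
      real_inner_self_eq_norm_sq, b2]
    have : ‖(φ a - φ b).fst‖ ^ 2 < (1 / 2) ^ 2 := by gcongr
    linarith
  exact (sq_lt_one_iff₀ (norm_nonneg _)).1 b4

theorem mem_eigenspace_iff {μ : ℝ} {φ : D.Space} : φ ∈ D.eigenspace μ ↔ IsImage φ (μ • φ) := Iff.rfl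

theorem eigenspace_orthogonal {μ ν : ℝ} (hμν : μ ≠ ν) {φ ψ : D.Space} (hφ : φ ∈ D.eigenspace μ)
    (hψ : ψ ∈ D.eigenspace ν) : inner ℝ φ ψ = 0 := by
  have h := (IsImage.inner_symm (mem_eigenspace_iff.1 hφ) (mem_eigenspace_iff.1 hψ)).1
  rw [real_inner_smul_left, real_inner_smul_right] at h
  have h' : (μ - ν) * inner ℝ φ ψ = 0 := by linarith
  exact (mul_eq_zero.1 h').resolve_left (sub_ne_zero.2 hμν)

theorem add_mul_reflForm {μ ν : ℝ} {φ ψ : D.Space} (hφ : φ ∈ D.eigenspace μ)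
    (hψ : ψ ∈ D.eigenspace ν) : (μ + ν) * reflForm D.P φ ψ = 2 * D.velocityForm φ ψ := by
  have h := (IsImage.inner_symm (mem_eigenspace_iff.1 hφ) (mem_eigenspace_iff.1 hψ)).2
  rw [reflForm_smul_left, reflForm_comm D.P φ (ν • ψ), reflForm_smul_left,
    reflForm_comm D.P ψ φ] at h
  linarith

/-- On sums of eigenvectors with |μ| ≤ R the operator is bounded by R, because eigenspaces are
orthogonal; so bounded sequences there are bounded in the graph norm. -/
theorem exists_image_of_mem_iSup {R : ℝ} {φ : D.Space}
    (hφ : φ ∈ ⨆ μ : {μ : ℝ // |μ| ≤ R}, D.eigenspace μ) :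
    ∃ ψ, IsImage φ ψ ∧ ‖ψ‖ ≤ R * ‖φ‖ := by
  classical
  rw [Submodule.mem_iSup_iff_exists_finsupp] at hφ
  obtain ⟨x, hx, rfl⟩ := hφ
  have horth : ∀ i j : {μ : ℝ // |μ| ≤ R}, i ≠ j → ∀ x ∈ D.eigenspace i, ∀ y ∈ D.eigenspace j,
      inner ℝ x y = 0 := fun i j hij x hx y hy =>
    eigenspace_orthogonal (fun h => hij (Subtype.ext h)) hx hy
  refine ⟨∑ i ∈ x.support, (i : ℝ) • x i, ?_, ?_⟩
  · have h1 : (∑ i ∈ x.support, (x i, (i : ℝ) • x i)) ∈ D.graph :=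
      Submodule.sum_mem _ fun i _ => hx i
    have h2 : IsImage (∑ i ∈ x.support, (x i, (i : ℝ) • x i)).1
      (∑ i ∈ x.support, (x i, (i : ℝ) • x i)).2 := h1
    rw [Prod.fst_sum, Prod.snd_sum] at h2
    exact h2
  · have e1 : x.sum (fun _ y => y) = ∑ i ∈ x.support, x i := rfl
    by_cases hne : x.support.Nonempty
    · have hR : 0 ≤ R := (abs_nonneg _).trans hne.choose.2
      refine le_of_sq_le_sq ?_ (by positivity)
      rw [e1, mul_pow, norm_sum_sq horth _ hx,
        norm_sum_sq horth _ fun i => Submodule.smul_mem _ _ (hx i), Finset.mul_sum]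
      refine Finset.sum_le_sum fun i _ => ?_
      rw [norm_smul, mul_pow, Real.norm_eq_abs]
      gcongr
      exact i.2
    · rw [e1, Finset.not_nonempty_iff_eq_empty.1 hne]
      simp

/-- Riesz's lemma: an infinite-dimensional normed space contains a bounded sequence with mutual
distances at least 1, which the compactness of the domain excludes. -/
theorem finiteDimensional_iSup_eigenspace (R : ℝ) :
    FiniteDimensional ℝ (⨆ μ : {μ : ℝ // |μ| ≤ R}, D.eigenspace μ : Submodule ℝ D.Space) := by
  by_contra hfin
  obtain ⟨R', f, hR', hf, hsep⟩ := exists_seq_norm_le_one_le_norm_sub hfin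
  choose ψ hψ hψle using fun n => exists_image_of_mem_iSup (f n).2
  obtain ⟨n, m, hnm, hlt⟩ := exists_norm_sub_lt (R := max R' (|R| * R')) hψ
    (fun n => (hf n).trans (le_max_left _ _))
    (fun n => (hψle n).trans (le_trans (by
      have := hf n
      gcongr
      · exact le_abs_self R
      · exact this) (le_max_right _ _)))
  exact absurd hlt (not_lt.2 (hsep hnm))

instance (μ : ℝ) : FiniteDimensional ℝ (D.eigenspace μ) := by
  have := finiteDimensional_iSup_eigenspace (D := D) |μ|
  exact Submodule.finiteDimensional_of_le
    (le_iSup (fun ν : {ν : ℝ // |ν| ≤ |μ|} => D.eigenspace ν) ⟨μ, le_rfl⟩)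

/-- Eigenvectors for distinct eigenvalues are orthogonal, hence independent, in a finite-dimensional
space. -/
theorem finite_eigenvalues (R : ℝ) : {μ : ℝ | D.eigenspace μ ≠ ⊥ ∧ |μ| ≤ R}.Finite := by
  have := finiteDimensional_iSup_eigenspace (D := D) R
  have hex : ∀ μ : {μ : ℝ | D.eigenspace μ ≠ ⊥ ∧ |μ| ≤ R}, ∃ x ∈ D.eigenspace μ, x ≠ 0 := fun μ =>
    (Submodule.ne_bot_iff _).1 μ.2.1
  choose x hx hx0 using hex
  set y : {μ : ℝ | D.eigenspace μ ≠ ⊥ ∧ |μ| ≤ R} →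
      (⨆ μ : {μ : ℝ // |μ| ≤ R}, D.eigenspace μ : Submodule ℝ D.Space) :=
    fun μ => ⟨x μ, Submodule.mem_iSup_of_mem ⟨μ, μ.2.2⟩ (hx μ)⟩ with hy
  have hli : LinearIndependent ℝ y := by
    refine linearIndependent_of_ne_zero_of_inner_eq_zero (fun μ h => hx0 μ (congrArg Subtype.val h)) ?_
    intro μ ν hμν
    exact eigenspace_orthogonal (fun h => hμν (Subtype.ext h)) (hx μ) (hx ν)
  exact Set.finite_coe_iff.1 hli.finite

end Data

end Graetz

/-! ### Application to the positive and the negative spectral space -/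

namespace Graetz

namespace Data

variable {D : Data}

/-- The sign ε treats both halves of the spectrum at once: the weights ε μ equal |μ|, and
multiplying the relation by ε puts the sign into the form k. -/
theorem lyapunovFamily {S : Set ℝ} {ε : ℝ} (hε : |ε| = 1) (hS : ∀ μ ∈ S, 0 < ε * μ) :
    LyapunovFamily (fun μ : S => D.eigenspace μ) (fun μ : S => ε * (μ : ℝ)) D.P
      (ε • D.velocityForm) (‖D.velocity‖ + 1) where
  finite_dim _ := inferInstance
  orth μ ν hμν _ hx _ hy := eigenspace_orthogonal (fun h => hμν (Subtype.ext h)) hx hy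
  pos μ := hS μ μ.2
  discrete R := by
    refine ((finite_eigenvalues (D := D) R).preimage Subtype.val_injective.injOn).subset ?_
    rintro μ ⟨h1, h2⟩
    refine ⟨h1, ?_⟩
    have h3 : |(μ : ℝ)| = ε * μ := by
      rw [← abs_of_pos (hS μ μ.2), abs_mul, hε, one_mul]
    exact h3.trans_le h2
  proj := inner_P
  bound_pos := by positivity
  bound x y := by
    rw [LinearMap.smul_apply, LinearMap.smul_apply, smul_eq_mul, abs_mul, hε, one_mul,
      velocityForm_apply, norm_P, norm_P, ← mul_assoc]
    refine (abs_real_inner_le_norm _ _).trans ?_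
    gcongr
    refine (D.velocity.le_opNorm _).trans ?_
    gcongr
    linarith
  relation μ ν x hx y hy := by
    rw [LinearMap.smul_apply, LinearMap.smul_apply, smul_eq_mul]
    linear_combination ε * add_mul_reflForm hx hy

theorem eigenProj_eq (μ : ℝ) (φ : D.Space) [CompleteSpace D.Space] :
    D.eigenProj μ φ = (D.eigenspace μ).starProjection φ := by
  have h : (D.eigenspace μ).topologicalClosure = D.eigenspace μ :=
    (D.eigenspace μ).closed_of_finiteDimensional.submodule_topologicalClosure_eq
  unfold eigenProj
  congr! 1
  simp only [h]

theorem spectralSpace_eq (S : Set ℝ) :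
    D.spectralSpace S = (⨆ μ : S, D.eigenspace μ).topologicalClosure := by
  rw [spectralSpace, iSup_subtype']

theorem starProjection_eigenspace_eq_zero {S : Set ℝ} {μ : ℝ} (hμ : μ ∉ S) {φ : D.Space}
    (hφ : φ ∈ D.spectralSpace S) : (D.eigenspace μ).starProjection φ = 0 := by
  rw [Submodule.starProjection_apply_eq_zero_iff]
  refine Submodule.topologicalClosure_minimal _ ?_ (Submodule.isClosed_orthogonal _) hφ
  refine iSup₂_le fun ν hν ψ hψ => ?_
  rw [Submodule.mem_orthogonal]
  exact fun u hu => eigenspace_orthogonal (fun h : μ = ν => hμ (h ▸ hν)) hu hψ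

/-- Eigenspaces for eigenvalues outside S are orthogonal to the spectral space, so only the terms
with index in S survive. -/
theorem powNorm_half [CompleteSpace D.Space] {S : Set ℝ} {ε : ℝ} (hε : |ε| = 1)
    (hS : ∀ μ ∈ S, 0 < ε * μ) {φ : D.Space} (hφ : φ ∈ D.spectralSpace S) :
    D.powNorm (1 / 2) φ = LyapunovFamily.weightedSq (fun μ : S => D.eigenspace μ)
      (fun μ : S => ε * (μ : ℝ)) φ ^ (1 / 2 : ℝ) := by
  unfold powNorm LyapunovFamily.weightedSq
  congr 1
  rw [← tsum_subtype_eq_of_support_subset (s := S)]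
  · refine tsum_congr fun μ => ?_
    beta_reduce
    rw [eigenProj_eq, mul_one_div_cancel two_ne_zero, Real.rpow_one,
      ← abs_of_pos (hS μ μ.2), abs_mul, hε, one_mul]
  · intro μ hμ
    by_contra hμS
    exact hμ (by beta_reduce; rw [eigenProj_eq, starProjection_eigenspace_eq_zero hμS hφ]; simp)

theorem invertibleWithBounds [CompleteSpace D.Space] {S : Set ℝ} {ε : ℝ} (hε : |ε| = 1)
    (hS : ∀ μ ∈ S, 0 < ε * μ) : D.InvertibleWithBounds S := by
  have hL := lyapunovFamily (D := D) hε hS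
  have hinv : (D.compression S).IsInvertible := hL.isInvertible_compress (spectralSpace_eq S)
  have hT : ∀ x, D.compression S ((D.compression S).inverse x) = x := by
    obtain ⟨e, he⟩ := hinv
    intro x
    rw [← he, ContinuousLinearMap.inverse_equiv]
    exact e.apply_symm_apply x
  have hB : ∀ φ, D.B S φ =
      ((D.compression S).inverse ((D.spectralSpace S).orthogonalProjectionOnto φ) : D.Space) :=
    fun _ => rfl
  -- Self-adjointness of B: (Bφ | ψ) = (Bφ | πψ) = (Bφ | πP Bψ) = (PBφ | PBψ), which is symmetric in
  -- φ and ψ.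
  have hsymm : ∀ φ ψ, inner ℝ (D.B S φ) ψ = inner ℝ (D.P (D.B S φ)) (D.P (D.B S ψ)) := by
    intro φ ψ
    have hmem : D.B S φ ∈ D.spectralSpace S := Subtype.coe_prop _
    have h1 := hL.inner_compress
      ((D.compression S).inverse ((D.spectralSpace S).orthogonalProjectionOnto ψ)) hmem
    change inner ℝ (D.compression S _ : D.Space) _ = _ at h1
    rw [hT, ← Submodule.starProjection_apply, Submodule.inner_starProjection_left_eq_right,
      Submodule.starProjection_eq_self_iff.2 hmem] at h1
    rw [real_inner_comm ψ, h1, hB ψ, real_inner_comm]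
  refine ⟨hinv, ?_, ?_⟩
  · rw [ContinuousLinearMap.isSelfAdjoint_iff_isSymmetric]
    intro φ ψ
    change inner ℝ (D.B S φ) ψ = inner ℝ φ (D.B S ψ)
    rw [real_inner_comm (D.B S ψ) φ, hsymm, hsymm, real_inner_comm]
  · obtain ⟨M, hM, hbound⟩ := hL.exists_bounds (spectralSpace_eq S)
    refine ⟨M, hM, fun φ => ?_⟩
    have hb := hbound ((D.compression S).inverse
      ((D.spectralSpace S).orthogonalProjectionOnto φ))
    change _ ≤ M * ‖D.compression S _‖ ∧ _ ≤ _ * LyapunovFamily.weightedSq _ _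
      (D.compression S _ : D.Space) at hb
    rw [hT] at hb
    refine ⟨hb.1, ?_⟩
    have hBmem : D.B S φ ∈ D.spectralSpace S := Subtype.coe_prop _
    have hmem : D.proj S φ ∈ D.spectralSpace S := Subtype.coe_prop _
    rw [powNorm_half hε hS hBmem, powNorm_half hε hS hmem]
    refine (ENNReal.rpow_le_rpow hb.2 (by norm_num)).trans_eq ?_
    rw [ENNReal.mul_rpow_of_nonneg _ _ (by norm_num),
      ENNReal.ofReal_rpow_of_nonneg (by positivity) (by norm_num), ← Real.sqrt_eq_rpow,
      Real.sqrt_sq hM.le]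
    rfl

end Data

end Graetz

/-- For every Graetz problem, the form is definite on `H` and the space of pairs is a Hilbert space;
`π₋ P π₋` and `π₊ P π₊` are invertible on the ranges of `π₋` and `π₊`, and `B₋`, `B₊` are
self-adjoint and bounded in the norm of the space and in the `1/2`-norm. -/
theorem mainTheorem1 (D : Graetz.Data) :
    (∀ s : D.V, Graetz.Data.energy s s = 0 ↔ D.IsNegligible s) ∧
      ∃ _ : CompleteSpace D.Space,
        D.InvertibleWithBounds (Set.Iio 0) ∧ D.InvertibleWithBounds (Set.Ioi 0) :=
  ⟨Graetz.Data.energy_eq_zero_iff, inferInstance,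
    Graetz.Data.invertibleWithBounds (ε := -1) (by simp) fun μ hμ => by
      simpa using Set.mem_Iio.1 hμ,
    Graetz.Data.invertibleWithBounds (ε := 1) (by simp) fun μ hμ => by
      simpa using Set.mem_Ioi.1 hμ⟩
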